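/- **Setting.** Let $d\ge 3$, $\lambda\ge 0$, $r_0\ge 1$, and write $r=|x|$. Let $S\subset\mathbb R^d$ be a closed Lebesgue-null cone with vertex $0\in S$ (that is, $tx\in S$ for $x\in S$, $t>0$), for instance $S=\{0\}$. Let $A\in C^1(\mathbb R^d\setminus S;\mathbb R^d)$ and let $V:\mathbb R^d\to\mathbb R$ be measurable. Put $\nabla_A=\nabla+iA$, $H_{A,V}=\nabla_A^2+V$, $B_{kj}=\partial_jA_k-\partial_kA_j$, $(B_\tau)_j=\sum_k\frac{x_k}{|x|}B_{kj}$. Write $a_\pm$ for the positive and negative parts of $a$. All pointwise bounds below are required at the points of $\mathbb R^d\setminus S$. *Assumption 1.* There are constants $\nu_1,\nu_2,\mu_1,\mu_2$ with $\nu_1^2+2\mu_1<2(d-1)(d-2)$ and $\frac23\nu_2^2+\mu_2<1$ such that $|B_\tau|\le\nu_1/r^2$ and $(\partial_rV)_-\le\mu_1/r^3$ for $r\le r_0$, and $|B_\tau|\le\nu_2/r$ and $(\partial_rV)_-\le\mu_2/r$ for $r>r_0$. *Assumption 2.* There are constants $\nu_1,\mu_1$ and $c,\mu>0$ with $\nu_1^2+2\mu_1<2(d-1)(d-2)$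 such that $|B_\tau|\le\nu_1/r^2$ and $(\partial_rV)_-\le\mu_1/r^3$ for $r\le r_0$, and $|B_\tau|\le c/r^{1+\mu}$ and $(\partial_rV)_-\le c/r^{1+\mu}$ for $r>r_0$. *The space $\mathcal H^1$.* A function $u\in L^2(\mathbb R^d;\mathbb C)$ belongs to $\mathcal H^1$, the $L^2$ domain of $H_{A,V}$, if (a) there are $\varphi_n\in C_c^\infty(\mathbb R^d\setminus S;\mathbb C)$ and a measurable $G:\mathbb R^d\to\mathbb C^d$ with $\varphi_n\to u$ and $\nabla_A\varphi_n\to G$ in $L^2(K)$ for every compact $K\subset\mathbb R^d\setminus\{0\}$ (then $\nabla_Au:=G$), and (b) there is $h\in L^2(\mathbb R^d)$ with $\int(-\nabla_Au\cdot\overline{\nabla_A\varphi}+Vu\overline\varphi)\,dx=\int h\overline\varphi\,dx$ for all $\varphi\in C_c^\infty(\mathbb R^d\setminus S;\mathbb C)$ (then $H_{A,V}u:=h$). **Theorem.** Assume that one of the following holds. (i) $V$ is bounded on $K\setminus S$ for every compact $K\subset\mathbb R^d\setminus\{0\}$, $\partial_rV$ exists at every point of $\mathbb R^d\setminus S$,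 Assumption 1 or Assumption 2 holds, and for some constant $\kappa>\frac{d-2}{r_0(2+\log r_0)}$ and all $r>r_0$, $$V_-\le \kappa(\log r+2)\Big[\kappa(\log r+2)+\frac{d-1}{r}\Big]+\frac{\kappa}{2r}+V_+ .$$ (ii) $B_\tau$ satisfies the bounds on $B_\tau$ in Assumption 1 with $\nu_1^2<2(d-1)(d-2)$ and $\frac23\nu_2^2<1$, or those in Assumption 2 with $\nu_1^2<2(d-1)(d-2)$ and $c,\mu>0$; and for some $\gamma_1,\gamma_2>0$, $|V|\le\gamma_1r^{-3/2}$ for $r\le r_0$ and $|V|\le\gamma_2(\log r+1)^{1/2}r^{-1/2}$ for $r>r_0$. If $u\in\mathcal H^1$ satisfies $(H_{A,V}+\lambda)u=0$ almost everywhere and, for every $m>0$, $$\int_{|x|>R}\big(|u|^2+|\nabla_Au|^2\big)\,dx=O\big(e^{-mR(1+\log R)}\big)\qquad(R\to\infty),$$ then $u=0$ almost everywhere. -/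

import Mathlib

open MeasureTheory Filter Topology
open scoped ContDiff ENNReal

namespace MagneticSchrodinger

noncomputable section

/-- Euclidean space `ℝ^d`. -/
abbrev Space (d : ℕ) := EuclideanSpace ℝ (Fin d)

/-- The `j`-th coordinate vector of `ℝ^d`. -/
def coordVec {d : ℕ} (j : Fin d) : Space d := EuclideanSpace.single j (1 : ℝ)

/-- The sets on which the magnetic potential may be singular: closed Lebesgue-null cones with
vertex at the origin. The basic example is `{0}`; for the Aharonov-Bohm potential it is a line. -/
structure IsSingularCone {d : ℕ} (S : Set (Space d)) : Prop where
  isClosed : IsClosed S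
  zero_mem : (0 : Space d) ∈ S
  smul_mem : ∀ t : ℝ, 0 < t → ∀ x ∈ S, t • x ∈ S
  null : volume S = 0

/-- The magnetic field `B_{kj} = ∂A_k/∂x_j - ∂A_j/∂x_k`. -/
def magneticField {d : ℕ} (A : Space d → Space d) (x : Space d) : Matrix (Fin d) (Fin d) ℝ :=
  Matrix.of fun k j => fderiv ℝ A x (coordVec j) k - fderiv ℝ A x (coordVec k) j

/-- The tangential part of the magnetic field, `(B_τ)_j = ∑_k (x_k / |x|) B_{kj}`. -/
def tangentialField {d : ℕ} (A : Space d → Space d) (x : Space d) : Space d :=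
  WithLp.toLp 2 fun j => ∑ k, x k / ‖x‖ * magneticField A x k j

/-- `t ↦ V (t x / |x|)`, the restriction of `V` to the ray through `x`. -/
def alongRay {d : ℕ} (V : Space d → ℝ) (x : Space d) (t : ℝ) : ℝ := V (t • (‖x‖⁻¹ • x))

/-- The radial derivative `∂_r V`. -/
def radialDeriv {d : ℕ} (V : Space d → ℝ) (x : Space d) : ℝ := deriv (alongRay V x) ‖x‖

/-- `∂_r V` exists at every point outside `S`. -/
def RadiallyDifferentiableOff {d : ℕ} (S : Set (Space d)) (V : Space d → ℝ) : Prop :=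
  ∀ x ∉ S, DifferentiableAt ℝ (alongRay V x) ‖x‖

/-- `V` is bounded on the compact sets that do not contain the origin (up to the null set `S`). -/
def LocallyBoundedOffOrigin {d : ℕ} (S : Set (Space d)) (V : Space d → ℝ) : Prop :=
  ∀ K : Set (Space d), IsCompact K → (0 : Space d) ∉ K → ∃ C : ℝ, ∀ x ∈ K \ S, |V x| ≤ C

/-- Off `S`, the function `F` is at most `f r` where `r = |x| ≤ r₀`, and at most `g r` where
`r > r₀`. -/
def TwoZoneBound {d : ℕ} (S : Set (Space d)) (r₀ : ℝ) (F : Space d → ℝ) (f g : ℝ → ℝ) : Prop :=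
  ∀ x ∉ S, F x ≤ if ‖x‖ ≤ r₀ then f ‖x‖ else g ‖x‖

/-- First assumption on `B_τ` and `(∂_r V)_-`. -/
def AssumptionOne {d : ℕ} (S : Set (Space d)) (r₀ : ℝ) (A : Space d → Space d)
    (V : Space d → ℝ) : Prop :=
  ∃ ν₁ ν₂ μ₁ μ₂ : ℝ,
    TwoZoneBound S r₀ (fun x => ‖tangentialField A x‖) (fun r => ν₁ / r ^ 2) (fun r => ν₂ / r) ∧
    TwoZoneBound S r₀ (fun x => (radialDeriv V x)⁻) (fun r => μ₁ / r ^ 3) (fun r => μ₂ / r) ∧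
    ν₁ ^ 2 + 2 * μ₁ < 2 * ((d : ℝ) - 1) * ((d : ℝ) - 2) ∧
    2 / 3 * ν₂ ^ 2 + μ₂ < 1

/-- Second assumption on `B_τ` and `(∂_r V)_-`. -/
def AssumptionTwo {d : ℕ} (S : Set (Space d)) (r₀ : ℝ) (A : Space d → Space d)
    (V : Space d → ℝ) : Prop :=
  ∃ ν₁ μ₁ c μ : ℝ, 0 < c ∧ 0 < μ ∧
    TwoZoneBound S r₀ (fun x => ‖tangentialField A x‖)
      (fun r => ν₁ / r ^ 2) (fun r => c / r ^ (1 + μ)) ∧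
    TwoZoneBound S r₀ (fun x => (radialDeriv V x)⁻)
      (fun r => μ₁ / r ^ 3) (fun r => c / r ^ (1 + μ)) ∧
    ν₁ ^ 2 + 2 * μ₁ < 2 * ((d : ℝ) - 1) * ((d : ℝ) - 2)

/-- The part of the first assumption that concerns `B_τ` only. -/
def FieldAssumptionOne {d : ℕ} (S : Set (Space d)) (r₀ : ℝ) (A : Space d → Space d) : Prop :=
  ∃ ν₁ ν₂ : ℝ,
    TwoZoneBound S r₀ (fun x => ‖tangentialField A x‖) (fun r => ν₁ / r ^ 2) (fun r => ν₂ / r) ∧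
    ν₁ ^ 2 < 2 * ((d : ℝ) - 1) * ((d : ℝ) - 2) ∧
    2 / 3 * ν₂ ^ 2 < 1

/-- The part of the second assumption that concerns `B_τ` only. -/
def FieldAssumptionTwo {d : ℕ} (S : Set (Space d)) (r₀ : ℝ) (A : Space d → Space d) : Prop :=
  ∃ ν₁ c μ : ℝ, 0 < c ∧ 0 < μ ∧
    TwoZoneBound S r₀ (fun x => ‖tangentialField A x‖)
      (fun r => ν₁ / r ^ 2) (fun r => c / r ^ (1 + μ)) ∧
    ν₁ ^ 2 < 2 * ((d : ℝ) - 1) * ((d : ℝ) - 2)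

/-- The lower bound on `V` in `|x| > r₀`; `κ` is the constant `τβ`. -/
def OuterLowerBound {d : ℕ} (S : Set (Space d)) (r₀ : ℝ) (V : Space d → ℝ) : Prop :=
  ∃ κ : ℝ, ((d : ℝ) - 2) / (r₀ * (2 + Real.log r₀)) < κ ∧
    ∀ x ∉ S, r₀ < ‖x‖ →
      (V x)⁻ ≤ κ * (Real.log ‖x‖ + 2) * (κ * (Real.log ‖x‖ + 2) + ((d : ℝ) - 1) / ‖x‖)
        + κ / (2 * ‖x‖) + (V x)⁺

/-- Hypothesis (i). -/
def HypothesisOne {d : ℕ} (S : Set (Space d)) (r₀ : ℝ) (A : Space d → Space d)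
    (V : Space d → ℝ) : Prop :=
  LocallyBoundedOffOrigin S V ∧ RadiallyDifferentiableOff S V ∧
    (AssumptionOne S r₀ A V ∨ AssumptionTwo S r₀ A V) ∧ OuterLowerBound S r₀ V

/-- Hypothesis (ii). -/
def HypothesisTwo {d : ℕ} (S : Set (Space d)) (r₀ : ℝ) (A : Space d → Space d)
    (V : Space d → ℝ) : Prop :=
  (FieldAssumptionOne S r₀ A ∨ FieldAssumptionTwo S r₀ A) ∧
    ∃ γ₁ γ₂ : ℝ, 0 < γ₁ ∧ 0 < γ₂ ∧
      TwoZoneBound S r₀ (fun x => |V x|) (fun r => γ₁ / r ^ (3 / 2 : ℝ))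
        (fun r => γ₂ * (Real.log r + 1) ^ (1 / 2 : ℝ) / r ^ (1 / 2 : ℝ))

/-- Test functions: elements of `C_c^∞(ℝ^d ∖ S; ℂ)`. -/
structure IsTestFunction {d : ℕ} (S : Set (Space d)) (φ : Space d → ℂ) : Prop where
  smooth : ContDiff ℝ ∞ φ
  compact : HasCompactSupport φ
  support : tsupport φ ⊆ Sᶜ

/-- The magnetic gradient `∇_A φ = ∇φ + i A φ` of a smooth function. -/
def magneticGrad {d : ℕ} (A : Space d → Space d) (φ : Space d → ℂ) (x : Space d) :
    EuclideanSpace ℂ (Fin d) :=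
  WithLp.toLp 2 fun j => fderiv ℝ φ x (coordVec j) + Complex.I * (A x j : ℂ) * φ x

/-- `u` is in the local energy space of the potential `A`, with magnetic gradient `G = ∇_A u`:
the pair `(u, G)` is the limit of `(φ_n, ∇_A φ_n)`, `φ_n ∈ C_c^∞(ℝ^d ∖ S)`, in `L²(K)` for every
compact `K ⊆ ℝ^d ∖ {0}`. -/
def HasMagneticGrad {d : ℕ} (S : Set (Space d)) (A : Space d → Space d) (u : Space d → ℂ)
    (G : Space d → EuclideanSpace ℂ (Fin d)) : Prop :=
  AEStronglyMeasurable u volume ∧ AEStronglyMeasurable G volume ∧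
    ∃ φ : ℕ → Space d → ℂ, (∀ n, IsTestFunction S (φ n)) ∧
      ∀ K : Set (Space d), IsCompact K → (0 : Space d) ∉ K →
        Tendsto (fun n => eLpNorm (fun x => φ n x - u x) 2 (volume.restrict K)) atTop (𝓝 0) ∧
        Tendsto (fun n => eLpNorm (fun x => magneticGrad A (φ n) x - G x) 2 (volume.restrict K))
          atTop (𝓝 0)

/-- `h = ∇_A² u + V u` in the sense of distributions on `ℝ^d ∖ S`, where `G = ∇_A u`. (The inner
product is conjugate-linear in its first argument.) -/
def HasMagneticSchrodinger {d : ℕ} (S : Set (Space d)) (A : Space d → Space d) (V : Space d → ℝ)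
    (u : Space d → ℂ) (G : Space d → EuclideanSpace ℂ (Fin d)) (h : Space d → ℂ) : Prop :=
  ∀ φ : Space d → ℂ, IsTestFunction S φ →
    (∫ x, (-(inner ℂ (magneticGrad A φ x) (G x)) + (V x : ℂ) * u x * star (φ x))) =
      ∫ x, h x * star (φ x)

/-- `u` belongs to the distorted Sobolev space `𝓗¹`, the `L²` domain of `H_{A,V} = ∇_A² + V`,
with `G = ∇_A u` and `h = H_{A,V} u`. -/
structure MemDistortedSobolev {d : ℕ} (S : Set (Space d)) (A : Space d → Space d)
    (V : Space d → ℝ) (u : Space d → ℂ) (G : Space d → EuclideanSpace ℂ (Fin d))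
    (h : Space d → ℂ) : Prop where
  memLp : MemLp u 2 volume
  grad : HasMagneticGrad S A u G
  op : HasMagneticSchrodinger S A V u G h
  memLp_op : MemLp h 2 volume

/-- `∫_{|x| > R} (|u|² + |G|²) dx = O(e^{-m R (1 + log R)})` as `R → ∞`, for every `m > 0`. -/
def HasFastDecay {d : ℕ} (u : Space d → ℂ) (G : Space d → EuclideanSpace ℂ (Fin d)) : Prop :=
  ∀ m : ℝ, 0 < m → ∃ C R₁ : ℝ, ∀ R : ℝ, R₁ ≤ R →
    ∫⁻ x in {x : Space d | R < ‖x‖}, (‖u x‖ₑ ^ 2 + ‖G x‖ₑ ^ 2) ≤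
      ENNReal.ofReal (C * Real.exp (-m * R * (1 + Real.log R)))

end

end MagneticSchrodinger

open MagneticSchrodinger

/-! The proof is a Carleman estimate with weight r^{-d} e^{2τφ(r)}, φ(r) = r log r + (K-1) r,
followed by τ → ∞. Put ℓ = φ' = K + log r, with K chosen so that ℓ ≥ 1 for r ≥ ρ. For a cutoff χ
that rises on [ρ, 2ρ] and falls on [R, 2R], and for all large τ, the integral of χ · weight · ℓ |u|²
is at most a constant free of τ times the integral of weight · ℓ² (|u|² + |∇_A u|²) over the two
transition annuli. As R → ∞ the outer annulus disappears: the weight there is of size e^{4τ R log R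
+ O(R)}, and the decay hypothesis, used with an m proportional to τ + 1, beats it
(`tendsto_outer_weight`). What remains compares e^{2τφ(3ρ)} times the mass of u in 3ρ ≤ |x| ≤ L with
e^{2τφ(2ρ)} times a fixed number. Since φ increases, τ → ∞ kills that mass, and ρ and L are
arbitrary (`IsWeakSolution.ae_eq_zero`).

The estimate combines three integral relations: a virial inequality with multiplier f(|x|) x·∇_A w,
the energy identity with multiplier f(|x|) w, and the divergence theorem for f(|x|) |w|² x. The
virial relation would normally need second derivatives of the solution, but only u and ∇_A u are at
hand. So x·∇_A is replaced by difference quotients of the covariant dilations T_s w(x) = exp(i ∫_0^s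
A(e^t x)·e^t x dt) w(e^s x), which it generates. The inverse T_{-s} is the adjoint of T_s up to a
Jacobian, hence in (2s)⁻¹ times the weak equation at T_s w minus that at T_{-s} w the terms
quadratic in ∇_A w become difference quotients of explicit radial weights. The commutator of T_s
with ∇_A consists of the factor e^s and of a defect which, by the homotopy formula for one-forms,
contains only B_τ (`inner_phaseDefect`). The potential plus λ is split as V₁ + V₂: for V₁ a
one-sided bound on V₁(x) - V₁(e^s x) is enough, for V₂ a bound on its size. The outcome is
`integral_radial_nonpos`.

With suitable multipliers the three relations add up to squares plus lower order terms
(`carleman_identity`). The coefficient left in front of |w|² is at least τ²ℓ, which comes from r φ''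
= 1, that is, from the strict convexity of the phase. For large τ this absorbs the field and the
potential (`absorption`). -/

namespace MagneticSchrodinger

noncomputable section

/-! ### Convergence in L² and passage to the limit in integrals -/

section TendstoL2

variable {α ι F F' : Type*} [MeasurableSpace α] {μ : Measure α} {l : Filter ι}
  [NormedAddCommGroup F] [NormedAddCommGroup F']

/-- Convergence in `L²` of functions along a filter. -/
structure TendstoL2 (μ : Measure α) (l : Filter ι) (f : ι → α → F) (g : α → F) : Prop where
  memLp : ∀ i, MemLp (f i) 2 μ
  memLp_lim : MemLp g 2 μ
  tendsto : Tendsto (fun i => eLpNorm (fun x => f i x - g x) 2 μ) l (𝓝 0)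

theorem TendstoL2.const {g : α → F} (hg : MemLp g 2 μ) : TendstoL2 μ l (fun _ => g) g :=
  ⟨fun _ => hg, hg, by simpa using tendsto_const_nhds⟩

/-- The bridge to the normed space `Lp`, from which the rules for sums and differences are
inherited, while the functions themselves keep their values at every point. -/
theorem tendstoL2_of_tendsto_toLp {f : ι → α → F} {g : α → F} (hf : ∀ i, MemLp (f i) 2 μ)
    (hg : MemLp g 2 μ) (h : Tendsto (fun i => (hf i).toLp (f i)) l (𝓝 (hg.toLp g))) :
    TendstoL2 μ l f g :=
  ⟨hf, hg, (Lp.tendsto_Lp_iff_tendsto_eLpNorm'' f hf g hg).1 h⟩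

theorem TendstoL2.tendsto_toLp {f : ι → α → F} {g : α → F} (h : TendstoL2 μ l f g) :
    Tendsto (fun i => (h.memLp i).toLp (f i)) l (𝓝 (h.memLp_lim.toLp g)) :=
  (Lp.tendsto_Lp_iff_tendsto_eLpNorm'' f h.memLp g h.memLp_lim).2 h.tendsto

theorem TendstoL2.add {f f' : ι → α → F} {g g' : α → F} (h : TendstoL2 μ l f g)
    (h' : TendstoL2 μ l f' g') :
    TendstoL2 μ l (fun i x => f i x + f' i x) (fun x => g x + g' x) :=
  tendstoL2_of_tendsto_toLp (fun i => (h.memLp i).add (h'.memLp i)) (h.memLp_lim.add h'.memLp_lim)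
    (h.tendsto_toLp.add h'.tendsto_toLp)

theorem TendstoL2.sub {f f' : ι → α → F} {g g' : α → F} (h : TendstoL2 μ l f g)
    (h' : TendstoL2 μ l f' g') :
    TendstoL2 μ l (fun i x => f i x - f' i x) (fun x => g x - g' x) :=
  tendstoL2_of_tendsto_toLp (fun i => (h.memLp i).sub (h'.memLp i)) (h.memLp_lim.sub h'.memLp_lim)
    (h.tendsto_toLp.sub h'.tendsto_toLp)

theorem TendstoL2.comp {κ : Type*} {l' : Filter κ} {f : ι → α → F} {g : α → F}
    (h : TendstoL2 μ l f g) {j : κ → ι} (hj : Tendsto j l' l) :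
    TendstoL2 μ l' (fun i => f (j i)) g :=
  ⟨fun _ => h.memLp _, h.memLp_lim, h.tendsto.comp hj⟩

theorem TendstoL2.congr_ae {f f' : ι → α → F} {g g' : α → F} (h : TendstoL2 μ l f g)
    (hf : ∀ i, f i =ᵐ[μ] f' i) (hg : g =ᵐ[μ] g') : TendstoL2 μ l f' g' :=
  ⟨fun i => (memLp_congr_ae (hf i)).1 (h.memLp i), (memLp_congr_ae hg).1 h.memLp_lim,
    h.tendsto.congr fun i => eLpNorm_congr_ae ((hf i).sub hg)⟩

/-- A map between function spaces that is pointwise Lipschitz preserves `L²` convergence. -/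
theorem TendstoL2.of_norm_sub_le {f : ι → α → F} {g : α → F} (h : TendstoL2 μ l f g)
    {f' : ι → α → F'} {g' : α → F'} (hf' : ∀ i, MemLp (f' i) 2 μ) (hg' : MemLp g' 2 μ) (M : ℝ)
    (hle : ∀ i, ∀ᵐ x ∂μ, ‖f' i x - g' x‖ ≤ M * ‖f i x - g x‖) : TendstoL2 μ l f' g' := by
  refine ⟨hf', hg', ?_⟩
  have h0 : Tendsto (fun i => ENNReal.ofReal M * eLpNorm (fun x => f i x - g x) 2 μ) l (𝓝 0) := by
    simpa using ENNReal.Tendsto.const_mul h.tendsto (Or.inr ENNReal.ofReal_ne_top)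
  exact tendsto_of_tendsto_of_tendsto_of_le_of_le tendsto_const_nhds h0 (fun _ => zero_le)
    fun i => eLpNorm_le_mul_eLpNorm_of_ae_le_mul (hle i) 2

theorem TendstoL2.norm {f : ι → α → F} {g : α → F} (h : TendstoL2 μ l f g) :
    TendstoL2 μ l (fun i x => ‖f i x‖) (fun x => ‖g x‖) :=
  h.of_norm_sub_le (fun i => (h.memLp i).norm) h.memLp_lim.norm 1
    fun i => Eventually.of_forall fun x => by
      simpa using abs_norm_sub_norm_le (f i x) (g x)

theorem TendstoL2.const_smul {𝕜 : Type*} [NormedField 𝕜] [NormedSpace 𝕜 F]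
    {f : ι → α → F} {g : α → F} (h : TendstoL2 μ l f g) (c : 𝕜) :
    TendstoL2 μ l (fun i x => c • f i x) (fun x => c • g x) :=
  h.of_norm_sub_le (fun i => (h.memLp i).const_smul c) (h.memLp_lim.const_smul c) ‖c‖
    fun i => Eventually.of_forall fun x => by rw [← smul_sub, norm_smul]

/-- Dominated convergence in `L²`. -/
theorem tendstoL2_of_dominated [l.IsCountablyGenerated] {f : ι → α → F} {g : α → F}
    {b : α → F'} (hb : MemLp b 2 μ) (hf : ∀ i, MemLp (f i) 2 μ) (hg : AEStronglyMeasurable g μ)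
    (hgb : ∀ᵐ x ∂μ, ‖g x‖ ≤ ‖b x‖)
    (hfb : ∀ᶠ i in l, ∀ᵐ x ∂μ, ‖f i x - g x‖ ≤ ‖b x‖)
    (hlim : ∀ᵐ x ∂μ, Tendsto (fun i => f i x) l (𝓝 (g x))) : TendstoL2 μ l f g := by
  have hg' : MemLp g 2 μ := hb.of_le_mul (c := 1) hg (by simpa using hgb)
  refine ⟨hf, hg', ?_⟩
  have h2 : (2 : ℝ≥0∞) ≠ 0 := by norm_num
  have h2' : (2 : ℝ≥0∞) ≠ ⊤ := by norm_num
  have key : Tendsto (fun i => ∫⁻ x, ‖f i x - g x‖ₑ ^ (2 : ℝ) ∂μ) l (𝓝 (∫⁻ _, 0 ∂μ)) := by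
    refine tendsto_lintegral_filter_of_dominated_convergence' (fun x => ‖b x‖ₑ ^ (2 : ℝ)) ?_ ?_ ?_ ?_
    · exact Eventually.of_forall fun i => ((hf i).1.sub hg).enorm.pow_const _
    · filter_upwards [hfb] with i hi
      filter_upwards [hi] with x hx
      exact ENNReal.rpow_le_rpow (enorm_le_iff_norm_le.2 hx) (by norm_num)
    · have := lintegral_rpow_enorm_lt_top_of_eLpNorm_lt_top h2 h2' hb.2
      simpa using this.ne
    · filter_upwards [hlim] with x hx
      have h1 : Tendsto (fun i => ‖f i x - g x‖ₑ) l (𝓝 0) := by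
        have h3 := (hx.sub_const (g x)).enorm
        simpa using h3
      have h4 := (ENNReal.continuous_rpow_const (y := (2 : ℝ))).continuousAt.tendsto.comp h1
      rw [ENNReal.zero_rpow_of_pos (by norm_num)] at h4
      exact h4
  have h4 := (ENNReal.continuous_rpow_const (y := (1 / 2 : ℝ))).continuousAt.tendsto.comp key
  simp only [lintegral_zero] at h4
  rw [ENNReal.zero_rpow_of_pos (by norm_num)] at h4
  refine h4.congr fun i => ?_
  rw [eLpNorm_eq_lintegral_rpow_enorm_toReal h2 h2', Function.comp_apply, ENNReal.toReal_ofNat]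

/-- Multiplication by a bounded, pointwise convergent family preserves `L²` convergence. -/
theorem TendstoL2.smul_of_bounded {𝕜 : Type*} [NormedField 𝕜] [NormedSpace 𝕜 F]
    [l.IsCountablyGenerated] {f : ι → α → F} {g : α → F}
    (h : TendstoL2 μ l f g) {m : ι → α → 𝕜} {m₀ : α → 𝕜}
    (hm : ∀ i, AEStronglyMeasurable (m i) μ) (hm₀ : AEStronglyMeasurable m₀ μ) (M : ℝ)
    (hM : ∀ i, ∀ᵐ x ∂μ, ‖m i x‖ ≤ M) (hM₀ : ∀ᵐ x ∂μ, ‖m₀ x‖ ≤ M)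
    (hlim : ∀ᵐ x ∂μ, Tendsto (fun i => m i x) l (𝓝 (m₀ x))) :
    TendstoL2 μ l (fun i x => m i x • f i x) (fun x => m₀ x • g x) := by
  have mem : ∀ (m : α → 𝕜) (f : α → F), AEStronglyMeasurable m μ → (∀ᵐ x ∂μ, ‖m x‖ ≤ M) →
      MemLp f 2 μ → MemLp (fun x => m x • f x) 2 μ := fun m f hm hM hf =>
    hf.of_le_mul (c := M) (hm.smul hf.1) (by
      filter_upwards [hM] with x hx
      rw [norm_smul]
      gcongr)
  -- Split m_i f_i = m_i (f_i - g) + m_i g: the first term is small since m_i is bounded, the second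
  -- converges by domination.
  have h1 : TendstoL2 μ l (fun i x => m i x • (f i x - g x)) (fun x => (0 : F)) := by
    have h0 : TendstoL2 μ l (fun i x => f i x - g x) (fun x => g x - g x) :=
      h.sub (TendstoL2.const h.memLp_lim)
    refine h0.of_norm_sub_le (fun i => mem _ _ (hm i) (hM i) (h0.memLp i)) (by simp) M fun i => ?_
    filter_upwards [hM i] with x hx
    simp only [sub_zero, norm_smul, sub_self]
    gcongr
  have h2 : TendstoL2 μ l (fun i x => m i x • g x) (fun x => m₀ x • g x) := by
    refine tendstoL2_of_dominated (b := fun x => (2 * M) • ‖g x‖)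
      (h.memLp_lim.norm.const_smul (2 * M))
      (fun i => mem _ _ (hm i) (hM i) h.memLp_lim) (mem _ _ hm₀ hM₀ h.memLp_lim).1 ?_ ?_ ?_
    · filter_upwards [hM₀] with x hx
      have hM0 : 0 ≤ M := (norm_nonneg _).trans hx
      rw [norm_smul, norm_smul, norm_norm, Real.norm_of_nonneg (by positivity)]
      gcongr
      linarith
    · refine Eventually.of_forall fun i => ?_
      filter_upwards [hM₀, hM i] with x hx hx'
      have hM0 : 0 ≤ M := (norm_nonneg _).trans hx
      rw [← sub_smul, norm_smul, norm_smul, norm_norm, Real.norm_of_nonneg (by positivity)]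
      gcongr
      calc _ ≤ ‖m i x‖ + ‖m₀ x‖ := norm_sub_le _ _
        _ ≤ _ := by linarith
    · filter_upwards [hlim] with x hx
      exact hx.smul_const _
  refine (h1.add h2).congr_ae (fun i => ?_) ?_
  · exact Eventually.of_forall fun x => by simp [smul_sub]
  · exact Eventually.of_forall fun x => by simp

/-- Continuity of the L² inner product in both slots. The weak identities below pass to their limits
through this. -/
theorem TendstoL2.tendsto_integral_inner {𝕜 : Type*} [RCLike 𝕜] [InnerProductSpace 𝕜 F]
    {f f' : ι → α → F} {g g' : α → F} (h : TendstoL2 μ l f g) (h' : TendstoL2 μ l f' g') :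
    Tendsto (fun i => ∫ x, inner 𝕜 (f i x) (f' i x) ∂μ) l (𝓝 (∫ x, inner 𝕜 (g x) (g' x) ∂μ)) := by
  have key : ∀ {f f' : α → F} (hf : MemLp f 2 μ) (hf' : MemLp f' 2 μ),
      inner 𝕜 (hf.toLp f) (hf'.toLp f') = ∫ x, inner 𝕜 (f x) (f' x) ∂μ := by
    intro f f' hf hf'
    rw [L2.inner_def]
    refine integral_congr_ae ?_
    filter_upwards [hf.coeFn_toLp, hf'.coeFn_toLp] with x hx hx'
    rw [hx, hx']
  have := (h.tendsto_toLp.inner h'.tendsto_toLp : Tendsto (fun i => inner 𝕜 _ _) l (𝓝 (inner 𝕜 _ _)))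
  simpa only [key] using this

/-- An `L²` limit follows from approximation by families that converge, uniformly in the index. -/
theorem tendstoL2_of_approx {f : ι → α → F} {g : α → F} (hf : ∀ i, MemLp (f i) 2 μ)
    (hg : MemLp g 2 μ)
    (h : ∀ ε : ℝ≥0∞, 0 < ε → ∃ (f' : ι → α → F) (g' : α → F), TendstoL2 μ l f' g' ∧
      (∀ᶠ i in l, eLpNorm (fun x => f i x - f' i x) 2 μ ≤ ε) ∧
      eLpNorm (fun x => g' x - g x) 2 μ ≤ ε) : TendstoL2 μ l f g := by
  refine ⟨hf, hg, ENNReal.tendsto_nhds_zero.2 fun ε hε => ?_⟩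
  obtain ⟨f', g', h1, h2, h3⟩ := h (ε / 3) (ENNReal.div_pos hε.ne' (by norm_num))
  filter_upwards [h2, ENNReal.tendsto_nhds_zero.1 h1.tendsto (ε / 3)
    (ENNReal.div_pos hε.ne' (by norm_num))] with i hi hi'
  have m1 : AEStronglyMeasurable (fun x => f i x - f' i x) μ := (hf i).1.sub (h1.memLp i).1
  have m2 : AEStronglyMeasurable (fun x => f' i x - g' x) μ := (h1.memLp i).1.sub h1.memLp_lim.1
  have m3 : AEStronglyMeasurable (fun x => g' x - g x) μ := h1.memLp_lim.1.sub hg.1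
  have e : (fun x => f i x - g x) =
      (fun x => f i x - f' i x) + ((fun x => f' i x - g' x) + fun x => g' x - g x) := by
    ext x
    simp
  rw [e, ← ENNReal.add_thirds ε, add_assoc]
  exact (eLpNorm_add_le m1 (m2.add m3) one_le_two).trans
    (add_le_add hi ((eLpNorm_add_le m2 m3 one_le_two).trans (add_le_add hi' h3)))

end TendstoL2

/-! ### C¹ dependence of an integral on a parameter -/

section ParametricIntegral

variable {H : Type*} [NormedAddCommGroup H] [NormedSpace ℝ H]
  {U : Set H} {f : ℝ → H → ℝ}

theorem hasFDerivAt_slice (hU : IsOpen U)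
    (hf : ContDiffOn ℝ 1 (Function.uncurry f) (Set.univ ×ˢ U)) (t : ℝ) {x : H} (hx : x ∈ U) :
    HasFDerivAt (f t) ((fderiv ℝ (Function.uncurry f) (t, x)).comp
      (ContinuousLinearMap.inr ℝ ℝ H)) x := by
  have hd : DifferentiableAt ℝ (Function.uncurry f) (t, x) :=
    (hf.contDiffAt ((isOpen_univ.prod hU).mem_nhds ⟨trivial, hx⟩)).differentiableAt one_ne_zero
  exact hd.hasFDerivAt.comp x (hasFDerivAt_prodMk_right t x)

theorem continuousOn_fderiv_slice (hU : IsOpen U)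
    (hf : ContDiffOn ℝ 1 (Function.uncurry f) (Set.univ ×ˢ U)) :
    ContinuousOn (fun p : ℝ × H => fderiv ℝ (f p.1) p.2) (Set.univ ×ˢ U) := by
  have h := hf.continuousOn_fderiv_of_isOpen (isOpen_univ.prod hU) le_rfl
  refine (h.clm_comp (continuousOn_const (c := ContinuousLinearMap.inr ℝ ℝ H))).congr ?_
  rintro ⟨t, x⟩ ⟨-, hx⟩
  exact (hasFDerivAt_slice hU hf t hx).fderiv

/-- The derivative is jointly continuous, hence bounded on the product of the interval with a
compact neighbourhood of the point. This constant is the dominating function in the two theorems on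
the integral; finite dimension supplies the compact neighbourhood. -/
theorem exists_bound_fderiv_slice [FiniteDimensional ℝ H] (hU : IsOpen U)
    (hf : ContDiffOn ℝ 1 (Function.uncurry f) (Set.univ ×ˢ U)) (a b : ℝ) {x : H} (hx : x ∈ U) :
    ∃ C, ∃ N ∈ 𝓝 x, N ⊆ U ∧ ∀ t ∈ Set.uIcc a b, ∀ y ∈ N, ‖fderiv ℝ (f t) y‖ ≤ C := by
  have : ProperSpace H := FiniteDimensional.proper_real H
  obtain ⟨N, hN, hNU, hNc⟩ := local_compact_nhds (hU.mem_nhds hx)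
  obtain ⟨C, hC⟩ := ((isCompact_uIcc (a := a) (b := b)).prod hNc).exists_bound_of_continuousOn
    ((continuousOn_fderiv_slice hU hf).mono (Set.prod_mono (Set.subset_univ _) hNU))
  exact ⟨C, N, hN, hNU, fun t ht y hy => hC (t, y) ⟨ht, hy⟩⟩

theorem continuous_slice_left
    (hf : ContDiffOn ℝ 1 (Function.uncurry f) (Set.univ ×ˢ U)) {x : H} (hx : x ∈ U) :
    Continuous fun t => f t x :=
  continuousOn_univ.1 (hf.continuousOn.comp (Continuous.prodMk_left x).continuousOn
    fun _ _ => ⟨trivial, hx⟩)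

theorem continuous_fderiv_slice_left (hU : IsOpen U)
    (hf : ContDiffOn ℝ 1 (Function.uncurry f) (Set.univ ×ˢ U)) {x : H} (hx : x ∈ U) :
    Continuous fun t => fderiv ℝ (f t) x :=
  continuousOn_univ.1 ((continuousOn_fderiv_slice hU hf).comp (Continuous.prodMk_left x).continuousOn
    fun _ _ => ⟨trivial, hx⟩)

theorem hasFDerivAt_intervalIntegral [FiniteDimensional ℝ H] (hU : IsOpen U)
    (hf : ContDiffOn ℝ 1 (Function.uncurry f) (Set.univ ×ˢ U)) (a b : ℝ) {x : H} (hx : x ∈ U) :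
    HasFDerivAt (fun y => ∫ t in a..b, f t y) (∫ t in a..b, fderiv ℝ (f t) x) x := by
  obtain ⟨C, N, hN, hNU, hC⟩ := exists_bound_fderiv_slice hU hf a b hx
  refine intervalIntegral.hasFDerivAt_integral_of_dominated_of_fderiv_le (bound := fun _ => C)
    (F' := fun y t => fderiv ℝ (f t) y) hN ?_ ?_ ?_ ?_ ?_ ?_
  · filter_upwards [hU.mem_nhds hx] with y hy
    exact (continuous_slice_left hf hy).aestronglyMeasurable
  · exact (continuous_slice_left hf hx).intervalIntegrable _ _
  · exact (continuous_fderiv_slice_left hU hf hx).aestronglyMeasurable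
  · exact Eventually.of_forall fun t ht y hy => hC t (Set.uIoc_subset_uIcc ht) y hy
  · exact intervalIntegrable_const
  · exact Eventually.of_forall fun t _ y hy =>
      (hasFDerivAt_slice hU hf t (hNU hy)).differentiableAt.hasFDerivAt

theorem contDiffOn_intervalIntegral [FiniteDimensional ℝ H] (hU : IsOpen U)
    (hf : ContDiffOn ℝ 1 (Function.uncurry f) (Set.univ ×ˢ U)) (a b : ℝ) :
    ContDiffOn ℝ 1 (fun y => ∫ t in a..b, f t y) U := by
  rw [show (1 : ℕ∞ω) = 0 + 1 from rfl, contDiffOn_succ_iff_fderiv_of_isOpen hU]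
  refine ⟨fun x hx =>
    (hasFDerivAt_intervalIntegral hU hf a b hx).differentiableAt.differentiableWithinAt,
    fun h => by simp at h, contDiffOn_zero.2 ?_⟩
  refine ContinuousOn.congr (f := fun x => ∫ t in a..b, fderiv ℝ (f t) x) ?_ fun x hx =>
    (hasFDerivAt_intervalIntegral hU hf a b hx).fderiv
  intro x hx
  obtain ⟨C, N, hN, hNU, hC⟩ := exists_bound_fderiv_slice hU hf a b hx
  refine ContinuousAt.continuousWithinAt ?_
  refine intervalIntegral.continuousAt_of_dominated_interval (bound := fun _ => C) ?_ ?_ ?_ ?_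
  · filter_upwards [hU.mem_nhds hx] with y hy
    exact (continuous_fderiv_slice_left hU hf hy).aestronglyMeasurable
  · filter_upwards [hN] with y hy
    exact Eventually.of_forall fun t ht => hC t (Set.uIoc_subset_uIcc ht) y hy
  · exact intervalIntegrable_const
  · refine Eventually.of_forall fun t _ => ?_
    exact ((continuousOn_fderiv_slice hU hf).continuousAt
      ((isOpen_univ.prod hU).mem_nhds ⟨trivial, hx⟩)).comp (f := fun y => (t, y))
      (Continuous.prodMk_right t).continuousAt

end ParametricIntegral

/-! ### Dilations by e^s and their Jacobian -/

section Dilation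

variable {d : ℕ} {F : Type*} [NormedAddCommGroup F]

theorem measurableEmbedding_exp_smul (s : ℝ) :
    MeasurableEmbedding fun x : Space d => Real.exp s • x :=
  (Homeomorph.smulOfNeZero (Real.exp s) (Real.exp_ne_zero s)).measurableEmbedding

theorem map_exp_smul (s : ℝ) : Measure.map (fun x : Space d => Real.exp s • x) volume =
    ENNReal.ofReal (Real.exp (-(s * d))) • volume := by
  rw [Measure.map_addHaar_smul _ (Real.exp_ne_zero s), finrank_euclideanSpace_fin,
    ← Real.exp_nat_mul, ← Real.exp_neg, abs_of_pos (Real.exp_pos _), mul_comm]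

theorem aestronglyMeasurable_exp_smul {w : Space d → F} (hw : AEStronglyMeasurable w volume)
    (s : ℝ) : AEStronglyMeasurable (fun x => w (Real.exp s • x)) volume :=
  hw.comp_quasiMeasurePreserving (Measure.quasiMeasurePreserving_smul volume (Real.exp_ne_zero s))

theorem integral_exp_smul [NormedSpace ℝ F] (f : Space d → F) (s : ℝ) :
    ∫ x, f (Real.exp s • x) = Real.exp (-(s * d)) • ∫ x, f x := by
  rw [← (measurableEmbedding_exp_smul s).integral_map f, map_exp_smul, integral_smul_measure,
    ENNReal.toReal_ofReal (Real.exp_pos _).le]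

theorem eLpNorm_exp_smul (w : Space d → F) (s : ℝ) :
    eLpNorm (fun x => w (Real.exp s • x)) 2 volume =
      ENNReal.ofReal (Real.exp (-(s * d) / 2)) * eLpNorm w 2 volume := by
  have h := (measurableEmbedding_exp_smul (d := d) s).eLpNorm_map_measure (g := w) (p := 2)
    (μ := volume)
  rw [map_exp_smul, eLpNorm_smul_measure_of_ne_top (by norm_num)] at h
  rw [show (fun x => w (Real.exp s • x)) = w ∘ fun x => Real.exp s • x from rfl, ← h, smul_eq_mul,
    ENNReal.toReal_div, ENNReal.toReal_one, ENNReal.toReal_ofNat,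
    ENNReal.ofReal_rpow_of_pos (Real.exp_pos _), ← Real.exp_mul]
  ring_nf

end Dilation

/-! ### The phase along rays and its gauge defect -/

section Phase

variable {d : ℕ} {S : Set (Space d)} {A : Space d → Space d}

theorem IsSingularCone.exp_smul_notMem (hS : IsSingularCone S) {x : Space d} (hx : x ∉ S) (s : ℝ) :
    Real.exp s • x ∉ S := fun h => hx <| by
  have := hS.smul_mem (Real.exp (-s)) (Real.exp_pos _) _ h
  rwa [smul_smul, ← Real.exp_add, neg_add_cancel, Real.exp_zero, one_smul] at this

theorem IsSingularCone.ne_zero (hS : IsSingularCone S) {x : Space d} (hx : x ∉ S) : x ≠ 0 :=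
  fun h => hx (h ▸ hS.zero_mem)

theorem IsSingularCone.ae_notMem (hS : IsSingularCone S) : ∀ᵐ x : Space d, x ∉ S :=
  measure_eq_zero_iff_ae_notMem.1 hS.null

/-- `S` is null, so the Lebesgue measure equals its restriction to the open complement of `S`, where
continuity is available. -/
theorem IsSingularCone.aestronglyMeasurable {F : Type*} [TopologicalSpace F]
    [TopologicalSpace.PseudoMetrizableSpace F] [SecondCountableTopology F]
    (hS : IsSingularCone S) {f : Space d → F} (hf : ContinuousOn f Sᶜ) :
    AEStronglyMeasurable f volume := by
  have h : volume.restrict Sᶜ = (volume : Measure (Space d)) :=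
    Measure.restrict_eq_self_of_ae_mem hS.ae_notMem
  rw [← h]
  exact hf.aestronglyMeasurable hS.isClosed.isOpen_compl.measurableSet

/-- The covariant work of the potential along the ray from `x` to `e^s x`. -/
def rayPhase (A : Space d → Space d) (s : ℝ) (x : Space d) : ℝ :=
  ∫ t in (0 : ℝ)..s, inner ℝ (A (Real.exp t • x)) (Real.exp t • x)

/-- The failure of `e^s A(e^s x)` to be gauge equivalent to `A`. -/
def phaseDefect (A : Space d → Space d) (s : ℝ) (x : Space d) : Space d :=
  gradient (rayPhase A s) x + A x - Real.exp s • A (Real.exp s • x)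

theorem contDiffOn_ray (hS : IsSingularCone S) (hA : ContDiffOn ℝ 1 A Sᶜ) :
    ContDiffOn ℝ 1 (fun p : ℝ × Space d => A (Real.exp p.1 • p.2)) (Set.univ ×ˢ Sᶜ) :=
  hA.comp (by fun_prop) fun p hp => hS.exp_smul_notMem hp.2 _

theorem contDiffOn_ray_inner (hS : IsSingularCone S) (hA : ContDiffOn ℝ 1 A Sᶜ) :
    ContDiffOn ℝ 1 (Function.uncurry fun (t : ℝ) (x : Space d) =>
      inner ℝ (A (Real.exp t • x)) (Real.exp t • x)) (Set.univ ×ˢ Sᶜ) :=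
  (contDiffOn_ray hS hA).inner ℝ (by fun_prop)

theorem contDiffOn_rayPhase (hS : IsSingularCone S) (hA : ContDiffOn ℝ 1 A Sᶜ) (s : ℝ) :
    ContDiffOn ℝ 1 (rayPhase A s) Sᶜ :=
  contDiffOn_intervalIntegral hS.isClosed.isOpen_compl (contDiffOn_ray_inner hS hA) 0 s

theorem continuousOn_phaseDefect (hS : IsSingularCone S) (hA : ContDiffOn ℝ 1 A Sᶜ) (s : ℝ) :
    ContinuousOn (phaseDefect A s) Sᶜ := by
  have h1 : ContinuousOn (gradient (rayPhase A s)) Sᶜ :=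
    (LinearIsometryEquiv.continuous _).comp_continuousOn
      ((contDiffOn_rayPhase hS hA s).continuousOn_fderiv_of_isOpen hS.isClosed.isOpen_compl le_rfl)
  have h2 : ContinuousOn (fun x => A (Real.exp s • x)) Sᶜ :=
    hA.continuousOn.comp (by fun_prop) fun x hx => hS.exp_smul_notMem hx s
  exact (h1.add hA.continuousOn).sub (h2.const_smul (Real.exp s))

/-- B_τ is dA contracted with the radial direction. The factor ‖y‖ clears its denominator and leaves
a coordinate-free expression. -/
theorem inner_tangentialField {y : Space d} (hy : y ≠ 0) (v : Space d) :
    ‖y‖ * inner ℝ (tangentialField A y) v =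
      inner ℝ (fderiv ℝ A y v) y - inner ℝ (fderiv ℝ A y y) v := by
  have hn : ‖y‖ ≠ 0 := norm_ne_zero_iff.2 hy
  have expand : ∀ z : Space d, fderiv ℝ A y z = ∑ j, z j • fderiv ℝ A y (coordVec j) := by
    intro z
    have hz : z = ∑ j, z j • coordVec j := by
      ext i
      simp [coordVec, Finset.sum_apply, Pi.single_apply]
    conv_lhs => rw [hz]
    simp
  rw [expand v, expand y]
  simp only [PiLp.inner_apply, RCLike.inner_apply, conj_trivial, tangentialField, magneticField,
    Matrix.of_apply, WithLp.ofLp_sum, WithLp.ofLp_smul, Finset.sum_apply, Pi.smul_apply, smul_eq_mul]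
  simp only [Finset.mul_sum]
  rw [Finset.sum_comm (f := fun i j => y i * (v j * _)), ← Finset.sum_sub_distrib]
  refine Finset.sum_congr rfl fun j _ => ?_
  rw [← Finset.sum_sub_distrib]
  refine Finset.sum_congr rfl fun k _ => ?_
  field_simp

/-- Cartan's homotopy formula for the one-form A and the flow x ↦ e^t x: the pull-back e^s A(e^s x)
differs from A by an exact form, the gradient of `rayPhase`, and by the integral of dA contracted
with the flow field. Only the second part survives in the defect. -/
theorem inner_phaseDefect (hS : IsSingularCone S) (hA : ContDiffOn ℝ 1 A Sᶜ) (s : ℝ)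
    {x : Space d} (hx : x ∉ S) (v : Space d) :
    inner ℝ (phaseDefect A s x) v = ∫ t in (0 : ℝ)..s, Real.exp t *
      (‖Real.exp t • x‖ * inner ℝ (tangentialField A (Real.exp t • x)) v) := by
  have hU := hS.isClosed.isOpen_compl
  have hAd : ∀ t : ℝ, HasFDerivAt A (fderiv ℝ A (Real.exp t • x)) (Real.exp t • x) := fun t =>
    ((hA.contDiffAt (hU.mem_nhds (hS.exp_smul_notMem hx t))).differentiableAt
      one_ne_zero).hasFDerivAt
  have hAc : Continuous fun t : ℝ => A (Real.exp t • x) :=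
    continuousOn_univ.1 ((contDiffOn_ray hS hA).continuousOn.comp
      (Continuous.prodMk_left x).continuousOn fun t _ => ⟨trivial, hx⟩)
  have hDc : Continuous fun t : ℝ => fderiv ℝ A (Real.exp t • x) :=
    continuousOn_univ.1 ((hA.continuousOn_fderiv_of_isOpen hU le_rfl).comp
      (f := fun t : ℝ => Real.exp t • x) (by fun_prop)
      fun t _ => hS.exp_smul_notMem hx t)
  have hf := contDiffOn_ray_inner hS hA
  have c0 : Continuous fun t : ℝ => Real.exp t • x := by fun_prop
  have c1 : Continuous fun t : ℝ => Real.exp t * inner ℝ (A (Real.exp t • x)) v + Real.exp t *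
      inner ℝ (fderiv ℝ A (Real.exp t • x) v) (Real.exp t • x) :=
    (Real.continuous_exp.mul (hAc.inner continuous_const)).add
      (Real.continuous_exp.mul ((hDc.clm_apply continuous_const).inner c0))
  have c2 : Continuous fun t : ℝ => Real.exp t * inner ℝ (A (Real.exp t • x)) v + Real.exp t *
      inner ℝ (fderiv ℝ A (Real.exp t • x) (Real.exp t • x)) v :=
    (Real.continuous_exp.mul (hAc.inner continuous_const)).add
      (Real.continuous_exp.mul ((hDc.clm_apply c0).inner continuous_const))
  have h1 : fderiv ℝ (rayPhase A s) x v = ∫ t in (0 : ℝ)..s,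
      (Real.exp t * inner ℝ (A (Real.exp t • x)) v + Real.exp t *
        inner ℝ (fderiv ℝ A (Real.exp t • x) v) (Real.exp t • x)) := by
    have h2 : fderiv ℝ (rayPhase A s) x = _ := (hasFDerivAt_intervalIntegral hU hf 0 s hx).fderiv
    rw [h2, ContinuousLinearMap.intervalIntegral_apply
      ((continuous_fderiv_slice_left hU hf hx).intervalIntegrable _ _)]
    refine intervalIntegral.integral_congr fun t _ => ?_
    have h3 : HasFDerivAt (fun y : Space d => Real.exp t • y)
        (Real.exp t • ContinuousLinearMap.id ℝ (Space d)) x := (hasFDerivAt_id x).const_smul (Real.exp t)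
    have h4 := ((hAd t).comp x h3).inner ℝ h3
    have h5 := congrArg (fun L : Space d →L[ℝ] ℝ => L v) h4.fderiv
    refine h5.trans ?_
    simp [inner_smul_left, inner_smul_right]
  -- The fundamental theorem of calculus along the ray. Its integrand shares the undifferentiated
  -- term in A with that of `h1`, so subtraction leaves the antisymmetric part of DA.
  have h2 : Real.exp s * inner ℝ (A (Real.exp s • x)) v - inner ℝ (A x) v =
      ∫ t in (0 : ℝ)..s, (Real.exp t * inner ℝ (A (Real.exp t • x)) v + Real.exp t *
        inner ℝ (fderiv ℝ A (Real.exp t • x) (Real.exp t • x)) v) := by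
    rw [intervalIntegral.integral_eq_sub_of_hasDerivAt
      (f := fun t => Real.exp t * inner ℝ (A (Real.exp t • x)) v)]
    · simp
    · intro t _
      have h3 : HasDerivAt (fun t : ℝ => Real.exp t • x) (Real.exp t • x) t :=
        (Real.hasDerivAt_exp t).smul_const x
      have h4 := ((hAd t).comp_hasDerivAt t h3).inner ℝ (hasDerivAt_const t v)
      refine ((Real.hasDerivAt_exp t).mul h4).congr_deriv ?_
      simp
    · exact c2.intervalIntegrable _ _
  have h3 : inner ℝ (phaseDefect A s x) v = fderiv ℝ (rayPhase A s) x v -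
      (Real.exp s * inner ℝ (A (Real.exp s • x)) v - inner ℝ (A x) v) := by
    rw [phaseDefect, inner_sub_left, inner_add_left, real_inner_smul_left, inner_gradient_left]
    ring
  rw [h3, h1, h2, ← intervalIntegral.integral_sub]
  · refine intervalIntegral.integral_congr fun t _ => ?_
    rw [inner_tangentialField (hS.ne_zero (hS.exp_smul_notMem hx t))]
    ring
  · exact c1.intervalIntegrable _ _
  · exact c2.intervalIntegrable _ _

/-- The integrand of `inner_phaseDefect` is at most e^{|s|} C ‖v‖ over an interval of length |s|.
The linear order in s is what makes the defect harmless after division by 2s. -/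
theorem norm_phaseDefect_le (hS : IsSingularCone S) (hA : ContDiffOn ℝ 1 A Sᶜ) (s : ℝ)
    {x : Space d} (hx : x ∉ S) {C : ℝ}
    (hC : ∀ t ∈ Set.uIcc 0 s, ‖Real.exp t • x‖ * ‖tangentialField A (Real.exp t • x)‖ ≤ C) :
    ‖phaseDefect A s x‖ ≤ Real.exp |s| * C * |s| := by
  have hC0 : 0 ≤ C := le_trans (by positivity) (hC 0 Set.left_mem_uIcc)
  have key : ∀ v, ‖inner ℝ (phaseDefect A s x) v‖ ≤ Real.exp |s| * C * ‖v‖ * |s| := by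
    intro v
    rw [inner_phaseDefect hS hA s hx v]
    have := intervalIntegral.norm_integral_le_of_norm_le_const (a := (0 : ℝ)) (b := s)
      (C := Real.exp |s| * C * ‖v‖) (f := fun t => Real.exp t *
        (‖Real.exp t • x‖ * inner ℝ (tangentialField A (Real.exp t • x)) v)) fun t ht => by
      have ht' := Set.uIoc_subset_uIcc ht
      have h1 : t ≤ |s| := by
        rcases Set.mem_uIcc.1 ht' with h | h
        · exact h.2.trans (le_abs_self s)
        · exact h.2.trans (abs_nonneg s)
      rw [norm_mul, norm_mul, Real.norm_of_nonneg (Real.exp_pos t).le, norm_norm, mul_assoc]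
      refine mul_le_mul (Real.exp_le_exp.2 h1) ?_ (by positivity) (Real.exp_pos _).le
      calc _ ≤ ‖Real.exp t • x‖ * (‖tangentialField A (Real.exp t • x)‖ * ‖v‖) := by
            gcongr
            exact norm_inner_le_norm _ _
        _ ≤ C * ‖v‖ := by
            rw [← mul_assoc]
            gcongr
            exact hC t ht'
    simpa using this
  -- Duality: the defect is tested against itself.
  have h := key (phaseDefect A s x)
  rw [real_inner_self_eq_norm_sq, norm_pow, norm_norm] at h
  rcases (norm_nonneg (phaseDefect A s x)).eq_or_lt with h0 | h0
  · rw [← h0]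
    positivity
  · refine le_of_mul_le_mul_right ?_ h0
    calc _ = ‖phaseDefect A s x‖ ^ 2 := by ring
      _ ≤ _ := h
      _ = _ := by ring

end Phase

/-! ### Covariant dilations of functions -/

section Transport

variable {d : ℕ} {S : Set (Space d)} {A : Space d → Space d}
  {F : Type*} [NormedAddCommGroup F] [NormedSpace ℂ F]

/-- A real vector, regarded as a complex one. -/
def cvec (v : Space d) : EuclideanSpace ℂ (Fin d) := WithLp.toLp 2 fun j => (v j : ℂ)

@[simp] theorem cvec_apply (v : Space d) (j : Fin d) : cvec v j = (v j : ℂ) := rfl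

theorem norm_cvec (v : Space d) : ‖cvec v‖ = ‖v‖ := by
  simp [EuclideanSpace.norm_eq]

theorem continuous_cvec : Continuous (cvec (d := d)) := by
  unfold cvec
  fun_prop

theorem inner_coordVec (v : Space d) (j : Fin d) : inner ℝ v (coordVec j) = v j := by
  rw [coordVec, EuclideanSpace.inner_single_right]
  simp

theorem inner_cvec_magneticGrad (A : Space d → Space d) (φ : Space d → ℂ) (x v : Space d) :
    inner ℂ (cvec v) (magneticGrad A φ x) =
      fderiv ℝ φ x v + Complex.I * (inner ℝ (A x) v : ℝ) * φ x := by
  have hv : v = ∑ j, v j • coordVec j := by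
    ext i
    simp [coordVec, Finset.sum_apply, Pi.single_apply]
  conv_rhs => rw [hv]
  rw [PiLp.inner_apply]
  simp only [RCLike.inner_apply, cvec_apply, magneticGrad, Complex.conj_ofReal,
    map_sum, map_smul, Complex.real_smul, inner_sum, inner_smul_right, inner_coordVec]
  rw [Complex.ofReal_sum, Finset.mul_sum, Finset.sum_mul, ← Finset.sum_add_distrib]
  refine Finset.sum_congr rfl fun j _ => ?_
  push_cast
  ring

theorem norm_inner_cvec_le (x : Space d) (g : EuclideanSpace ℂ (Fin d)) :
    ‖inner ℂ (cvec x) g‖ ≤ ‖x‖ * ‖g‖ := by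
  simpa [norm_cvec] using norm_inner_le_norm (𝕜 := ℂ) (cvec x) g

/-- Continuously differentiable functions with compact support off the singular set. -/
structure IsC1Test (S : Set (Space d)) (φ : Space d → ℂ) : Prop where
  contDiff : ContDiff ℝ 1 φ
  compact : HasCompactSupport φ
  support : tsupport φ ⊆ Sᶜ

theorem IsTestFunction.isC1Test {φ : Space d → ℂ} (h : IsTestFunction S φ) : IsC1Test S φ :=
  ⟨h.smooth.of_le (by exact_mod_cast le_top), h.compact, h.support⟩

theorem magneticGrad_eq_zero {φ : Space d → ℂ} {x : Space d} (h : x ∉ tsupport φ) :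
    magneticGrad A φ x = 0 := by
  have h1 : fderiv ℝ φ x = 0 :=
    Function.notMem_support.1 fun h' => h (support_fderiv_subset ℝ h')
  ext j
  simp [magneticGrad, h1, image_eq_zero_of_notMem_tsupport h]

theorem IsC1Test.continuous_magneticGrad {φ : Space d → ℂ} (hφ : IsC1Test S φ)
    (hS : IsSingularCone S) (hA : ContDiffOn ℝ 1 A Sᶜ) : Continuous (magneticGrad A φ) := by
  refine continuous_iff_continuousAt.2 fun x => ?_
  by_cases hx : x ∈ S
  · have h : x ∈ (tsupport φ)ᶜ := fun h => hφ.support h hx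
    have h2 : magneticGrad A φ =ᶠ[𝓝 x] fun _ => 0 := by
      filter_upwards [(isClosed_tsupport φ).isOpen_compl.mem_nhds h] with y hy
      exact magneticGrad_eq_zero hy
    exact continuousAt_const.congr h2.symm
  · have hAx : ContinuousAt A x := hA.continuousOn.continuousAt (hS.isClosed.isOpen_compl.mem_nhds hx)
    have h1 : Continuous (fderiv ℝ φ) := hφ.contDiff.continuous_fderiv one_ne_zero
    have h2 := hφ.contDiff.continuous
    refine (PiLp.continuous_toLp 2 _).continuousAt.comp (continuousAt_pi.2 fun j => ?_)
    have h3 : ContinuousAt (fun x => A x j) x :=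
      (EuclideanSpace.proj (𝕜 := ℝ) j).continuous.continuousAt.comp hAx
    have h4 : ContinuousAt (fun x => ((A x j : ℝ) : ℂ)) x :=
      Complex.continuous_ofReal.continuousAt.comp h3
    exact ((h1.clm_apply continuous_const).continuousAt).add
      ((continuousAt_const.mul h4).mul h2.continuousAt)

theorem hasCompactSupport_magneticGrad {φ : Space d → ℂ} (h : HasCompactSupport φ) :
    HasCompactSupport (magneticGrad A φ) :=
  HasCompactSupport.intro h fun _ hx => magneticGrad_eq_zero hx

/-- Dilation by `e^s`, covariant with respect to the potential. -/
def transport (A : Space d → Space d) (s : ℝ) (w : Space d → F) (x : Space d) : F :=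
  Complex.exp (Complex.I * rayPhase A s x) • w (Real.exp s • x)

theorem norm_exp_I_mul (t : ℝ) : ‖Complex.exp (Complex.I * t)‖ = 1 := by
  rw [mul_comm, Complex.norm_exp_ofReal_mul_I]

theorem norm_transport (A : Space d → Space d) (s : ℝ) (w : Space d → F) (x : Space d) :
    ‖transport A s w x‖ = ‖w (Real.exp s • x)‖ := by
  rw [transport, norm_smul, norm_exp_I_mul, one_mul]

theorem transport_zero (A : Space d → Space d) (w : Space d → F) : transport A 0 w = w := by
  ext x
  simp [transport, rayPhase]

theorem transport_sub (A : Space d → Space d) (s : ℝ) (w w' : Space d → F) (x : Space d) :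
    transport A s (fun y => w y - w' y) x = transport A s w x - transport A s w' x := by
  simp [transport, smul_sub]

theorem continuousOn_transport_factor (hS : IsSingularCone S) (hA : ContDiffOn ℝ 1 A Sᶜ) (s : ℝ) :
    ContinuousOn (fun x => Complex.exp (Complex.I * rayPhase A s x)) Sᶜ :=
  Complex.continuous_exp.comp_continuousOn (continuousOn_const.mul
    (Complex.continuous_ofReal.comp_continuousOn (contDiffOn_rayPhase hS hA s).continuousOn))

theorem aestronglyMeasurable_transport (hS : IsSingularCone S) (hA : ContDiffOn ℝ 1 A Sᶜ)
    {w : Space d → F} (hw : AEStronglyMeasurable w volume) (s : ℝ) :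
    AEStronglyMeasurable (transport A s w) volume :=
  (hS.aestronglyMeasurable (continuousOn_transport_factor hS hA s)).smul
    (aestronglyMeasurable_exp_smul hw s)

theorem eLpNorm_transport (A : Space d → Space d) (s : ℝ) (w : Space d → F) :
    eLpNorm (transport A s w) 2 volume =
      ENNReal.ofReal (Real.exp (-(s * d) / 2)) * eLpNorm w 2 volume := by
  rw [← eLpNorm_exp_smul]
  exact eLpNorm_congr_norm_ae (Eventually.of_forall fun x => norm_transport A s w x)

theorem memLp_transport (hS : IsSingularCone S) (hA : ContDiffOn ℝ 1 A Sᶜ)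
    {w : Space d → F} (hw : MemLp w 2 volume) (s : ℝ) : MemLp (transport A s w) 2 volume :=
  ⟨aestronglyMeasurable_transport hS hA hw.1 s, by
    rw [eLpNorm_transport]
    exact ENNReal.mul_lt_top ENNReal.ofReal_lt_top hw.2⟩

theorem TendstoL2.transport {ι : Type*} {l : Filter ι} (hS : IsSingularCone S)
    (hA : ContDiffOn ℝ 1 A Sᶜ) {f : ι → Space d → F} {g : Space d → F}
    (h : TendstoL2 volume l f g) (s : ℝ) :
    TendstoL2 volume l (fun i => transport A s (f i)) (transport A s g) := by
  refine ⟨fun i => memLp_transport hS hA (h.memLp i) s, memLp_transport hS hA h.memLp_lim s, ?_⟩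
  simp_rw [← transport_sub]
  have e : ∀ i, eLpNorm (fun x => MagneticSchrodinger.transport A s (fun y => f i y - g y) x) 2 volume =
      ENNReal.ofReal (Real.exp (-(s * d) / 2)) * eLpNorm (fun y => f i y - g y) 2 volume :=
    fun i => eLpNorm_transport A s _
  simp_rw [e]
  simpa using ENNReal.Tendsto.const_mul h.tendsto (Or.inr ENNReal.ofReal_ne_top)

theorem hasDerivAt_rayPhase (hS : IsSingularCone S) (hA : ContDiffOn ℝ 1 A Sᶜ) {x : Space d}
    (hx : x ∉ S) (s : ℝ) :
    HasDerivAt (fun s => rayPhase A s x) (inner ℝ (A (Real.exp s • x)) (Real.exp s • x)) s := by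
  have hc := continuous_slice_left (contDiffOn_ray_inner hS hA) (x := x) hx
  exact intervalIntegral.integral_hasDerivAt_right (hc.intervalIntegrable _ _)
    (hc.stronglyMeasurableAtFilter _ _) hc.continuousAt

theorem tendsto_transport_factor (hS : IsSingularCone S) (hA : ContDiffOn ℝ 1 A Sᶜ)
    {x : Space d} (hx : x ∉ S) :
    Tendsto (fun s => Complex.exp (Complex.I * rayPhase A s x)) (𝓝 0) (𝓝 1) := by
  have h : ContinuousAt (fun s => Complex.exp (Complex.I * rayPhase A s x)) 0 :=
    Complex.continuous_exp.continuousAt.comp (continuousAt_const.mul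
      (Complex.continuous_ofReal.continuousAt.comp (hasDerivAt_rayPhase hS hA hx 0).continuousAt))
  simpa [ContinuousAt, rayPhase] using h

theorem exists_norm_le_of_hasCompactSupport {F : Type*} [NormedAddCommGroup F] {f : Space d → F} (hf : HasCompactSupport f) :
    ∃ R : ℝ, 0 < R ∧ ∀ x, R < ‖x‖ → f x = 0 := by
  obtain ⟨R, hR, h⟩ := hf.isCompact.isBounded.exists_pos_norm_le
  exact ⟨R, hR, fun x hx => image_eq_zero_of_notMem_tsupport fun h' => absurd (h x h') (not_le.2 hx)⟩

theorem memLp_indicator_closedBall (R M : ℝ) :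
    MemLp ((Metric.closedBall (0 : Space d) R).indicator fun _ => M) 2 volume :=
  memLp_indicator_const 2 Metric.isClosed_closedBall.measurableSet M
    (Or.inr (isCompact_closedBall _ _).measure_lt_top.ne)

theorem norm_le_norm_exp_smul {s : ℝ} (hs : |s| ≤ 1) (x : Space d) :
    Real.exp (-1) * ‖x‖ ≤ ‖Real.exp s • x‖ := by
  rw [norm_smul, Real.norm_of_nonneg (Real.exp_pos s).le]
  gcongr
  linarith [(abs_le.1 hs).1]

/-- Covariant dilations are strongly continuous in `L²`. -/
theorem tendstoL2_transport (hS : IsSingularCone S) (hA : ContDiffOn ℝ 1 A Sᶜ)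
    {w : Space d → F} (hw : MemLp w 2 volume) :
    TendstoL2 volume (𝓝 0) (fun s => transport A s w) w := by
  refine tendstoL2_of_approx (fun s => memLp_transport hS hA hw s) hw fun ε hε => ?_
  -- An upper bound for the operator norm e^{-sd/2} of T_s when |s| ≤ 1. An approximation within ε /
  -- c therefore stays within ε after transport.
  set c := ENNReal.ofReal (Real.exp (d / 2)) with hc
  have hc0 : c ≠ 0 := (ENNReal.ofReal_pos.2 (Real.exp_pos _)).ne'
  have hc1 : 1 ≤ c := by
    rw [hc, ENNReal.one_le_ofReal]
    exact Real.one_le_exp (by positivity)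
  obtain ⟨g, hg, hgε, hgc, hgm⟩ := hw.exists_hasCompactSupport_eLpNorm_sub_le (by norm_num)
    (ENNReal.div_pos hε.ne' (ENNReal.ofReal_ne_top (r := Real.exp (d / 2)))).ne'
  have hgε' : eLpNorm (fun x => w x - g x) 2 volume ≤ ε / c := hgε
  refine ⟨fun s => transport A s g, g, ?_, ?_, ?_⟩
  · obtain ⟨R, hR, hgR⟩ := exists_norm_le_of_hasCompactSupport hg
    obtain ⟨M, hM⟩ := hgc.bounded_above_of_compact_support hg
    have hM0 : 0 ≤ M := (norm_nonneg _).trans (hM 0)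
    -- If ‖x‖ > e R and |s| ≤ 1, both x and e^s x lie outside the support of g.
    refine tendstoL2_of_dominated (memLp_indicator_closedBall (R * Real.exp 1) (2 * M))
      (fun s => memLp_transport hS hA hgm s) hgc.aestronglyMeasurable ?_ ?_ ?_
    · refine Eventually.of_forall fun x => ?_
      by_cases hx : x ∈ Metric.closedBall (0 : Space d) (R * Real.exp 1)
      · rw [Set.indicator_of_mem hx, Real.norm_of_nonneg (by positivity)]
        linarith [hM x]
      · rw [Set.indicator_of_notMem hx, hgR x, norm_zero, norm_zero]
        rw [mem_closedBall_zero_iff, not_le] at hx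
        nlinarith [Real.one_le_exp (zero_le_one (α := ℝ))]
    · filter_upwards [Metric.closedBall_mem_nhds (0 : ℝ) one_pos] with s hs
      rw [mem_closedBall_zero_iff, Real.norm_eq_abs] at hs
      refine Eventually.of_forall fun x => ?_
      by_cases hx : x ∈ Metric.closedBall (0 : Space d) (R * Real.exp 1)
      · rw [Set.indicator_of_mem hx, Real.norm_of_nonneg (by positivity), two_mul]
        refine (norm_sub_le _ _).trans (add_le_add ?_ (hM x))
        rw [norm_transport]
        exact hM _
      · rw [mem_closedBall_zero_iff, not_le] at hx
        have h1 : g x = 0 := hgR x (by nlinarith [Real.one_le_exp (zero_le_one (α := ℝ))])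
        have h2 : g (Real.exp s • x) = 0 := hgR _ <| by
          refine lt_of_lt_of_le ?_ (norm_le_norm_exp_smul hs x)
          calc R = Real.exp (-1) * (R * Real.exp 1) := by
                rw [mul_comm R, ← mul_assoc, ← Real.exp_add]; simp
            _ < _ := by gcongr
        rw [h1, sub_zero, norm_transport, h2, norm_zero]
        exact norm_nonneg _
    · filter_upwards [hS.ae_notMem] with x hx
      have h1 : Tendsto (fun s : ℝ => g (Real.exp s • x)) (𝓝 0) (𝓝 (g x)) := by
        have : Continuous fun s : ℝ => g (Real.exp s • x) := by fun_prop
        simpa using this.tendsto 0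
      simpa [transport] using (tendsto_transport_factor hS hA hx).smul h1
  · filter_upwards [Metric.closedBall_mem_nhds (0 : ℝ) one_pos] with s hs
    rw [mem_closedBall_zero_iff, Real.norm_eq_abs] at hs
    simp_rw [← transport_sub]
    change eLpNorm (transport A s fun y => w y - g y) 2 volume ≤ ε
    rw [eLpNorm_transport]
    calc _ ≤ c * (ε / c) := by
          refine mul_le_mul' (ENNReal.ofReal_le_ofReal (Real.exp_le_exp.2 ?_)) hgε'
          nlinarith [(abs_le.1 hs).1, (Nat.cast_nonneg d : (0 : ℝ) ≤ d)]
      _ = ε := ENNReal.mul_div_cancel hc0 ENNReal.ofReal_ne_top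
  · calc eLpNorm (fun x => g x - w x) 2 volume = eLpNorm (fun x => w x - g x) 2 volume :=
          eLpNorm_sub_comm g w 2 volume
      _ ≤ ε / c := hgε'
      _ ≤ ε / 1 := by gcongr
      _ = ε := div_one ε

theorem hasFDerivAt_transport (hS : IsSingularCone S) (hA : ContDiffOn ℝ 1 A Sᶜ) (s : ℝ)
    {φ : Space d → ℂ} (hφ : ContDiff ℝ 1 φ) {x : Space d} (hx : x ∉ S) (v : Space d) :
    fderiv ℝ (transport A s φ) x v = Complex.exp (Complex.I * rayPhase A s x) *
      (Real.exp s * fderiv ℝ φ (Real.exp s • x) v +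
        Complex.I * (fderiv ℝ (rayPhase A s) x v : ℝ) * φ (Real.exp s • x)) := by
  have h1 : HasFDerivAt (rayPhase A s) (fderiv ℝ (rayPhase A s) x) x :=
    (((contDiffOn_rayPhase hS hA s).contDiffAt (hS.isClosed.isOpen_compl.mem_nhds hx)).differentiableAt
      one_ne_zero).hasFDerivAt
  have h2 : HasFDerivAt (fun x => Complex.exp (Complex.I * rayPhase A s x)) _ x :=
    ((Complex.ofRealCLM.hasFDerivAt.comp x h1).const_mul Complex.I).cexp
  have h3 : HasFDerivAt (fun x : Space d => φ (Real.exp s • x)) _ x :=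
    ((hφ.differentiable one_ne_zero) (Real.exp s • x)).hasFDerivAt.comp x
      ((hasFDerivAt_id x).const_smul (Real.exp s))
  have h4 : fderiv ℝ (transport A s φ) x = _ := (h2.mul h3).fderiv
  rw [h4]
  simp
  ring

/-- The phase is only C¹ because A is, so smooth test functions do not stay smooth under T_s; this
is the reason for the class `IsC1Test`. The support stays off `S` because `S` is a cone. -/
theorem IsC1Test.transport (hS : IsSingularCone S) (hA : ContDiffOn ℝ 1 A Sᶜ) (s : ℝ)
    {φ : Space d → ℂ} (hφ : IsC1Test S φ) : IsC1Test S (transport A s φ) := by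
  have hcl : IsClosed ((fun x : Space d => Real.exp s • x) ⁻¹' tsupport φ) :=
    (isClosed_tsupport φ).preimage (continuous_const_smul _)
  have hsub : tsupport (MagneticSchrodinger.transport A s φ) ⊆ (fun x : Space d => Real.exp s • x) ⁻¹' tsupport φ := by
    refine closure_minimal (fun x hx => ?_) hcl
    refine subset_closure fun h => hx ?_
    simp [MagneticSchrodinger.transport, h]
  have hsub' : (fun x : Space d => Real.exp s • x) ⁻¹' tsupport φ ⊆ Sᶜ := fun x hx hxS =>
    hφ.support hx (hS.smul_mem _ (Real.exp_pos s) _ hxS)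
  refine ⟨contDiff_iff_contDiffAt.2 fun x => ?_, ?_, hsub.trans hsub'⟩
  · by_cases hx : x ∈ S
    · have h2 : MagneticSchrodinger.transport A s φ =ᶠ[𝓝 x] fun _ => 0 := by
        filter_upwards [hcl.isOpen_compl.mem_nhds fun h => hsub' h hx] with y hy
        exact image_eq_zero_of_notMem_tsupport fun h => hy (hsub h)
      exact contDiffAt_const.congr_of_eventuallyEq h2
    · have h1 := (contDiffOn_rayPhase hS hA s).contDiffAt (hS.isClosed.isOpen_compl.mem_nhds hx)
      have h2 : ContDiffAt ℝ 1 (fun x => Complex.exp (Complex.I * rayPhase A s x)) x :=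
        (contDiffAt_const.mul (Complex.ofRealCLM.contDiff.contDiffAt.comp x h1)).cexp
      exact h2.smul (hφ.contDiff.comp (contDiff_const_smul (Real.exp s))).contDiffAt
  · refine HasCompactSupport.of_support_subset_isCompact ?_ (subset_closure.trans hsub)
    exact (Homeomorph.smulOfNeZero (Real.exp s) (Real.exp_ne_zero s)).isClosedEmbedding.isCompact_preimage hφ.compact

/-- Differentiating the phase factor adds its gradient to A; taking out the e^s A(e^s x) that
belongs to e^s T_s ∇_A φ leaves exactly the defect. -/
theorem magneticGrad_transport (hS : IsSingularCone S) (hA : ContDiffOn ℝ 1 A Sᶜ) (s : ℝ)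
    {φ : Space d → ℂ} (hφ : ContDiff ℝ 1 φ) {x : Space d} (hx : x ∉ S) :
    magneticGrad A (transport A s φ) x = (Real.exp s : ℂ) • transport A s (magneticGrad A φ) x +
      (Complex.I * transport A s φ x) • cvec (phaseDefect A s x) := by
  ext j
  have h : gradient (rayPhase A s) x j = fderiv ℝ (rayPhase A s) x (coordVec j) := by
    rw [← inner_gradient_left, inner_coordVec]
  simp only [magneticGrad, hasFDerivAt_transport hS hA s hφ hx, transport, PiLp.add_apply,
    PiLp.smul_apply, cvec_apply, phaseDefect, PiLp.sub_apply, h, smul_eq_mul]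
  push_cast
  ring

/-- The s-derivative of the phase is A · x at the point e^s x, which turns the radial derivative of
φ into the covariant one. Thus x·∇_A generates T_s, and no derivative of A appears. -/
theorem hasDerivAt_transport (hS : IsSingularCone S) (hA : ContDiffOn ℝ 1 A Sᶜ) (s : ℝ)
    {φ : Space d → ℂ} (hφ : ContDiff ℝ 1 φ) {x : Space d} (hx : x ∉ S) :
    HasDerivAt (fun s => transport A s φ x)
      (transport A s (fun y => inner ℂ (cvec y) (magneticGrad A φ y)) x) s := by
  have h1 : HasDerivAt (fun s => Complex.exp (Complex.I * rayPhase A s x)) _ s :=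
    (((hasDerivAt_rayPhase hS hA hx s).ofReal_comp).const_mul Complex.I).cexp
  have h2 : HasDerivAt (fun s : ℝ => φ (Real.exp s • x)) _ s :=
    ((hφ.differentiable one_ne_zero) (Real.exp s • x)).hasFDerivAt.comp_hasDerivAt s
      ((Real.hasDerivAt_exp s).smul_const x)
  refine (h1.mul h2).congr_deriv ?_
  simp only [transport, inner_cvec_magneticGrad, smul_eq_mul]
  ring

end Transport

/-! ### Finite energy functions on annuli and slopes of their dilations -/

section EnergyPair

variable {d : ℕ} {S : Set (Space d)} {A : Space d → Space d}

/-- The radial component `⟨x, H⟩`. -/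
def radial (H : Space d → EuclideanSpace ℂ (Fin d)) (x : Space d) : ℂ := inner ℂ (cvec x) (H x)

theorem norm_radial_le (H : Space d → EuclideanSpace ℂ (Fin d)) (x : Space d) :
    ‖radial H x‖ ≤ ‖x‖ * ‖H x‖ := norm_inner_cvec_le x (H x)

theorem TendstoL2.tendsto_eLpNorm {α ι F : Type*} [MeasurableSpace α] {μ : Measure α}
    {l : Filter ι} [NormedAddCommGroup F] {f : ι → α → F} {g : α → F} (h : TendstoL2 μ l f g) :
    Tendsto (fun i => eLpNorm (f i) 2 μ) l (𝓝 (eLpNorm g 2 μ)) := by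
  have h1 := h.tendsto_toLp.enorm
  simpa [Lp.enorm_toLp] using h1

theorem IsC1Test.continuous_radial {φ : Space d → ℂ} (hφ : IsC1Test S φ)
    (hS : IsSingularCone S) (hA : ContDiffOn ℝ 1 A Sᶜ) :
    Continuous (radial (magneticGrad A φ)) :=
  continuous_cvec.inner (hφ.continuous_magneticGrad hS hA)

theorem hasCompactSupport_radial {φ : Space d → ℂ} (h : HasCompactSupport φ) :
    HasCompactSupport (radial (magneticGrad A φ)) :=
  HasCompactSupport.intro h fun x hx => by
    rw [radial, magneticGrad_eq_zero hx, inner_zero_right]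

theorem IsC1Test.memLp {φ : Space d → ℂ} (hφ : IsC1Test S φ) : MemLp φ 2 volume :=
  hφ.contDiff.continuous.memLp_of_hasCompactSupport hφ.compact

theorem IsC1Test.memLp_magneticGrad {φ : Space d → ℂ} (hφ : IsC1Test S φ)
    (hS : IsSingularCone S) (hA : ContDiffOn ℝ 1 A Sᶜ) : MemLp (magneticGrad A φ) 2 volume :=
  (hφ.continuous_magneticGrad hS hA).memLp_of_hasCompactSupport
    (hasCompactSupport_magneticGrad hφ.compact)

theorem IsC1Test.sub {φ ψ : Space d → ℂ} (hφ : IsC1Test S φ) (hψ : IsC1Test S ψ) :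
    IsC1Test S (fun x => φ x - ψ x) := by
  refine ⟨hφ.contDiff.sub hψ.contDiff, hφ.compact.sub hψ.compact, ?_⟩
  have h : tsupport (fun x => φ x - ψ x) ⊆ tsupport φ ∪ tsupport ψ := by
    refine closure_minimal (fun x hx => ?_) ((isClosed_tsupport φ).union (isClosed_tsupport ψ))
    by_contra h'
    rw [Set.mem_union, not_or] at h'
    exact hx (by simp [image_eq_zero_of_notMem_tsupport h'.1, image_eq_zero_of_notMem_tsupport h'.2])
  exact h.trans (Set.union_subset hφ.support hψ.support)

theorem magneticGrad_sub {φ ψ : Space d → ℂ} (hφ : ContDiff ℝ 1 φ) (hψ : ContDiff ℝ 1 ψ)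
    (x : Space d) :
    magneticGrad A (fun x => φ x - ψ x) x = magneticGrad A φ x - magneticGrad A ψ x := by
  ext j
  simp only [magneticGrad, PiLp.sub_apply]
  rw [fderiv_fun_sub (hφ.differentiable one_ne_zero x) (hψ.differentiable one_ne_zero x)]
  simp only [sub_apply]
  ring

/-- The slopes of `s ↦ T_s φ` converge in `L²` to the radial covariant derivative. -/
theorem tendstoL2_slope_of_isC1Test (hS : IsSingularCone S) (hA : ContDiffOn ℝ 1 A Sᶜ)
    {φ : Space d → ℂ} (hφ : IsC1Test S φ) (s : ℝ) :
    TendstoL2 volume (𝓝[≠] 0)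
      (fun h x => h⁻¹ • (transport A (s + h) φ x - transport A s φ x))
      (transport A s (radial (magneticGrad A φ))) := by
  have hXc := hφ.continuous_radial hS hA
  have hXs : HasCompactSupport (radial (magneticGrad A φ)) := hasCompactSupport_radial hφ.compact
  obtain ⟨R, hR, hφR⟩ := exists_norm_le_of_hasCompactSupport hφ.compact
  obtain ⟨R', hR', hXR⟩ := exists_norm_le_of_hasCompactSupport hXs
  obtain ⟨M, hM⟩ := hXc.bounded_above_of_compact_support hXs
  have hM0 : 0 ≤ M := (norm_nonneg _).trans (hM 0)
  have hXm : MemLp (radial (magneticGrad A φ)) 2 volume := hXc.memLp_of_hasCompactSupport hXs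
  -- Outside the ball of radius Q the points e^{s+h} x with |h| ≤ 1 have left both supports.
  set Q := max R R' * Real.exp (1 - s) with hQ
  have hout : ∀ x : Space d, Q < ‖x‖ → ∀ h : ℝ, |h| ≤ 1 → max R R' < ‖Real.exp (s + h) • x‖ := by
    intro x hx h hh
    rw [norm_smul, Real.norm_of_nonneg (Real.exp_pos _).le]
    calc max R R' = Real.exp (s - 1) * Q := by
          rw [hQ, mul_comm (max R R'), ← mul_assoc, ← Real.exp_add]; simp
      _ < Real.exp (s - 1) * ‖x‖ := by gcongr
      _ ≤ _ := by gcongr; linarith [(abs_le.1 hh).1]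
  have hT : ∀ t x, ‖transport A t (radial (magneticGrad A φ)) x‖ ≤ M := fun t x => by
    rw [norm_transport]; exact hM _
  refine tendstoL2_of_dominated (memLp_indicator_closedBall Q (2 * M)) (fun h => ?_)
    (memLp_transport hS hA hXm s).1 ?_ ?_ ?_
  · exact ((memLp_transport hS hA hφ.memLp _).sub (memLp_transport hS hA hφ.memLp _)).const_smul h⁻¹
  · refine Eventually.of_forall fun x => ?_
    by_cases hx : x ∈ Metric.closedBall (0 : Space d) Q
    · rw [Set.indicator_of_mem hx, Real.norm_of_nonneg (by positivity)]
      linarith [hT s x]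
    · rw [mem_closedBall_zero_iff, not_le] at hx
      rw [norm_transport, hXR, norm_zero]
      · exact norm_nonneg _
      · simpa using (le_max_right R R').trans_lt (hout x hx 0 (by simp))
  · have h1 : ∀ᶠ h : ℝ in 𝓝[≠] 0, |h| ≤ 1 := by
      filter_upwards [nhdsWithin_le_nhds (Metric.closedBall_mem_nhds (0 : ℝ) one_pos)] with h hh
      rwa [mem_closedBall_zero_iff, Real.norm_eq_abs] at hh
    filter_upwards [h1] with h hh
    filter_upwards [hS.ae_notMem] with x hxS
    by_cases hx : x ∈ Metric.closedBall (0 : Space d) Q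
    · rw [Set.indicator_of_mem hx, Real.norm_of_nonneg (by positivity), two_mul]
      refine (norm_sub_le _ _).trans (add_le_add ?_ (hT s x))
      -- The mean value inequality in the dilation parameter bounds the slopes by M uniformly in h.
      have h2 := convex_univ.norm_image_sub_le_of_norm_hasDerivWithin_le (𝕜 := ℝ)
        (f := fun t => transport A t φ x) (C := M) (x := s) (y := s + h)
        (fun t _ => (hasDerivAt_transport hS hA t hφ.contDiff hxS).hasDerivWithinAt)
        (fun t _ => hT t x) trivial trivial
      rw [add_sub_cancel_left] at h2
      rw [norm_smul, norm_inv]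
      rcases eq_or_ne h 0 with rfl | hne
      · simpa using hM0
      · rw [inv_mul_le_iff₀ (norm_pos_iff.2 hne), mul_comm]
        exact h2
    · rw [mem_closedBall_zero_iff, not_le] at hx
      have e1 : transport A (s + h) φ x = 0 := by
        rw [← norm_eq_zero, norm_transport, hφR _ ((le_max_left R R').trans_lt (hout x hx h hh)),
          norm_zero]
      have h0 := hout x hx 0 (by simp)
      rw [add_zero] at h0
      have e2 : transport A s φ x = 0 := by
        rw [← norm_eq_zero, norm_transport, hφR _ ((le_max_left R R').trans_lt h0), norm_zero]
      have e3 : transport A s (radial (magneticGrad A φ)) x = 0 := by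
        rw [← norm_eq_zero, norm_transport, hXR _ ((le_max_right R R').trans_lt h0), norm_zero]
      rw [e1, e2, e3]
      simp
  · filter_upwards [hS.ae_notMem] with x hx
    have h := hasDerivAt_transport hS hA s hφ.contDiff hx
    rw [hasDerivAt_iff_tendsto_slope_zero] at h
    exact h

/-- The L²-valued curve t ↦ T_t φ has speed e^{-td/2} times the norm of the radial derivative, at
most e^{d/2} times it for |t| ≤ 1. The bound contains neither φ nor the defect, so it passes to
limits of test functions. -/
theorem eLpNorm_transport_sub_le_of_isC1Test (hS : IsSingularCone S) (hA : ContDiffOn ℝ 1 A Sᶜ)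
    {φ : Space d → ℂ} (hφ : IsC1Test S φ) {s : ℝ} (hs : |s| ≤ 1) :
    eLpNorm (fun x => transport A s φ x - φ x) 2 volume ≤
      ENNReal.ofReal (Real.exp (d / 2) * |s|) * eLpNorm (radial (magneticGrad A φ)) 2 volume := by
  have hXm : MemLp (radial (magneticGrad A φ)) 2 volume :=
    (hφ.continuous_radial hS hA).memLp_of_hasCompactSupport (hasCompactSupport_radial hφ.compact)
  have hm := fun t => memLp_transport hS hA hφ.memLp t
  have hXt := fun t => memLp_transport hS hA hXm t
  set c : ℝ → Lp ℂ 2 (volume : Measure (Space d)) := fun t => (hm t).toLp (transport A t φ)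
  have hd : ∀ t, HasDerivAt c ((hXt t).toLp (transport A t (radial (magneticGrad A φ)))) t := by
    intro t
    have h0 := (tendstoL2_slope_of_isC1Test hS hA hφ t).tendsto_toLp
    refine hasDerivAt_iff_tendsto_slope_zero.2 (Tendsto.congr (fun h => ?_) h0)
    have h1 : c (t + h) - c t = ((hm (t + h)).sub (hm t)).toLp _ := (MemLp.toLp_sub _ _).symm
    rw [h1, ← MemLp.toLp_const_smul]
    rfl
  have hb : ∀ t ∈ Set.Icc (-1 : ℝ) 1, ‖(hXt t).toLp (transport A t (radial (magneticGrad A φ)))‖ ≤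
      Real.exp (d / 2) * (eLpNorm (radial (magneticGrad A φ)) 2 volume).toReal := by
    intro t ht
    rw [Lp.norm_toLp, eLpNorm_transport, ENNReal.toReal_mul, ENNReal.toReal_ofReal (Real.exp_pos _).le]
    gcongr
    nlinarith [ht.1, (Nat.cast_nonneg d : (0 : ℝ) ≤ d)]
  have h := (convex_Icc (-1 : ℝ) 1).norm_image_sub_le_of_norm_hasDerivWithin_le
    (fun t _ => (hd t).hasDerivWithinAt) hb (x := 0) (y := s) (by simp) (abs_le.1 hs)
  have e : c s - c 0 = ((hm s).sub hφ.memLp).toLp (fun x => transport A s φ x - φ x) := by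
    have : c 0 = hφ.memLp.toLp φ := by
      simp only [c, transport_zero]
    rw [this]
    exact (MemLp.toLp_sub _ _).symm
  rw [e, Lp.norm_toLp, sub_zero, Real.norm_eq_abs] at h
  have hfin : eLpNorm (fun x => transport A s φ x - φ x) 2 volume ≠ ⊤ :=
    ((hm s).sub hφ.memLp).eLpNorm_ne_top
  rw [← ENNReal.ofReal_toReal hfin, ← ENNReal.ofReal_toReal hXm.eLpNorm_ne_top,
    ← ENNReal.ofReal_mul (by positivity)]
  refine ENNReal.ofReal_le_ofReal (h.trans_eq ?_)
  ring

/-- A pair of a function and its magnetic gradient in `L²`, supported in `ρ ≤ |x| ≤ R`. -/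
structure EnergyPair (S : Set (Space d)) (A : Space d → Space d) (ρ R : ℝ) (w : Space d → ℂ)
    (H : Space d → EuclideanSpace ℂ (Fin d)) : Prop where
  zero : ∀ x, ‖x‖ < ρ ∨ R < ‖x‖ → w x = 0 ∧ H x = 0
  approx : ∃ φ : ℕ → Space d → ℂ, (∀ n, IsC1Test S (φ n)) ∧
    (∀ n x, ‖x‖ < ρ ∨ R < ‖x‖ → φ n x = 0) ∧
    TendstoL2 volume atTop φ w ∧ TendstoL2 volume atTop (fun n => magneticGrad A (φ n)) H

theorem EnergyPair.memLp {ρ R : ℝ} {w : Space d → ℂ} {H : Space d → EuclideanSpace ℂ (Fin d)}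
    (h : EnergyPair S A ρ R w H) : MemLp w 2 volume := by
  obtain ⟨φ, -, -, h, -⟩ := h.approx
  exact h.memLp_lim

theorem EnergyPair.memLp_grad {ρ R : ℝ} {w : Space d → ℂ}
    {H : Space d → EuclideanSpace ℂ (Fin d)} (h : EnergyPair S A ρ R w H) : MemLp H 2 volume := by
  obtain ⟨φ, -, -, -, h⟩ := h.approx
  exact h.memLp_lim

theorem magneticGrad_eq_zero_of_annulus {ρ R : ℝ} {φ : Space d → ℂ}
    (h : ∀ x, ‖x‖ < ρ ∨ R < ‖x‖ → φ x = 0) {x : Space d} (hx : ‖x‖ < ρ ∨ R < ‖x‖) :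
    magneticGrad A φ x = 0 := by
  refine magneticGrad_eq_zero fun hx' => ?_
  have hcl : IsClosed {x : Space d | ρ ≤ ‖x‖ ∧ ‖x‖ ≤ R} :=
    (isClosed_le continuous_const continuous_norm).inter
      (isClosed_le continuous_norm continuous_const)
  have := closure_minimal (s := Function.support φ) (fun y hy => ?_) hcl hx'
  · rcases hx with hx | hx
    · exact absurd this.1 (not_le.2 hx)
    · exact absurd this.2 (not_le.2 hx)
  · refine ⟨?_, ?_⟩ <;> by_contra hc
    · exact hy (h y (Or.inl (not_le.1 hc)))
    · exact hy (h y (Or.inr (not_le.1 hc)))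

theorem IsC1Test.energyPair (hS : IsSingularCone S) (hA : ContDiffOn ℝ 1 A Sᶜ) {ρ R : ℝ}
    {φ : Space d → ℂ} (hφ : IsC1Test S φ) (h : ∀ x, ‖x‖ < ρ ∨ R < ‖x‖ → φ x = 0) :
    EnergyPair S A ρ R φ (magneticGrad A φ) :=
  ⟨fun x hx => ⟨h x hx, magneticGrad_eq_zero_of_annulus h hx⟩, fun _ => φ, fun _ => hφ,
    fun _ => h, TendstoL2.const hφ.memLp, TendstoL2.const (hφ.memLp_magneticGrad hS hA)⟩

theorem EnergyPair.sub {ρ R : ℝ} {w w' : Space d → ℂ} {H H' : Space d → EuclideanSpace ℂ (Fin d)}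
    (h : EnergyPair S A ρ R w H) (h' : EnergyPair S A ρ R w' H') :
    EnergyPair S A ρ R (fun x => w x - w' x) (fun x => H x - H' x) := by
  obtain ⟨φ, h1, h2, h3, h4⟩ := h.approx
  obtain ⟨φ', h1', h2', h3', h4'⟩ := h'.approx
  refine ⟨fun x hx => ?_, fun n x => φ n x - φ' n x, fun n => (h1 n).sub (h1' n),
    fun n x hx => ?_, h3.sub h3', ?_⟩
  · simp [h.zero x hx, h'.zero x hx]
  · simp [h2 n x hx, h2' n x hx]
  · refine (h4.sub h4').congr_ae (fun n => Eventually.of_forall fun x => ?_) (EventuallyEq.refl _ _)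
    exact (magneticGrad_sub (h1 n).contDiff (h1' n).contDiff x).symm

/-- Contraction with x has norm at most R on the common support. This is where the outer radius of
an energy pair is needed. -/
theorem tendstoL2_radial {ρ R : ℝ} {w : Space d → ℂ}
    {H : Space d → EuclideanSpace ℂ (Fin d)} {ι : Type*} {l : Filter ι}
    {H' : ι → Space d → EuclideanSpace ℂ (Fin d)}
    (h : TendstoL2 volume l H' H) (hz : ∀ x, ‖x‖ < ρ ∨ R < ‖x‖ → w x = 0 ∧ H x = 0)
    (hz' : ∀ n x, ‖x‖ < ρ ∨ R < ‖x‖ → H' n x = 0) :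
    TendstoL2 volume l (fun n => radial (H' n)) (radial H) := by
  have mem : ∀ H : Space d → EuclideanSpace ℂ (Fin d), MemLp H 2 volume →
      (∀ x, ‖x‖ < ρ ∨ R < ‖x‖ → H x = 0) → MemLp (radial H) 2 volume := by
    intro H hH hz
    refine hH.of_le_mul (c := R) (continuous_cvec.aestronglyMeasurable.inner hH.1)
      (Eventually.of_forall fun x => ?_)
    rcases lt_or_ge R ‖x‖ with hx | hx
    · simp [radial, hz x (Or.inr hx)]
    · exact (norm_radial_le H x).trans (by gcongr)
  refine h.of_norm_sub_le (fun n => mem _ (h.memLp n) (hz' n))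
    (mem _ h.memLp_lim fun x hx => (hz x hx).2) R fun n => Eventually.of_forall fun x => ?_
  rcases lt_or_ge R ‖x‖ with hx | hx
  · simp [radial, hz x (Or.inr hx), hz' n x (Or.inr hx)]
  · rw [radial, radial, ← inner_sub_right]
    exact (norm_inner_cvec_le _ _).trans (by gcongr)

theorem EnergyPair.memLp_radial {ρ R : ℝ} {w : Space d → ℂ}
    {H : Space d → EuclideanSpace ℂ (Fin d)} (h : EnergyPair S A ρ R w H) :
    MemLp (radial H) 2 volume :=
  (tendstoL2_radial (l := (atTop : Filter ℕ)) (TendstoL2.const h.memLp_grad) h.zero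
    fun _ x hx => (h.zero x hx).2).memLp_lim

theorem EnergyPair.eLpNorm_transport_sub_le (hS : IsSingularCone S) (hA : ContDiffOn ℝ 1 A Sᶜ)
    {ρ R : ℝ} {w : Space d → ℂ} {H : Space d → EuclideanSpace ℂ (Fin d)}
    (h : EnergyPair S A ρ R w H) {s : ℝ} (hs : |s| ≤ 1) :
    eLpNorm (fun x => transport A s w x - w x) 2 volume ≤
      ENNReal.ofReal (Real.exp (d / 2) * |s|) * eLpNorm (radial H) 2 volume := by
  obtain ⟨φ, h1, h2, h3, h4⟩ := h.approx
  have hX := tendstoL2_radial h4 h.zero fun n x hx => magneticGrad_eq_zero_of_annulus (h2 n) hx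
  exact le_of_tendsto_of_tendsto' ((h3.transport hS hA s).sub h3).tendsto_eLpNorm
    (ENNReal.Tendsto.const_mul hX.tendsto_eLpNorm (Or.inr ENNReal.ofReal_ne_top))
    fun n => eLpNorm_transport_sub_le_of_isC1Test hS hA (h1 n) hs

/-- A density argument: the slopes of a single approximant φ_n converge, and the slopes of w - φ_n
are small uniformly in s by `EnergyPair.eLpNorm_transport_sub_le`, since φ_n also approximates the
radial derivative. -/
theorem EnergyPair.tendstoL2_slope (hS : IsSingularCone S) (hA : ContDiffOn ℝ 1 A Sᶜ)
    {ρ R : ℝ} {w : Space d → ℂ} {H : Space d → EuclideanSpace ℂ (Fin d)}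
    (h : EnergyPair S A ρ R w H) :
    TendstoL2 volume (𝓝[≠] 0) (fun s x => s⁻¹ • (transport A s w x - w x)) (radial H) := by
  have hm : ∀ {w : Space d → ℂ}, MemLp w 2 volume → ∀ s : ℝ,
      MemLp (fun x => s⁻¹ • (transport A s w x - w x)) 2 volume := fun hw s =>
    ((memLp_transport hS hA hw s).sub hw).const_smul s⁻¹
  refine tendstoL2_of_approx (hm h.memLp) h.memLp_radial fun ε hε => ?_
  obtain ⟨φ, h1, h2, h3, h4⟩ := h.approx
  have hX := tendstoL2_radial h4 h.zero fun n x hx => magneticGrad_eq_zero_of_annulus (h2 n) hx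
  have hc0 : ENNReal.ofReal (Real.exp (d / 2)) ≠ 0 := (ENNReal.ofReal_pos.2 (Real.exp_pos _)).ne'
  have hc1 : 1 ≤ ENNReal.ofReal (Real.exp (d / 2)) := by
    rw [ENNReal.one_le_ofReal]
    exact Real.one_le_exp (by positivity)
  have hδ : 0 < ε / ENNReal.ofReal (Real.exp (d / 2)) :=
    ENNReal.div_pos hε.ne' ENNReal.ofReal_ne_top
  obtain ⟨n, hn⟩ := ((ENNReal.tendsto_nhds_zero.1 hX.tendsto) _ hδ).exists
  have hs := tendstoL2_slope_of_isC1Test hS hA (h1 n) 0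
  simp only [zero_add, transport_zero] at hs
  refine ⟨_, _, hs, ?_, ?_⟩
  · have hd := h.sub ((h1 n).energyPair hS hA (h2 n))
    have h5 : ∀ᶠ s : ℝ in 𝓝[≠] 0, |s| ≤ 1 := by
      filter_upwards [nhdsWithin_le_nhds (Metric.closedBall_mem_nhds (0 : ℝ) one_pos)] with s hs
      rwa [mem_closedBall_zero_iff, Real.norm_eq_abs] at hs
    filter_upwards [h5, self_mem_nhdsWithin] with s hs1 hs0
    have hs0' : s ≠ 0 := hs0
    have e : (fun x => s⁻¹ • (transport A s w x - w x) -
        s⁻¹ • (transport A s (φ n) x - φ n x)) =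
        s⁻¹ • fun x => transport A s (fun y => w y - φ n y) x - (w x - φ n x) := by
      ext x
      simp only [transport_sub, Pi.smul_apply, ← smul_sub]
      congr 1
      ring
    have e2 : radial (fun x => H x - magneticGrad A (φ n) x) =
        (fun x => radial H x - radial (magneticGrad A (φ n)) x) := by
      ext x
      simp [radial]
    rw [e, eLpNorm_const_smul]
    have h6 := hd.eLpNorm_transport_sub_le hS hA hs1
    rw [e2, show eLpNorm (fun x => radial H x - radial (magneticGrad A (φ n)) x) 2 volume =
      eLpNorm (fun x => radial (magneticGrad A (φ n)) x - radial H x) 2 volume from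
      eLpNorm_sub_comm _ _ _ _] at h6
    have h7 : ‖s⁻¹‖ₑ = ENNReal.ofReal |s|⁻¹ := by
      rw [← abs_inv, ← Real.enorm_eq_ofReal_abs]
    calc _ ≤ ‖s⁻¹‖ₑ * (ENNReal.ofReal (Real.exp (d / 2) * |s|) *
          (ε / ENNReal.ofReal (Real.exp (d / 2)))) := by
          gcongr
          exact h6.trans (by gcongr)
      _ = ENNReal.ofReal (Real.exp (d / 2)) * (ε / ENNReal.ofReal (Real.exp (d / 2))) := by
          rw [← mul_assoc, h7, ← ENNReal.ofReal_mul (by positivity)]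
          congr 2
          field_simp
      _ = ε := ENNReal.mul_div_cancel hc0 ENNReal.ofReal_ne_top
  · calc _ ≤ ε / ENNReal.ofReal (Real.exp (d / 2)) := hn
      _ ≤ ε / 1 := by gcongr
      _ = ε := div_one ε

/-- The mean of the slopes at s and -s. The symmetric form lets T_{-s} be exchanged for the adjoint
of T_s later, so that no slope of the gradient is needed. -/
theorem EnergyPair.tendstoL2_symmetric_slope (hS : IsSingularCone S)
    (hA : ContDiffOn ℝ 1 A Sᶜ) {ρ R : ℝ} {w : Space d → ℂ}
    {H : Space d → EuclideanSpace ℂ (Fin d)} (h : EnergyPair S A ρ R w H) :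
    TendstoL2 volume (𝓝[>] 0)
      (fun s x => (2 * s)⁻¹ • (transport A s w x - transport A (-s) w x)) (radial H) := by
  have h0 := h.tendstoL2_slope hS hA
  have t1 : Tendsto (fun s : ℝ => s) (𝓝[>] 0) (𝓝[≠] 0) := nhdsWithin_mono _ fun s hs => ne_of_gt hs
  have t2 : Tendsto (fun s : ℝ => -s) (𝓝[>] 0) (𝓝[≠] 0) := by
    refine tendsto_nhdsWithin_iff.2 ⟨?_, ?_⟩
    · have : Tendsto (fun s : ℝ => -s) (𝓝 0) (𝓝 (-0)) := continuous_neg.tendsto 0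
      rw [neg_zero] at this
      exact this.mono_left nhdsWithin_le_nhds
    · filter_upwards [self_mem_nhdsWithin] with s hs
      exact neg_ne_zero.2 (ne_of_gt hs)
  refine (((h0.comp t1).add (h0.comp t2)).const_smul (2⁻¹ : ℝ)).congr_ae
    (fun s => Eventually.of_forall fun x => ?_) (Eventually.of_forall fun x => ?_)
  · simp only [Complex.real_smul]
    push_cast
    rw [inv_neg, mul_inv]
    ring
  · simp only [Complex.real_smul]
    push_cast
    ring

end EnergyPair

/-! ### The weak equation for C¹ test functions -/

section WeakForm

variable {d : ℕ} {S : Set (Space d)} {A : Space d → Space d}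

theorem norm_le_sum_norm (v : EuclideanSpace ℂ (Fin d)) : ‖v‖ ≤ ∑ j, ‖v j‖ := by
  have hv : v = ∑ j, EuclideanSpace.single j (v j) := by
    ext i
    simp [Finset.sum_apply, Pi.single_apply]
  conv_lhs => rw [hv]
  refine (norm_sum_le _ _).trans_eq (Finset.sum_congr rfl fun j _ => ?_)
  rw [PiLp.norm_single]

open Convolution in
/-- Mollification of a continuously differentiable function with compact support off `S`. -/
theorem IsC1Test.exists_approx (hS : IsSingularCone S) (hA : ContDiffOn ℝ 1 A Sᶜ)
    {φ : Space d → ℂ} (hφ : IsC1Test S φ) :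
    ∃ (ψ : ℕ → Space d → ℂ) (K : Set (Space d)), (∀ n, IsTestFunction S (ψ n)) ∧ IsCompact K ∧
      K ⊆ Sᶜ ∧ tsupport φ ⊆ K ∧ (∀ n, tsupport (ψ n) ⊆ K) ∧ TendstoL2 volume atTop ψ φ ∧
      TendstoL2 volume atTop (fun n => magneticGrad A (ψ n)) (magneticGrad A φ) := by
  -- A thickening of the support that still avoids `S`; mollifiers of radius at most δ keep all
  -- supports in the one compact set `K`.
  obtain ⟨δ, hδ, hδS⟩ := hφ.compact.isCompact.exists_cthickening_subset_open
    hS.isClosed.isOpen_compl hφ.support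
  set K := Metric.cthickening δ (tsupport φ) with hK
  have hKc : IsCompact K := hφ.compact.isCompact.cthickening
  have hpos : ∀ n : ℕ, 0 < δ / (n + 1) := fun n => by positivity
  set b : ℕ → ContDiffBump (0 : Space d) := fun n =>
    ⟨δ / (n + 1) / 2, δ / (n + 1), half_pos (hpos n), half_lt_self (hpos n)⟩ with hb
  have hb0 : Tendsto (fun n => (b n).rOut) atTop (𝓝 0) :=
    tendsto_const_div_atTop_nhds_zero_nat δ |>.comp (tendsto_add_atTop_nat 1) |>.congr
      fun n => by simp [hb]
  have hbδ : ∀ n, (b n).rOut ≤ δ := fun n => div_le_self hδ.le (by simp)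
  set ψ : ℕ → Space d → ℂ := fun n =>
    (b n).normed volume ⋆[ContinuousLinearMap.lsmul ℝ ℝ, volume] φ with hψ
  have hφc := hφ.contDiff.continuous
  have hli : ∀ n, LocallyIntegrable ((b n).normed volume) (volume : Measure (Space d)) := fun n =>
    (b n).continuous_normed.locallyIntegrable
  have hKt : ∀ n, tsupport (ψ n) ⊆ K := by
    intro n
    refine closure_minimal ?_ Metric.isClosed_cthickening
    refine (support_convolution_subset_swap _).trans ?_
    rw [(b n).support_normed_eq]
    rintro _ ⟨y, hy, z, hz, rfl⟩
    refine Metric.mem_cthickening_of_dist_le _ y _ _ (subset_tsupport _ hy) ?_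
    rw [dist_self_add_left]
    exact (mem_ball_zero_iff.1 hz).le.trans (hbδ n)
  have hφK : tsupport φ ⊆ K := Metric.self_subset_cthickening _
  have hψt : ∀ n, IsTestFunction S (ψ n) := fun n =>
    ⟨(b n).hasCompactSupport_normed.contDiff_convolution_left _ (b n).contDiff_normed
      hφc.locallyIntegrable, (b n).hasCompactSupport_normed.convolution _ hφ.compact,
      (hKt n).trans hδS⟩
  -- The derivative is put on φ, so that the gradients converge too.
  have hfd : ∀ n x v, fderiv ℝ (ψ n) x v =
      ((b n).normed volume ⋆[ContinuousLinearMap.lsmul ℝ ℝ, volume] fun y => fderiv ℝ φ y v) x := by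
    intro n x v
    rw [(hφ.compact.hasFDerivAt_convolution_right _ (hli n) hφ.contDiff x).fderiv]
    exact convolution_precompR_apply _ (hli n) (hφ.compact.fderiv ℝ)
      (hφ.contDiff.continuous_fderiv one_ne_zero) x v
  have hbound : ∀ g : Space d → ℂ, Continuous g → HasCompactSupport g → ∃ M, ∀ n x,
      ‖((b n).normed volume ⋆[ContinuousLinearMap.lsmul ℝ ℝ, volume] g) x‖ ≤ M := by
    intro g hg hgs
    obtain ⟨M, hM⟩ := hg.bounded_above_of_compact_support hgs
    refine ⟨2 * M + M, fun n x => ?_⟩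
    have h := (b n).dist_normed_convolution_le (μ := volume) (x₀ := x) (ε := 2 * M)
      hg.aestronglyMeasurable fun y _ => by
        rw [dist_eq_norm]
        linarith [norm_sub_le (g y) (g x), hM x, hM y]
    rw [dist_eq_norm] at h
    linarith [norm_le_norm_sub_add (((b n).normed volume ⋆[ContinuousLinearMap.lsmul ℝ ℝ, volume] g) x)
      (g x), hM x]
  have hdc : ∀ v, Continuous fun y => fderiv ℝ φ y v := fun v =>
    (hφ.contDiff.continuous_fderiv one_ne_zero).clm_apply continuous_const
  have hds : ∀ v, HasCompactSupport fun y => fderiv ℝ φ y v := fun v =>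
    (hφ.compact.fderiv ℝ).comp_left (g := fun L : Space d →L[ℝ] ℂ => L v) rfl
  have hlim : ∀ x, Tendsto (fun n => ψ n x) atTop (𝓝 (φ x)) := fun x =>
    ContDiffBump.convolution_tendsto_right_of_continuous hb0 hφc x
  obtain ⟨M₀, hM₀⟩ := hbound φ hφc hφ.compact
  choose M₁ hM₁ using fun j : Fin d => hbound (fun y => fderiv ℝ φ y (coordVec j)) (hdc _) (hds _)
  obtain ⟨MA, hMA⟩ := hKc.exists_bound_of_continuousOn (hA.continuousOn.mono hδS)
  obtain ⟨N₀, hN₀⟩ := hφc.bounded_above_of_compact_support hφ.compact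
  have hgc := hφ.continuous_magneticGrad hS hA
  obtain ⟨N₁, hN₁⟩ := hgc.bounded_above_of_compact_support (hasCompactSupport_magneticGrad hφ.compact)
  have mK : ∀ M : ℝ, MemLp (K.indicator fun _ : Space d => M) 2 (volume : Measure (Space d)) :=
    fun M => memLp_indicator_const 2 hKc.measurableSet M (Or.inr hKc.measure_lt_top.ne)
  refine ⟨ψ, K, hψt, hKc, hδS, hφK, hKt, ?_, ?_⟩
  · have h0 : 0 ≤ M₀ := (norm_nonneg _).trans (hM₀ 0 0)
    have h1 : 0 ≤ N₀ := (norm_nonneg _).trans (hN₀ 0)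
    refine tendstoL2_of_dominated (mK (M₀ + N₀)) (fun n => (hψt n).isC1Test.memLp)
      hφc.aestronglyMeasurable ?_ ?_ (Eventually.of_forall hlim)
    · refine Eventually.of_forall fun x => ?_
      by_cases hx : x ∈ K
      · rw [Set.indicator_of_mem hx, Real.norm_of_nonneg (by positivity)]
        linarith [hN₀ x]
      · simp [image_eq_zero_of_notMem_tsupport fun h => hx (hφK h)]
    · refine Eventually.of_forall fun n => Eventually.of_forall fun x => ?_
      by_cases hx : x ∈ K
      · rw [Set.indicator_of_mem hx, Real.norm_of_nonneg (by positivity)]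
        linarith [hN₀ x, hM₀ n x, norm_sub_le (ψ n x) (φ x)]
      · simp [image_eq_zero_of_notMem_tsupport fun h => hx (hφK h),
          image_eq_zero_of_notMem_tsupport fun h => hx (hKt n h)]
  · have h1 : 0 ≤ N₁ := (norm_nonneg _).trans (hN₁ 0)
    set Q := ∑ j, (M₁ j + MA * M₀)
    have hQ : ∀ n, ∀ x ∈ K, ‖magneticGrad A (ψ n) x‖ ≤ Q := by
      intro n x hx
      refine (norm_le_sum_norm _).trans (Finset.sum_le_sum fun j _ => ?_)
      have hAj : ‖A x j‖ ≤ MA := (PiLp.norm_apply_le _ _).trans (hMA x hx)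
      have e : magneticGrad A (ψ n) x j =
        fderiv ℝ (ψ n) x (coordVec j) + Complex.I * (A x j : ℂ) * ψ n x := rfl
      rw [e]
      refine (norm_add_le _ _).trans (add_le_add ?_ ?_)
      · rw [hfd]
        exact hM₁ j n x
      · rw [norm_mul, norm_mul, Complex.norm_I, one_mul, Complex.norm_real]
        exact mul_le_mul hAj (hM₀ n x) (norm_nonneg _) ((norm_nonneg _).trans hAj)
    refine tendstoL2_of_dominated (mK (|Q| + N₁))
      (fun n => (hψt n).isC1Test.memLp_magneticGrad hS hA) hgc.aestronglyMeasurable ?_ ?_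
      (Eventually.of_forall fun x => ?_)
    · refine Eventually.of_forall fun x => ?_
      by_cases hx : x ∈ K
      · rw [Set.indicator_of_mem hx, Real.norm_of_nonneg (by positivity)]
        linarith [hN₁ x, abs_nonneg Q]
      · simp [magneticGrad_eq_zero fun h => hx (hφK h)]
    · refine Eventually.of_forall fun n => Eventually.of_forall fun x => ?_
      by_cases hx : x ∈ K
      · rw [Set.indicator_of_mem hx, Real.norm_of_nonneg (by positivity)]
        linarith [hN₁ x, hQ n x hx, le_abs_self Q, norm_sub_le (magneticGrad A (ψ n) x) (magneticGrad A φ x)]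
      · simp [magneticGrad_eq_zero fun h => hx (hφK h), magneticGrad_eq_zero fun h => hx (hKt n h)]
    · refine ((PiLp.continuous_toLp 2 _).tendsto _).comp (tendsto_pi_nhds.2 fun j => ?_)
      refine Tendsto.add ?_ ((hlim x).const_mul _)
      simp_rw [hfd]
      exact ContDiffBump.convolution_tendsto_right_of_continuous hb0 (hdc _) x

/-- The weak equation `-∇_A* ∇_A u + W u = 0` with smooth test functions. -/
def IsWeakSolution (S : Set (Space d)) (A : Space d → Space d) (W : Space d → ℝ)
    (u : Space d → ℂ) (G : Space d → EuclideanSpace ℂ (Fin d)) : Prop :=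
  ∀ φ, IsTestFunction S φ →
    ∫ x, inner ℂ (magneticGrad A φ x) (G x) = ∫ x, inner ℂ (φ x) ((W x : ℂ) * u x)

theorem zero_notMem_of_subset_compl (hS : IsSingularCone S) {K : Set (Space d)} (h : K ⊆ Sᶜ) :
    (0 : Space d) ∉ K := fun h0 => h h0 hS.zero_mem

theorem memLp_indicator_of_memLp_restrict {F : Type*} [NormedAddCommGroup F] {K : Set (Space d)}
    (hK : IsCompact K) {f : Space d → F} (h : MemLp f 2 (volume.restrict K)) :
    MemLp (K.indicator f) 2 volume :=
  (memLp_indicator_iff_restrict hK.measurableSet).2 h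

theorem memLp_potential_mul (hS : IsSingularCone S) {W : Space d → ℝ}
    (hW : AEStronglyMeasurable W volume) (hWb : LocallyBoundedOffOrigin S W) {u : Space d → ℂ}
    (hu : MemLp u 2 volume) {K : Set (Space d)} (hK : IsCompact K) (h0 : (0 : Space d) ∉ K) :
    MemLp (K.indicator fun x => (W x : ℂ) * u x) 2 volume := by
  obtain ⟨C, hC⟩ := hWb K hK h0
  refine hu.of_le_mul (c := |C|) (((Complex.continuous_ofReal.comp_aestronglyMeasurable hW).mul
    hu.1).indicator hK.measurableSet) ?_
  filter_upwards [hS.ae_notMem] with x hx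
  by_cases hxK : x ∈ K
  · rw [Set.indicator_of_mem hxK, norm_mul, Complex.norm_real]
    gcongr
    exact (hC x ⟨hxK, hx⟩).trans (le_abs_self C)
  · rw [Set.indicator_of_notMem hxK, norm_zero]
    positivity

/-- Mollification takes place in a compact set on which G and W u are in L², so both sides pass to
the limit. The extension is needed because dilated test functions are only C¹. -/
theorem IsWeakSolution.of_isC1Test (hS : IsSingularCone S) (hA : ContDiffOn ℝ 1 A Sᶜ)
    {W : Space d → ℝ} (hW : AEStronglyMeasurable W volume) (hWb : LocallyBoundedOffOrigin S W)
    {u : Space d → ℂ} (hu : MemLp u 2 volume) {G : Space d → EuclideanSpace ℂ (Fin d)}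
    (hG : ∀ K : Set (Space d), IsCompact K → (0 : Space d) ∉ K → MemLp G 2 (volume.restrict K))
    (h : IsWeakSolution S A W u G) {φ : Space d → ℂ} (hφ : IsC1Test S φ) :
    ∫ x, inner ℂ (magneticGrad A φ x) (G x) = ∫ x, inner ℂ (φ x) ((W x : ℂ) * u x) := by
  obtain ⟨ψ, K, hψ, hK, hKS, hφK, hψK, h1, h2⟩ := hφ.exists_approx hS hA
  have h0 := zero_notMem_of_subset_compl hS hKS
  have e1 : ∀ η : Space d → ℂ, tsupport η ⊆ K → (∫ x, inner ℂ (magneticGrad A η x) (G x)) =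
      ∫ x, inner ℂ (magneticGrad A η x) (K.indicator G x) := fun η hη => by
    congr 1
    ext x
    by_cases hx : x ∈ K
    · rw [Set.indicator_of_mem hx]
    · rw [magneticGrad_eq_zero fun h => hx (hη h), inner_zero_left, inner_zero_left]
  have e2 : ∀ η : Space d → ℂ, tsupport η ⊆ K → (∫ x, inner ℂ (η x) ((W x : ℂ) * u x)) =
      ∫ x, inner ℂ (η x) (K.indicator (fun x => (W x : ℂ) * u x) x) := fun η hη => by
    congr 1
    ext x
    by_cases hx : x ∈ K
    · rw [Set.indicator_of_mem hx]
    · rw [image_eq_zero_of_notMem_tsupport fun h => hx (hη h), inner_zero_left, inner_zero_left]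
  have l1 := h2.tendsto_integral_inner (𝕜 := ℂ)
    (TendstoL2.const (memLp_indicator_of_memLp_restrict hK (hG K hK h0)))
  have l2 := h1.tendsto_integral_inner (𝕜 := ℂ)
    (TendstoL2.const (memLp_potential_mul hS hW hWb hu hK h0))
  rw [e1 φ hφK, e2 φ hφK]
  refine tendsto_nhds_unique l1 (l2.congr fun n => ?_)
  rw [← e1 _ (hψK n), ← e2 _ (hψK n)]
  exact (h _ (hψ n)).symm

end WeakForm

/-! ### Radial cutoffs -/

section Cutoff

variable {d : ℕ} {S : Set (Space d)} {A : Space d → Space d} {a b : ℝ} {f : ℝ → ℝ}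

/-- Continuously differentiable functions supported in `[a, b]`, `a > 0`. -/
structure IsCutoff (a b : ℝ) (f : ℝ → ℝ) : Prop where
  pos : 0 < a
  contDiff : ContDiff ℝ 1 f
  zero : ∀ r, r < a ∨ b < r → f r = 0

theorem IsCutoff.deriv_zero (h : IsCutoff a b f) {r : ℝ} (hr : r < a ∨ b < r) : deriv f r = 0 := by
  have ho : IsOpen {r : ℝ | r < a ∨ b < r} := isOpen_Iio.union isOpen_Ioi
  have : f =ᶠ[𝓝 r] fun _ => 0 := by
    filter_upwards [ho.mem_nhds hr] with t ht using h.zero t ht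
  rw [this.deriv_eq, deriv_const]

theorem IsCutoff.hasDerivAt (h : IsCutoff a b f) (r : ℝ) : HasDerivAt f (deriv f r) r :=
  (h.contDiff.differentiable one_ne_zero r).hasDerivAt

theorem IsCutoff.continuous_deriv (h : IsCutoff a b f) : Continuous (deriv f) :=
  h.contDiff.continuous_deriv le_rfl

theorem exists_bound_of_zero_off {g : ℝ → ℝ} (hg : Continuous g)
    (h : ∀ r, r < a ∨ b < r → g r = 0) : ∃ M, 0 ≤ M ∧ ∀ r, |g r| ≤ M := by
  obtain ⟨M, hM⟩ := (isCompact_Icc (a := a) (b := b)).exists_bound_of_continuousOn hg.continuousOn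
  refine ⟨|M|, abs_nonneg _, fun r => ?_⟩
  by_cases hr : r ∈ Set.Icc a b
  · exact (hM r hr).trans (le_abs_self M)
  · rw [h r, abs_zero]
    · exact abs_nonneg M
    · rw [Set.mem_Icc, not_and_or, not_le, not_le] at hr
      exact hr

theorem IsCutoff.bounded (h : IsCutoff a b f) : ∃ M, 0 ≤ M ∧ ∀ r, |f r| ≤ M :=
  exists_bound_of_zero_off h.contDiff.continuous h.zero

theorem IsCutoff.bounded_mul_deriv (h : IsCutoff a b f) : ∃ M, 0 ≤ M ∧ ∀ r, |r * deriv f r| ≤ M :=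
  exists_bound_of_zero_off (continuous_id.mul h.continuous_deriv)
    fun r hr => by rw [h.deriv_zero hr, mul_zero]

theorem IsCutoff.bounded_deriv_div (h : IsCutoff a b f) :
    ∃ M, 0 ≤ M ∧ ∀ r, |deriv f r / r| ≤ M := by
  obtain ⟨M, hM0, hM⟩ := exists_bound_of_zero_off h.continuous_deriv fun r hr => h.deriv_zero hr
  have ha := h.pos
  refine ⟨M / a, by positivity, fun r => ?_⟩
  rcases lt_or_ge r a with hr | hr
  · rw [h.deriv_zero (Or.inl hr)]
    simpa using by positivity
  · rw [abs_div, abs_of_pos (ha.trans_le hr)]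
    gcongr
    exact hM r

theorem hasFDerivAt_norm_of_ne_zero {x : Space d} (hx : x ≠ 0) :
    HasFDerivAt (fun y : Space d => ‖y‖) (‖x‖⁻¹ • innerSL ℝ x) x := by
  have h := (hasStrictFDerivAt_norm_sq x).hasFDerivAt.sqrt (by simpa using hx)
  have hn : ‖x‖ ≠ 0 := norm_ne_zero_iff.2 hx
  have e : (fun y : Space d => √(‖y‖ ^ 2)) = fun y => ‖y‖ := by
    ext y
    exact Real.sqrt_sq (norm_nonneg y)
  rw [e] at h
  refine h.congr_fderiv ?_
  ext v
  simp [Real.sqrt_sq (norm_nonneg x)]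
  field_simp

theorem IsCutoff.contDiff_norm (h : IsCutoff a b f) : ContDiff ℝ 1 fun x : Space d => f ‖x‖ := by
  refine contDiff_iff_contDiffAt.2 fun x => ?_
  rcases eq_or_ne x 0 with rfl | hx
  · have : (fun x : Space d => f ‖x‖) =ᶠ[𝓝 0] fun _ => 0 := by
      filter_upwards [Metric.ball_mem_nhds (0 : Space d) h.pos] with y hy
      exact h.zero _ (Or.inl (mem_ball_zero_iff.1 hy))
    exact contDiffAt_const.congr_of_eventuallyEq this
  · exact h.contDiff.contDiffAt.comp x (contDiffAt_norm ℝ hx)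

/-- The formula is valid at the origin as well: f vanishes near 0, and the right side is zero there
because the inner product is. -/
theorem IsCutoff.fderiv_norm (h : IsCutoff a b f) (x v : Space d) :
    fderiv ℝ (fun x : Space d => f ‖x‖) x v = deriv f ‖x‖ / ‖x‖ * inner ℝ x v := by
  rcases eq_or_ne x 0 with rfl | hx
  · have : (fun x : Space d => f ‖x‖) =ᶠ[𝓝 0] fun _ => 0 := by
      filter_upwards [Metric.ball_mem_nhds (0 : Space d) h.pos] with y hy
      exact h.zero _ (Or.inl (mem_ball_zero_iff.1 hy))
    rw [this.fderiv_eq]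
    simp
  · have h1 := (h.hasDerivAt ‖x‖).comp_hasFDerivAt x (hasFDerivAt_norm_of_ne_zero hx)
    have h2 : fderiv ℝ (fun x : Space d => f ‖x‖) x = _ := h1.fderiv
    rw [h2]
    simp
    ring

theorem magneticGrad_cutoff_mul (h : IsCutoff a b f) {φ : Space d → ℂ} (hφ : ContDiff ℝ 1 φ)
    (x : Space d) :
    magneticGrad A (fun x => (f ‖x‖ : ℂ) * φ x) x = (f ‖x‖ : ℂ) • magneticGrad A φ x +
      ((deriv f ‖x‖ / ‖x‖ : ℝ) * φ x : ℂ) • cvec x := by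
  have h1 : HasFDerivAt (fun x : Space d => (f ‖x‖ : ℂ))
      (Complex.ofRealCLM.comp (fderiv ℝ (fun x : Space d => f ‖x‖) x)) x :=
    Complex.ofRealCLM.hasFDerivAt.comp x (h.contDiff_norm.differentiable one_ne_zero x).hasFDerivAt
  have h2 : fderiv ℝ (fun x : Space d => (f ‖x‖ : ℂ) * φ x) x = _ :=
    (h1.mul (hφ.differentiable one_ne_zero x).hasFDerivAt).fderiv
  ext j
  simp only [magneticGrad, h2, PiLp.add_apply, PiLp.smul_apply, cvec_apply, smul_eq_mul,
    add_apply, smul_apply, ContinuousLinearMap.comp_apply,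
    Complex.ofRealCLM_apply, h.fderiv_norm, inner_coordVec]
  push_cast
  ring

theorem IsC1Test.cutoff_mul (h : IsCutoff a b f) {φ : Space d → ℂ} (hφ : IsC1Test S φ) :
    IsC1Test S fun x => (f ‖x‖ : ℂ) * φ x :=
  ⟨(Complex.ofRealCLM.contDiff.comp h.contDiff_norm).mul hφ.contDiff, hφ.compact.mul_left,
    (closure_mono (Function.support_mul_subset_right _ _)).trans hφ.support⟩

theorem isCompact_annulus (a b : ℝ) : IsCompact {x : Space d | a ≤ ‖x‖ ∧ ‖x‖ ≤ b} :=
  (isCompact_closedBall (0 : Space d) b).of_isClosed_subset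
    ((isClosed_le continuous_const continuous_norm).inter
      (isClosed_le continuous_norm continuous_const)) fun x hx => by simpa using hx.2

theorem zero_notMem_annulus (ha : 0 < a) : (0 : Space d) ∉ {x : Space d | a ≤ ‖x‖ ∧ ‖x‖ ≤ b} :=
  fun h => by simpa using ha.trans_le h.1

theorem memLp_bounded_smul {F : Type*} [NormedAddCommGroup F] [NormedSpace ℂ F]
    {m : Space d → ℂ} {w : Space d → F} {M : ℝ} (hw : MemLp w 2 volume)
    (hm : AEStronglyMeasurable m volume) (hM : ∀ᵐ x, ‖m x‖ ≤ M) :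
    MemLp (fun x => m x • w x) 2 volume :=
  hw.of_le_mul (c := M) (hm.smul hw.1) (by
    filter_upwards [hM] with x hx
    rw [norm_smul]
    gcongr)

theorem IsCutoff.memLp_smul (h : IsCutoff a b f) {F : Type*} [NormedAddCommGroup F]
    [NormedSpace ℂ F] {w : Space d → F} (hw : MemLp w 2 volume) :
    MemLp (fun x => (f ‖x‖ : ℂ) • w x) 2 volume := by
  obtain ⟨M, -, hM⟩ := h.bounded
  refine memLp_bounded_smul hw (Continuous.aestronglyMeasurable ?_)
    (Eventually.of_forall fun x => ?_) (M := M)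
  · exact Complex.continuous_ofReal.comp h.contDiff_norm.continuous
  · rw [Complex.norm_real]
    exact hM _

theorem IsCutoff.aestronglyMeasurable_deriv_div (h : IsCutoff a b f) :
    AEStronglyMeasurable (fun x : Space d => ((deriv f ‖x‖ / ‖x‖ : ℝ) : ℂ)) volume := by
  have : Measurable fun x : Space d => ((deriv f ‖x‖ / ‖x‖ : ℝ) : ℂ) :=
    Complex.measurable_ofReal.comp
      ((h.continuous_deriv.measurable.comp measurable_norm).div measurable_norm)
  exact this.aestronglyMeasurable

theorem IsCutoff.memLp_deriv_smul (h : IsCutoff a b f) {F : Type*} [NormedAddCommGroup F]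
    [NormedSpace ℂ F] {w : Space d → F} (hw : MemLp w 2 volume) :
    MemLp (fun x => ((deriv f ‖x‖ / ‖x‖ : ℝ) : ℂ) • w x) 2 volume := by
  obtain ⟨M, -, hM⟩ := h.bounded_deriv_div
  refine memLp_bounded_smul hw h.aestronglyMeasurable_deriv_div
    (Eventually.of_forall fun x => ?_) (M := M)
  rw [Complex.norm_real]
  exact hM _

end Cutoff

/-! ### Dilation and localization of energy pairs; the weak equation with cutoff -/

section EnergyPairTransport

variable {d : ℕ} {S : Set (Space d)} {A : Space d → Space d}

/-- The magnetic gradient of `T_s w`. -/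
def transportGrad (A : Space d → Space d) (s : ℝ) (w : Space d → ℂ)
    (H : Space d → EuclideanSpace ℂ (Fin d)) (x : Space d) : EuclideanSpace ℂ (Fin d) :=
  (Real.exp s : ℂ) • transport A s H x + (Complex.I * transport A s w x) • cvec (phaseDefect A s x)

/-- All points e^t x with t between 0 and s are within a factor e of x and of e^s x, so it suffices
that one endpoint has norm at least ρ. The support of T_s w controls e^s x, the support of the
cutoff controls x; each case occurs. -/
theorem norm_phaseDefect_le_of_annulus (hS : IsSingularCone S) (hA : ContDiffOn ℝ 1 A Sᶜ) {s ρ C : ℝ}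
    (hs : |s| ≤ 1) (hC : ∀ x ∉ S, Real.exp (-1) * ρ ≤ ‖x‖ → ‖x‖ * ‖tangentialField A x‖ ≤ C)
    {x : Space d} (hx : x ∉ S) (h : ρ ≤ ‖x‖ ∨ ρ ≤ ‖Real.exp s • x‖) :
    ‖phaseDefect A s x‖ ≤ Real.exp 1 * C * |s| := by
  have key : ∀ t ∈ Set.uIcc 0 s,
      ‖Real.exp t • x‖ * ‖tangentialField A (Real.exp t • x)‖ ≤ C := by
    intro t ht
    refine hC _ (hS.exp_smul_notMem hx t) ?_
    have hst := abs_le.1 hs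
    have ht' : |t| ≤ 1 ∧ |t - s| ≤ 1 := by
      rcases Set.mem_uIcc.1 ht with h | h <;> constructor <;> rw [abs_le] <;> constructor <;> linarith
    rcases h with h | h
    · exact (mul_le_mul_of_nonneg_left h (Real.exp_pos _).le).trans (norm_le_norm_exp_smul ht'.1 x)
    · refine (mul_le_mul_of_nonneg_left h (Real.exp_pos _).le).trans
        ((norm_le_norm_exp_smul ht'.2 _).trans_eq ?_)
      rw [smul_smul, ← Real.exp_add, sub_add_cancel]
  have hC0 : 0 ≤ C := le_trans (by positivity) (key 0 Set.left_mem_uIcc)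
  refine (norm_phaseDefect_le hS hA s hx key).trans ?_
  gcongr

theorem EnergyPair.transport (hS : IsSingularCone S) (hA : ContDiffOn ℝ 1 A Sᶜ) {s ρ R C : ℝ}
    (hρ : 0 < ρ) (hR : 0 < R)
    (hs : |s| ≤ 1) (hC : ∀ x ∉ S, Real.exp (-1) * ρ ≤ ‖x‖ → ‖x‖ * ‖tangentialField A x‖ ≤ C)
    {w : Space d → ℂ} {H : Space d → EuclideanSpace ℂ (Fin d)} (h : EnergyPair S A ρ R w H) :
    EnergyPair S A (Real.exp (-1) * ρ) (Real.exp 1 * R) (transport A s w) (transportGrad A s w H) := by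
  obtain ⟨φ, h1, h2, h3, h4⟩ := h.approx
  have hout : ∀ x : Space d, ‖x‖ < Real.exp (-1) * ρ ∨ Real.exp 1 * R < ‖x‖ →
      ‖Real.exp s • x‖ < ρ ∨ R < ‖Real.exp s • x‖ := by
    intro x hx
    rw [norm_smul, Real.norm_of_nonneg (Real.exp_pos _).le]
    refine hx.imp (fun hx => ?_) fun hx => ?_
    · calc Real.exp s * ‖x‖ < Real.exp s * (Real.exp (-1) * ρ) := by gcongr
        _ = Real.exp (s - 1) * ρ := by rw [← mul_assoc, ← Real.exp_add, sub_eq_add_neg]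
        _ ≤ 1 * ρ := by
          gcongr
          exact Real.exp_le_one_iff.2 (by linarith [(abs_le.1 hs).2])
        _ = ρ := one_mul ρ
    · calc R = 1 * R := (one_mul R).symm
        _ ≤ Real.exp (s + 1) * R := by
          gcongr
          exact Real.one_le_exp (by linarith [(abs_le.1 hs).1])
        _ = Real.exp s * (Real.exp 1 * R) := by rw [← mul_assoc, ← Real.exp_add]
        _ < Real.exp s * ‖x‖ := by gcongr
  have hmeas : AEStronglyMeasurable (fun x => cvec (phaseDefect A s x)) volume :=
    continuous_cvec.comp_aestronglyMeasurable
      (hS.aestronglyMeasurable (continuousOn_phaseDefect hS hA s))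
  -- The defect need not be bounded near the origin, but T_s v vanishes there.
  have hd : ∀ {v : Space d → ℂ}, MemLp v 2 volume → (∀ x, ‖x‖ < ρ ∨ R < ‖x‖ → v x = 0) →
      ∀ᵐ x, ‖(Complex.I * MagneticSchrodinger.transport A s v x) • cvec (phaseDefect A s x)‖ ≤
        Real.exp 1 * C * |s| * ‖MagneticSchrodinger.transport A s v x‖ := by
    intro v hv hv0
    filter_upwards [hS.ae_notMem] with x hx
    rw [norm_smul, norm_mul, Complex.norm_I, one_mul, mul_comm, norm_cvec]
    rcases lt_or_ge ‖Real.exp s • x‖ ρ with h | h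
    · have : ‖MagneticSchrodinger.transport A s v x‖ = 0 := by
        rw [norm_transport, hv0 _ (Or.inl h), norm_zero]
      simp [this]
    · gcongr
      exact norm_phaseDefect_le_of_annulus hS hA hs hC hx (Or.inr h)
  have hmem : ∀ {v : Space d → ℂ}, MemLp v 2 volume → (∀ x, ‖x‖ < ρ ∨ R < ‖x‖ → v x = 0) →
      MemLp (fun x => (Complex.I * MagneticSchrodinger.transport A s v x) • cvec (phaseDefect A s x))
        2 volume := fun hv hv0 =>
    (memLp_transport hS hA hv s).of_le_mul
      (((memLp_transport hS hA hv s).1.const_mul Complex.I).smul hmeas) (hd hv hv0)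
  refine ⟨fun x hx => ?_, fun n => MagneticSchrodinger.transport A s (φ n),
    fun n => (h1 n).transport hS hA s, fun n x hx => ?_, h3.transport hS hA s, ?_⟩
  · have := h.zero _ (hout x hx)
    simp [transportGrad, MagneticSchrodinger.transport, this]
  · simp [MagneticSchrodinger.transport, h2 n _ (hout x hx)]
  · have hw0 := fun x hx => (h.zero x hx).1
    have t1 := (h4.transport hS hA s).const_smul (Real.exp s : ℂ)
    have t2 : TendstoL2 volume atTop
        (fun n x => (Complex.I * MagneticSchrodinger.transport A s (φ n) x) • cvec (phaseDefect A s x))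
        (fun x => (Complex.I * MagneticSchrodinger.transport A s w x) • cvec (phaseDefect A s x)) := by
      refine (h3.transport hS hA s).of_norm_sub_le (fun n => hmem (h3.memLp n) (h2 n))
        (hmem h3.memLp_lim hw0) (Real.exp 1 * C * |s|) fun n => ?_
      filter_upwards [hd ((h3.memLp n).sub h3.memLp_lim) fun x hx => by
        simp [h2 n x hx, hw0 x hx]] with x hx
      rw [← sub_smul, ← mul_sub, ← transport_sub]
      exact hx
    refine (t1.add t2).congr_ae (fun n => ?_) (EventuallyEq.refl _ _)
    filter_upwards [hS.ae_notMem] with x hx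
    exact (magneticGrad_transport hS hA s (h1 n).contDiff hx).symm

/-- The weak equation tested against `f(|x|) w'`, for `(w', H')` of finite energy. -/
def CutoffWeakEquation (S : Set (Space d)) (A : Space d → Space d) (W : Space d → ℝ) (f : ℝ → ℝ)
    (w : Space d → ℂ) (H : Space d → EuclideanSpace ℂ (Fin d)) : Prop :=
  ∀ ρ R w' H', EnergyPair S A ρ R w' H' →
    (∫ x, inner ℂ (H' x) ((f ‖x‖ : ℂ) • H x)) +
      ∫ x, inner ℂ (w' x) (((deriv f ‖x‖ / ‖x‖ : ℝ) : ℂ) • radial H x) =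
    ∫ x, inner ℂ (w' x) ((f ‖x‖ : ℂ) • ((W x : ℂ) * w x))

theorem integrable_inner_of_memLp {α F : Type*} [MeasurableSpace α] {μ : Measure α}
    [NormedAddCommGroup F] [InnerProductSpace ℂ F] {f g : α → F} (hf : MemLp f 2 μ)
    (hg : MemLp g 2 μ) : Integrable (fun x => inner ℂ (f x) (g x)) μ := by
  refine (L2.integrable_inner (𝕜 := ℂ) (hf.toLp f) (hg.toLp g)).congr ?_
  filter_upwards [hf.coeFn_toLp, hg.coeFn_toLp] with x hx hx'
  rw [hx, hx']

theorem IsWeakSolution.cutoffWeakEquation (hS : IsSingularCone S) (hA : ContDiffOn ℝ 1 A Sᶜ)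
    {W : Space d → ℝ} (hW : AEStronglyMeasurable W volume) (hWb : LocallyBoundedOffOrigin S W)
    {u : Space d → ℂ} (hu : MemLp u 2 volume) {G : Space d → EuclideanSpace ℂ (Fin d)}
    (hG : ∀ K : Set (Space d), IsCompact K → (0 : Space d) ∉ K → MemLp G 2 (volume.restrict K))
    (h : IsWeakSolution S A W u G) {a b : ℝ} {f : ℝ → ℝ} (hf : IsCutoff a b f)
    {w : Space d → ℂ} {H : Space d → EuclideanSpace ℂ (Fin d)}
    (hw : ∀ x, a ≤ ‖x‖ → ‖x‖ ≤ b → w x = u x ∧ H x = G x) : CutoffWeakEquation S A W f w H := by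
  intro ρ R w' H' hE
  -- Both f and its derivative vanish off `K`, so w, H and W w may be exchanged for truncations of
  -- u, G and W u, which are in L². No relation between `K` and the support of w' is needed.
  set K : Set (Space d) := {x | a ≤ ‖x‖ ∧ ‖x‖ ≤ b} with hK
  have hKc : IsCompact K := isCompact_annulus a b
  have h0 : (0 : Space d) ∉ K := zero_notMem_annulus hf.pos
  have hKo : ∀ x ∉ K, ‖x‖ < a ∨ b < ‖x‖ := fun x hx => by
    rw [hK, Set.mem_ofPred_eq, not_and_or, not_le, not_le] at hx
    exact hx
  have mG := memLp_indicator_of_memLp_restrict hKc (hG K hKc h0)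
  have mV := memLp_potential_mul hS hW hWb hu hKc h0
  have mX : MemLp (radial (K.indicator G)) 2 volume := by
    refine mG.of_le_mul (c := b) (continuous_cvec.aestronglyMeasurable.inner mG.1)
      (Eventually.of_forall fun x => ?_)
    by_cases hx : x ∈ K
    · exact (norm_radial_le _ x).trans (by gcongr; exact hx.2)
    · simp [radial, Set.indicator_of_notMem hx]
  have e1 : ∀ x, (f ‖x‖ : ℂ) • H x = (f ‖x‖ : ℂ) • K.indicator G x := fun x => by
    by_cases hx : x ∈ K
    · rw [Set.indicator_of_mem hx, (hw x hx.1 hx.2).2]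
    · rw [hf.zero _ (hKo x hx)]; simp
  have e2 : ∀ x, ((deriv f ‖x‖ / ‖x‖ : ℝ) : ℂ) • radial H x =
      ((deriv f ‖x‖ / ‖x‖ : ℝ) : ℂ) • radial (K.indicator G) x := fun x => by
    by_cases hx : x ∈ K
    · rw [radial, radial, Set.indicator_of_mem hx, (hw x hx.1 hx.2).2]
    · rw [hf.deriv_zero (hKo x hx)]; simp
  have e3 : ∀ x, (f ‖x‖ : ℂ) • ((W x : ℂ) * w x) =
      (f ‖x‖ : ℂ) • K.indicator (fun x => (W x : ℂ) * u x) x := fun x => by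
    by_cases hx : x ∈ K
    · rw [Set.indicator_of_mem hx, (hw x hx.1 hx.2).1]
    · rw [hf.zero _ (hKo x hx)]; simp
  simp_rw [e1, e2, e3]
  have m1 := hf.memLp_smul mG
  have m2 := hf.memLp_deriv_smul mX
  have m3 := hf.memLp_smul mV
  obtain ⟨φ, h1, -, h3, h4⟩ := hE.approx
  have l1 := h4.tendsto_integral_inner (𝕜 := ℂ) (TendstoL2.const m1)
  have l2 := h3.tendsto_integral_inner (𝕜 := ℂ) (TendstoL2.const m2)
  have l3 := h3.tendsto_integral_inner (𝕜 := ℂ) (TendstoL2.const m3)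
  refine tendsto_nhds_unique (l1.add l2) (l3.congr fun n => ?_)
  -- The test function is f φ_n; the derivative of f produces the radial term.
  have h5 := h.of_isC1Test hS hA hW hWb hu hG ((h1 n).cutoff_mul hf)
  rw [← integral_add (integrable_inner_of_memLp (h4.memLp n) m1)
    (integrable_inner_of_memLp (h3.memLp n) m2)]
  refine Eq.trans ?_ (h5.symm.trans ?_)
  · refine integral_congr_ae (Eventually.of_forall fun x => ?_)
    simp only [← e3]
    by_cases hx : x ∈ K
    · rw [(hw x hx.1 hx.2).1]
      simp only [RCLike.inner_apply, map_mul, Complex.conj_ofReal, smul_eq_mul]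
      ring
    · rw [hf.zero _ (hKo x hx)]; simp
  · refine integral_congr_ae (Eventually.of_forall fun x => ?_)
    simp only [magneticGrad_cutoff_mul hf (h1 n).contDiff, inner_add_left, inner_smul_left,
      inner_smul_right, smul_eq_mul, radial, map_mul, Complex.conj_ofReal, RCLike.inner_apply]
    by_cases hx : x ∈ K
    · rw [Set.indicator_of_mem hx]
      ring
    · rw [hf.zero _ (hKo x hx), hf.deriv_zero (hKo x hx)]; simp

theorem memLp_restrict_of_hasMagneticGrad (hS : IsSingularCone S) (hA : ContDiffOn ℝ 1 A Sᶜ)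
    {u : Space d → ℂ} {G : Space d → EuclideanSpace ℂ (Fin d)} (h : HasMagneticGrad S A u G)
    (K : Set (Space d)) (hK : IsCompact K) (h0 : (0 : Space d) ∉ K) :
    MemLp G 2 (volume.restrict K) := by
  obtain ⟨-, hG, φ, hφ, hlim⟩ := h
  -- One approximant at finite L² distance from G is enough; the bound 1 is arbitrary.
  obtain ⟨n, hn⟩ := ((hlim K hK h0).2.eventually_lt_const (u := 1) (by simp)).exists
  have m1 : MemLp (magneticGrad A (φ n)) 2 (volume.restrict K) :=
    ((hφ n).isC1Test.memLp_magneticGrad hS hA).restrict K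
  have m2 : MemLp (fun x => magneticGrad A (φ n) x - G x) 2 (volume.restrict K) :=
    ⟨m1.1.sub hG.restrict, hn.trans ENNReal.one_lt_top⟩
  exact (m1.sub m2).ae_eq (Eventually.of_forall fun x => by simp)

/-- Localization of a function of locally finite energy to an annulus. -/
theorem HasMagneticGrad.energyPair (hS : IsSingularCone S) (hA : ContDiffOn ℝ 1 A Sᶜ)
    {u : Space d → ℂ} {G : Space d → EuclideanSpace ℂ (Fin d)} (h : HasMagneticGrad S A u G)
    (hu : MemLp u 2 volume) {a b : ℝ} {f : ℝ → ℝ} (hf : IsCutoff a b f) :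
    EnergyPair S A a b (fun x => (f ‖x‖ : ℂ) * u x)
      (fun x => (f ‖x‖ : ℂ) • G x + ((deriv f ‖x‖ / ‖x‖ : ℝ) * u x : ℂ) • cvec x) := by
  have hGK := memLp_restrict_of_hasMagneticGrad hS hA h
  obtain ⟨-, hG, φ, hφ, hlim⟩ := h
  set K : Set (Space d) := {x | a ≤ ‖x‖ ∧ ‖x‖ ≤ b} with hK
  have hKc : IsCompact K := isCompact_annulus a b
  have h0 : (0 : Space d) ∉ K := zero_notMem_annulus hf.pos
  have hKo : ∀ x ∉ K, ‖x‖ < a ∨ b < ‖x‖ := fun x hx => by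
    rw [hK, Set.mem_ofPred_eq, not_and_or, not_le, not_le] at hx
    exact hx
  obtain ⟨l1, l2⟩ := hlim K hKc h0
  have mG := memLp_indicator_of_memLp_restrict hKc (hGK K hKc h0)
  have t1 : TendstoL2 volume atTop (fun n => K.indicator (φ n)) (K.indicator u) := by
    refine ⟨fun n => (hφ n).isC1Test.memLp.indicator hKc.measurableSet,
      hu.indicator hKc.measurableSet, l1.congr fun n => ?_⟩
    rw [← eLpNorm_indicator_eq_eLpNorm_restrict hKc.measurableSet]
    congr 1
    ext x
    by_cases hx : x ∈ K <;> simp [hx]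
  have t2 : TendstoL2 volume atTop (fun n => K.indicator (magneticGrad A (φ n)))
      (K.indicator G) := by
    refine ⟨fun n => ((hφ n).isC1Test.memLp_magneticGrad hS hA).indicator hKc.measurableSet,
      mG, l2.congr fun n => ?_⟩
    rw [← eLpNorm_indicator_eq_eLpNorm_restrict hKc.measurableSet]
    congr 1
    ext x
    by_cases hx : x ∈ K <;> simp [hx]
  obtain ⟨M, hM0, hM⟩ := hf.bounded
  obtain ⟨N, hN0, hN⟩ := hf.bounded_deriv_div
  have hfm : AEStronglyMeasurable (fun x : Space d => (f ‖x‖ : ℂ)) volume :=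
    (Complex.continuous_ofReal.comp hf.contDiff_norm.continuous).aestronglyMeasurable
  have hfb : ∀ᵐ x : Space d, ‖(f ‖x‖ : ℂ)‖ ≤ M :=
    Eventually.of_forall fun x => by rw [Complex.norm_real]; exact hM _
  have t3 := t1.smul_of_bounded (m := fun _ x => (f ‖x‖ : ℂ)) (m₀ := fun x => (f ‖x‖ : ℂ))
    (fun _ => hfm) hfm M (fun _ => hfb) hfb (Eventually.of_forall fun x => tendsto_const_nhds)
  have t4 := t2.smul_of_bounded (m := fun _ x => (f ‖x‖ : ℂ)) (m₀ := fun x => (f ‖x‖ : ℂ))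
    (fun _ => hfm) hfm M (fun _ => hfb) hfb (Eventually.of_forall fun x => tendsto_const_nhds)
  have hcb : ∀ (v : ℂ) (x : Space d), ‖(((deriv f ‖x‖ / ‖x‖ : ℝ) : ℂ) * v) • cvec x‖ ≤
      N * |b| * ‖K.indicator (fun _ => v) x‖ := by
    intro v x
    by_cases hx : x ∈ K
    · rw [Set.indicator_of_mem hx, norm_smul, norm_mul, Complex.norm_real, norm_cvec, mul_right_comm]
      gcongr
      · exact hN _
      · exact hx.2.trans (le_abs_self b)
    · rw [hf.deriv_zero (hKo x hx)]
      simp [hx]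
  have hcm : ∀ v : Space d → ℂ, MemLp v 2 volume →
      MemLp (fun x => (((deriv f ‖x‖ / ‖x‖ : ℝ) : ℂ) * v x) • cvec x) 2 volume := fun v hv =>
    (hv.indicator hKc.measurableSet).of_le_mul (c := N * |b|)
      ((hf.aestronglyMeasurable_deriv_div.mul hv.1).smul continuous_cvec.aestronglyMeasurable)
      (Eventually.of_forall fun x => (hcb (v x) x).trans_eq (by
        by_cases hx : x ∈ K <;> simp [hx]))
  have t5 : TendstoL2 volume atTop
      (fun n x => (((deriv f ‖x‖ / ‖x‖ : ℝ) : ℂ) * φ n x) • cvec x)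
      (fun x => (((deriv f ‖x‖ / ‖x‖ : ℝ) : ℂ) * u x) • cvec x) := by
    refine t1.of_norm_sub_le (fun n => hcm _ (hφ n).isC1Test.memLp) (hcm _ hu) (N * |b|)
      fun n => Eventually.of_forall fun x => ?_
    rw [← sub_smul, ← mul_sub]
    refine (hcb _ x).trans_eq ?_
    by_cases hx : x ∈ K <;> simp [hx]
  refine ⟨fun x hx => ?_, fun n x => (f ‖x‖ : ℂ) * φ n x, fun n => (hφ n).isC1Test.cutoff_mul hf,
    fun n x hx => by simp [hf.zero _ hx], ?_, ?_⟩
  · simp [hf.zero _ hx, hf.deriv_zero hx]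
  · refine t3.congr_ae (fun n => Eventually.of_forall fun x => ?_)
      (Eventually.of_forall fun x => ?_) <;>
    · by_cases hx : x ∈ K
      · simp [hx]
      · simp [hx, hf.zero _ (hKo x hx)]
  · refine (t4.add t5).congr_ae (fun n => Eventually.of_forall fun x => ?_)
      (Eventually.of_forall fun x => ?_)
    · simp only [magneticGrad_cutoff_mul hf (hφ n).isC1Test.contDiff]
      by_cases hx : x ∈ K
      · simp [hx]
      · simp [hx, hf.zero _ (hKo x hx)]
    · by_cases hx : x ∈ K
      · simp [hx]
      · simp [hx, hf.zero _ (hKo x hx)]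

end EnergyPairTransport

/-! ### Difference quotients of radial weights -/

section Slope

variable {d : ℕ} {S : Set (Space d)} {A : Space d → Space d} {a b : ℝ} {f : ℝ → ℝ}

/-- A difference quotient comparing `f r` with `f (e^s r)`. -/
def slopeCoeff (α β : ℝ) (f : ℝ → ℝ) (s r : ℝ) : ℝ :=
  (Real.exp (α * s) * f r - Real.exp (β * s) * f (Real.exp s * r)) / (2 * s)

theorem IsCutoff.hasDerivAt_slope (hf : IsCutoff a b f) (α β r s : ℝ) :
    HasDerivAt (fun s => Real.exp (α * s) * f r - Real.exp (β * s) * f (Real.exp s * r))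
      (α * Real.exp (α * s) * f r - (β * Real.exp (β * s) * f (Real.exp s * r) +
        Real.exp (β * s) * ((Real.exp s * r) * deriv f (Real.exp s * r)))) s := by
  have h1 : ∀ γ : ℝ, HasDerivAt (fun s => Real.exp (γ * s)) (γ * Real.exp (γ * s)) s := fun γ => by
    have := ((hasDerivAt_id s).const_mul γ).exp
    simpa [mul_comm] using this
  have h2 : HasDerivAt (fun s => f (Real.exp s * r)) ((Real.exp s * r) * deriv f (Real.exp s * r)) s := by
    have := (hf.hasDerivAt (Real.exp s * r)).comp s ((Real.hasDerivAt_exp s).mul_const r)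
    rwa [mul_comm] at this
  exact ((h1 α).mul_const (f r)).sub ((h1 β).mul h2)

/-- The numerator vanishes at s = 0 and has a derivative bounded by `Q` on [0, 1], uniformly in r,
since f and r f' are bounded. -/
theorem IsCutoff.bounded_slopeCoeff (hf : IsCutoff a b f) (α β : ℝ) :
    ∃ M, 0 ≤ M ∧ ∀ s, 0 < s → s ≤ 1 → ∀ r, |slopeCoeff α β f s r| ≤ M := by
  obtain ⟨M₀, hM₀, h0⟩ := hf.bounded
  obtain ⟨M₁, hM₁, h1⟩ := hf.bounded_mul_deriv
  set Q := |α| * Real.exp |α| * M₀ + (|β| * Real.exp |β| * M₀ + Real.exp |β| * M₁) with hQ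
  refine ⟨Q, by positivity, fun s hs0 hs1 r => ?_⟩
  have hexp : ∀ γ t : ℝ, t ∈ Set.Icc (0 : ℝ) 1 → γ * t ≤ |γ| := fun γ t ht => by
    refine (le_abs_self _).trans ?_
    rw [abs_mul, abs_of_nonneg ht.1]
    exact mul_le_of_le_one_right (abs_nonneg γ) ht.2
  have h := (convex_Icc (0 : ℝ) 1).norm_image_sub_le_of_norm_hasDerivWithin_le (C := Q)
    (fun t _ => (hf.hasDerivAt_slope α β r t).hasDerivWithinAt) (fun t ht => ?_)
    (x := 0) (y := s) (by simp) ⟨hs0.le, hs1⟩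
  · simp only [mul_zero, Real.exp_zero, one_mul, sub_self, sub_zero, Real.norm_eq_abs,
      abs_of_pos hs0] at h
    rw [slopeCoeff, abs_div, abs_of_pos (by positivity : 0 < 2 * s), div_le_iff₀ (by positivity)]
    nlinarith [show 0 ≤ Q by positivity]
  · refine (norm_sub_le _ _).trans (add_le_add ?_ ((norm_add_le _ _).trans (add_le_add ?_ ?_)))
    · rw [norm_mul, norm_mul, Real.norm_eq_abs, Real.norm_eq_abs, Real.norm_eq_abs, Real.abs_exp]
      gcongr
      · exact hexp α t ht
      · exact h0 r
    · rw [norm_mul, norm_mul, Real.norm_eq_abs, Real.norm_eq_abs, Real.norm_eq_abs, Real.abs_exp]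
      gcongr
      · exact hexp β t ht
      · exact h0 _
    · rw [norm_mul, Real.norm_eq_abs, Real.norm_eq_abs, Real.abs_exp]
      gcongr
      · exact hexp β t ht
      · exact h1 _

theorem IsCutoff.tendsto_slopeCoeff (hf : IsCutoff a b f) (α β r : ℝ) :
    Tendsto (fun s => slopeCoeff α β f s r) (𝓝[>] 0)
      (𝓝 (((α - β) * f r - r * deriv f r) / 2)) := by
  have h := hasDerivAt_iff_tendsto_slope_zero.1 (hf.hasDerivAt_slope α β r 0)
  have h' := (h.mono_left (nhdsWithin_mono _ fun s (hs : s ∈ Set.Ioi 0) => ne_of_gt hs)).const_mul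
    (2⁻¹ : ℝ)
  simp only [zero_add, mul_zero, Real.exp_zero, one_mul, mul_one, sub_self, sub_zero,
    smul_eq_mul] at h'
  refine (h'.congr fun s => ?_).trans_eq ?_
  · rw [slopeCoeff, div_eq_inv_mul, mul_inv, mul_assoc]
  · congr 1
    ring

theorem IsCutoff.aestronglyMeasurable_slopeCoeff (hf : IsCutoff a b f) (α β s : ℝ) :
    AEStronglyMeasurable (fun x : Space d => ((slopeCoeff α β f s ‖x‖ : ℝ) : ℂ)) volume := by
  have hc := hf.contDiff.continuous
  refine Continuous.aestronglyMeasurable ?_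
  unfold slopeCoeff
  fun_prop

/-- A sequence of steps in `(0, 1]` that tends to zero. -/
def step (n : ℕ) : ℝ := 1 / ((n : ℝ) + 1)

theorem step_pos (n : ℕ) : 0 < step n := Nat.one_div_pos_of_nat

theorem step_le_one (n : ℕ) : step n ≤ 1 := by
  rw [step, div_le_one (by positivity)]
  linarith [(Nat.cast_nonneg n : (0 : ℝ) ≤ n)]

theorem abs_step_le_one (n : ℕ) : |step n| ≤ 1 := by
  rw [abs_of_pos (step_pos n)]
  exact step_le_one n

theorem abs_neg_step_le_one (n : ℕ) : |-step n| ≤ 1 := by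
  rw [abs_neg]
  exact abs_step_le_one n

theorem tendsto_step : Tendsto step atTop (𝓝[>] 0) :=
  tendsto_nhdsWithin_iff.2 ⟨tendsto_one_div_add_atTop_nhds_zero_nat, Eventually.of_forall step_pos⟩

theorem tendsto_step_nhds : Tendsto step atTop (𝓝 0) := tendsto_one_div_add_atTop_nhds_zero_nat

theorem tendsto_neg_step_nhds : Tendsto (fun n => -step n) atTop (𝓝 0) := by
  simpa using tendsto_step_nhds.neg

variable {F : Type*} [NormedAddCommGroup F] [InnerProductSpace ℂ F]

/-- The ray from e^s x back to x is the same ray reversed. This cocycle rule makes T_{-s} inverse to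
T_s. -/
theorem rayPhase_neg (A : Space d → Space d) (s : ℝ) (x : Space d) :
    rayPhase A (-s) (Real.exp s • x) = -rayPhase A s x := by
  have h : ∀ t : ℝ, Real.exp t • Real.exp s • x = Real.exp (t + s) • x := fun t => by
    rw [smul_smul, ← Real.exp_add]
  simp only [rayPhase, h]
  rw [intervalIntegral.integral_comp_add_right
    (fun t => inner ℝ (A (Real.exp t • x)) (Real.exp t • x)) s, zero_add, neg_add_cancel,
    intervalIntegral.integral_symm]

/-- Covariant dilations are unitary up to a factor. -/
theorem integral_inner_transport_neg (A : Space d → Space d) (s : ℝ) (w : Space d → F)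
    (m : Space d → ℂ) :
    ∫ x, inner ℂ (transport A (-s) w x) (m x • w x) =
      Real.exp (s * d) * ∫ x, m (Real.exp s • x) * inner ℂ (w x) (transport A s w x) := by
  have h := integral_exp_smul (fun x => inner ℂ (transport A (-s) w x) (m x • w x)) s
  have e : ∀ x, inner ℂ (transport A (-s) w (Real.exp s • x))
      (m (Real.exp s • x) • w (Real.exp s • x)) =
      m (Real.exp s • x) * inner ℂ (w x) (transport A s w x) := by
    intro x
    have e1 : Real.exp (-s) • Real.exp s • x = x := by
      rw [smul_smul, ← Real.exp_add, neg_add_cancel, Real.exp_zero, one_smul]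
    simp only [transport, rayPhase_neg, e1, inner_smul_left, inner_smul_right, ← Complex.exp_conj,
      map_mul, Complex.conj_I, Complex.conj_ofReal]
    push_cast
    ring_nf
  simp_rw [e] at h
  rw [h, Complex.real_smul, ← mul_assoc, ← Complex.ofReal_mul, ← Real.exp_add]
  simp

theorem integral_inner_comm_re {α : Type*} [MeasurableSpace α] {μ : Measure α} (f g : α → F) :
    (∫ x, inner ℂ (f x) (g x) ∂μ).re = (∫ x, inner ℂ (g x) (f x) ∂μ).re := by
  have h : ∫ x, inner ℂ (g x) (f x) ∂μ = starRingEnd ℂ (∫ x, inner ℂ (f x) (g x) ∂μ) := by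
    rw [← integral_conj]
    simp
  rw [h, Complex.conj_re]

theorem re_integral_inner_self_mul {α : Type*} [MeasurableSpace α] {μ : Measure α} (f : α → F)
    (m : α → ℝ) :
    (∫ x, inner ℂ (f x) ((m x : ℂ) • f x) ∂μ).re = ∫ x, m x * ‖f x‖ ^ 2 ∂μ := by
  have : ∀ x, inner ℂ (f x) ((m x : ℂ) • f x) = ((m x * ‖f x‖ ^ 2 : ℝ) : ℂ) := fun x => by
    rw [inner_smul_right, inner_self_eq_norm_sq_to_K]
    push_cast
    rfl
  simp_rw [this, integral_complex_ofReal, Complex.ofReal_re]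

theorem norm_cutoff_comp (s : ℝ) (x : Space d) : ‖Real.exp s • x‖ = Real.exp s * ‖x‖ := by
  rw [norm_smul, Real.norm_of_nonneg (Real.exp_pos s).le]

theorem IsCutoff.memLp_comp_smul (hf : IsCutoff a b f) {w : Space d → F} (hw : MemLp w 2 volume)
    (s : ℝ) : MemLp (fun x => (f (Real.exp s * ‖x‖) : ℂ) • w x) 2 volume := by
  obtain ⟨M, -, hM⟩ := hf.bounded
  have hc := hf.contDiff.continuous
  refine memLp_bounded_smul hw (Continuous.aestronglyMeasurable ?_)
    (Eventually.of_forall fun x => ?_) (M := M)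
  · fun_prop
  · rw [Complex.norm_real]
    exact hM _

/-- The symmetric difference quotient of the weighted correlation of `w` with its dilations. -/
theorem tendsto_symmetric_correlation (hS : IsSingularCone S) (hA : ContDiffOn ℝ 1 A Sᶜ)
    (hf : IsCutoff a b f) (α β : ℝ) {w : Space d → F} (hw : MemLp w 2 volume) :
    Tendsto (fun n => ((2 * step n : ℝ)⁻¹ * (Real.exp (α * step n) *
        (∫ x, inner ℂ (transport A (step n) w x) ((f ‖x‖ : ℂ) • w x)) -
      Real.exp ((β - d) * step n) *
        ∫ x, inner ℂ (transport A (-step n) w x) ((f ‖x‖ : ℂ) • w x)) : ℂ).re) atTop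
      (𝓝 (∫ x, ((α - β) * f ‖x‖ - ‖x‖ * deriv f ‖x‖) / 2 * ‖w x‖ ^ 2)) := by
  obtain ⟨M, -, hM⟩ := hf.bounded_slopeCoeff α β
  have hT := (tendstoL2_transport hS hA hw).comp tendsto_step_nhds
  have hlim : ∀ x : Space d, Tendsto (fun n => ((slopeCoeff α β f (step n) ‖x‖ : ℝ) : ℂ)) atTop
      (𝓝 ((((α - β) * f ‖x‖ - ‖x‖ * deriv f ‖x‖) / 2 : ℝ) : ℂ)) := fun x =>
    (Complex.continuous_ofReal.tendsto _).comp ((hf.tendsto_slopeCoeff α β ‖x‖).comp tendsto_step)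
  have hb : ∀ n, ∀ᵐ x : Space d, ‖((slopeCoeff α β f (step n) ‖x‖ : ℝ) : ℂ)‖ ≤ M := fun n =>
    Eventually.of_forall fun x => by
      rw [Complex.norm_real]
      exact hM _ (step_pos n) (step_le_one n) _
  have hm := hT.smul_of_bounded (m := fun n x => ((slopeCoeff α β f (step n) ‖x‖ : ℝ) : ℂ))
    (m₀ := fun x => ((((α - β) * f ‖x‖ - ‖x‖ * deriv f ‖x‖) / 2 : ℝ) : ℂ))
    (fun n => hf.aestronglyMeasurable_slopeCoeff α β _)
    (aestronglyMeasurable_of_tendsto_ae atTop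
      (fun n => hf.aestronglyMeasurable_slopeCoeff α β (step n)) (Eventually.of_forall hlim)) M hb
    (Eventually.of_forall fun x => le_of_tendsto (hlim x).norm
      (Eventually.of_forall fun n => by
        rw [Complex.norm_real]
        exact hM _ (step_pos n) (step_le_one n) _)) (Eventually.of_forall hlim)
  have hfin := (Complex.continuous_re.tendsto _).comp
    ((TendstoL2.const hw).tendsto_integral_inner (𝕜 := ℂ) hm)
  rw [re_integral_inner_self_mul] at hfin
  refine hfin.congr fun n => ?_
  rw [Function.comp_apply]
  set s := step n
  have hs0 : (2 * s : ℝ) ≠ 0 := by have := step_pos n; positivity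
  have hTw := memLp_transport hS hA hw s
  have i1 := integrable_inner_of_memLp hw (hf.memLp_smul hTw)
  have i2 := integrable_inner_of_memLp hw (hf.memLp_comp_smul hTw s)
  have e1 : (∫ x, inner ℂ (transport A s w x) ((f ‖x‖ : ℂ) • w x)).re =
      (∫ x, inner ℂ (w x) ((f ‖x‖ : ℂ) • transport A s w x)).re := by
    rw [integral_inner_comm_re]
    simp only [inner_smul_left, inner_smul_right, Complex.conj_ofReal]
  have e2 : ∫ x, inner ℂ (transport A (-s) w x) ((f ‖x‖ : ℂ) • w x) =
      Real.exp (s * d) * ∫ x, inner ℂ (w x) ((f (Real.exp s * ‖x‖) : ℂ) • transport A s w x) := by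
    rw [integral_inner_transport_neg A s w fun x => (f ‖x‖ : ℂ)]
    simp only [norm_cutoff_comp, inner_smul_right]
  have e3 : ∫ x, inner ℂ (w x) (((slopeCoeff α β f s ‖x‖ : ℝ) : ℂ) • transport A s w x) =
      ((2 * s : ℝ)⁻¹ : ℝ) * ((Real.exp (α * s) : ℝ) *
        (∫ x, inner ℂ (w x) ((f ‖x‖ : ℂ) • transport A s w x)) -
        (Real.exp (β * s) : ℝ) *
        ∫ x, inner ℂ (w x) ((f (Real.exp s * ‖x‖) : ℂ) • transport A s w x)) := by
    rw [← integral_const_mul, ← integral_const_mul, ← integral_sub (i1.const_mul _) (i2.const_mul _),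
      ← integral_const_mul]
    congr 1
    ext x
    simp only [inner_smul_right, slopeCoeff, div_eq_inv_mul]
    push_cast
    ring
  -- The Jacobian e^{sd} from moving T_{-s} to the other side turns β - d into the β of
  -- `slopeCoeff`.
  have e4 : (Real.exp ((β - d) * s) : ℂ) * (Real.exp (s * d) : ℂ) = (Real.exp (β * s) : ℝ) := by
    rw [← Complex.ofReal_mul, ← Real.exp_add]
    congr 2
    ring
  rw [e3, e2, ← mul_assoc ((Real.exp ((β - d) * s) : ℝ) : ℂ), e4, Complex.re_ofReal_mul,
    Complex.re_ofReal_mul, Complex.sub_re, Complex.sub_re, Complex.re_ofReal_mul,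
    Complex.re_ofReal_mul, Complex.re_ofReal_mul, e1]

end Slope

/-! ### Divergence and energy identities; control of the gauge defect -/

section Identities

variable {d : ℕ} {S : Set (Space d)} {A : Space d → Space d} {a b ρ R : ℝ} {f : ℝ → ℝ}
  {w : Space d → ℂ} {H : Space d → EuclideanSpace ℂ (Fin d)}

/-- The real part of `w̄ ⟨x, H⟩`. -/
def corr (w : Space d → ℂ) (H : Space d → EuclideanSpace ℂ (Fin d)) (x : Space d) : ℝ :=
  (inner ℂ (w x) (radial H x)).re

theorem integrable_bdd_mul {α : Type*} [MeasurableSpace α] {μ : Measure α} {m g : α → ℝ} {M : ℝ}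
    (hg : Integrable g μ) (hm : AEStronglyMeasurable m μ) (hM : ∀ᵐ x ∂μ, |m x| ≤ M) :
    Integrable (fun x => m x * g x) μ :=
  hg.bdd_mul (c := M) hm hM

theorem EnergyPair.integrable_sq (h : EnergyPair S A ρ R w H) :
    Integrable (fun x => ‖w x‖ ^ 2) volume := h.memLp.norm.integrable_sq

theorem EnergyPair.integrable_grad_sq (h : EnergyPair S A ρ R w H) :
    Integrable (fun x => ‖H x‖ ^ 2) volume := h.memLp_grad.norm.integrable_sq

theorem EnergyPair.integrable_radial_sq (h : EnergyPair S A ρ R w H) :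
    Integrable (fun x => ‖radial H x‖ ^ 2) volume := h.memLp_radial.norm.integrable_sq

theorem EnergyPair.integrable_corr (h : EnergyPair S A ρ R w H) :
    Integrable (corr w H) volume :=
  (integrable_inner_of_memLp h.memLp h.memLp_radial).re

theorem EnergyPair.integrable_mul_grad (h : EnergyPair S A ρ R w H) :
    Integrable (fun x => ‖w x‖ * ‖H x‖) volume :=
  h.memLp.norm.integrable_mul h.memLp_grad.norm

theorem re_integral_smul_radial (h : EnergyPair S A ρ R w H) {m : Space d → ℝ} {M : ℝ}
    (hm : AEStronglyMeasurable m volume) (hM : ∀ᵐ x, |m x| ≤ M) :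
    (∫ x, inner ℂ (w x) ((m x : ℂ) • radial H x)).re = ∫ x, m x * corr w H x := by
  have hi : Integrable (fun x => inner ℂ (w x) ((m x : ℂ) • radial H x)) volume :=
    integrable_inner_of_memLp h.memLp (memLp_bounded_smul h.memLp_radial
      (Complex.continuous_ofReal.comp_aestronglyMeasurable hm)
      (hM.mono fun x hx => by rw [Complex.norm_real]; exact hx))
  have := integral_re (𝕜 := ℂ) hi
  rw [RCLike.re_eq_complex_re] at this
  rw [← this]
  congr 1
  ext x
  rw [corr, inner_smul_right, Complex.re_ofReal_mul]

theorem tendsto_slope_inner (hS : IsSingularCone S) (hA : ContDiffOn ℝ 1 A Sᶜ)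
    (h : EnergyPair S A ρ R w H) {g : Space d → ℂ} (hg : MemLp g 2 volume) :
    Tendsto (fun n => ((2 * step n : ℝ)⁻¹ : ℂ) * ((∫ x, inner ℂ (transport A (step n) w x) (g x)) -
      ∫ x, inner ℂ (transport A (-step n) w x) (g x))) atTop
      (𝓝 (∫ x, inner ℂ (radial H x) (g x))) := by
  refine (((h.tendstoL2_symmetric_slope hS hA).comp tendsto_step).tendsto_integral_inner (𝕜 := ℂ)
    (TendstoL2.const hg)).congr fun n => ?_
  rw [← integral_sub (integrable_inner_of_memLp (memLp_transport hS hA h.memLp _) hg)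
    (integrable_inner_of_memLp (memLp_transport hS hA h.memLp _) hg), ← integral_const_mul]
  congr 1
  ext x
  rw [← inner_sub_left, Complex.real_smul, ← smul_eq_mul, inner_smul_left, Complex.conj_ofReal,
    Complex.ofReal_inv]

theorem IsCutoff.aestronglyMeasurable_real (hf : IsCutoff a b f) :
    AEStronglyMeasurable (fun x : Space d => f ‖x‖) volume :=
  hf.contDiff_norm.continuous.aestronglyMeasurable

theorem IsCutoff.aestronglyMeasurable_deriv (hf : IsCutoff a b f) :
    AEStronglyMeasurable (fun x : Space d => ‖x‖ * deriv f ‖x‖) volume :=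
  (continuous_norm.mul (hf.continuous_deriv.comp continuous_norm)).aestronglyMeasurable

theorem IsCutoff.aestronglyMeasurable_deriv_div_real (hf : IsCutoff a b f) :
    AEStronglyMeasurable (fun x : Space d => deriv f ‖x‖ / ‖x‖) volume :=
  ((hf.continuous_deriv.measurable.comp measurable_norm).div measurable_norm).aestronglyMeasurable

/-- The divergence theorem for `f(|x|) |w|² x`. -/
theorem integral_divergence (hS : IsSingularCone S) (hA : ContDiffOn ℝ 1 A Sᶜ)
    (h : EnergyPair S A ρ R w H) (hf : IsCutoff a b f) :
    Integrable (fun x => (‖x‖ * deriv f ‖x‖ + d * f ‖x‖) * ‖w x‖ ^ 2 + 2 * f ‖x‖ * corr w H x)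
      volume ∧
    ∫ x, ((‖x‖ * deriv f ‖x‖ + d * f ‖x‖) * ‖w x‖ ^ 2 + 2 * f ‖x‖ * corr w H x) = 0 := by
  obtain ⟨M, hM0, hM⟩ := hf.bounded
  obtain ⟨M', hM'0, hM'⟩ := hf.bounded_mul_deriv
  -- With α = 0 and β = d both exponential factors are 1. The same quotient converges to ∫ f `corr`
  -- by `tendsto_slope_inner`, and equality of the two limits is the divergence theorem.
  have l1 := tendsto_symmetric_correlation hS hA hf 0 d h.memLp
  have l2 := (Complex.continuous_re.tendsto _).comp
    (tendsto_slope_inner hS hA h (hf.memLp_smul h.memLp))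
  rw [integral_inner_comm_re] at l2
  have e : (∫ x, inner ℂ ((f ‖x‖ : ℂ) • w x) (radial H x)).re = ∫ x, f ‖x‖ * corr w H x := by
    rw [← re_integral_smul_radial h hf.aestronglyMeasurable_real
      (Eventually.of_forall fun x => hM _)]
    simp only [inner_smul_left, inner_smul_right, Complex.conj_ofReal]
  rw [e] at l2
  have key := tendsto_nhds_unique l2 (l1.congr fun n => by simp)
  have i1 : Integrable (fun x => (‖x‖ * deriv f ‖x‖ + d * f ‖x‖) * ‖w x‖ ^ 2) volume :=
    integrable_bdd_mul (M := M' + d * M) h.integrable_sq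
      (hf.aestronglyMeasurable_deriv.add (hf.aestronglyMeasurable_real.const_mul _))
      (Eventually.of_forall fun x => (abs_add_le _ _).trans (add_le_add (hM' _) (by
        rw [abs_mul, Nat.abs_cast]
        gcongr
        exact hM _)))
  have i2 : Integrable (fun x => 2 * f ‖x‖ * corr w H x) volume :=
    integrable_bdd_mul (M := 2 * M) h.integrable_corr (hf.aestronglyMeasurable_real.const_mul 2)
      (Eventually.of_forall fun x => by
        rw [abs_mul, abs_two]
        gcongr
        exact hM _)
  have e1 : ∫ x, 2 * f ‖x‖ * corr w H x = 2 * ∫ x, f ‖x‖ * corr w H x := by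
    rw [← integral_const_mul]
    simp only [mul_assoc]
  have e2 : ∫ x, (‖x‖ * deriv f ‖x‖ + d * f ‖x‖) * ‖w x‖ ^ 2 =
      -2 * ∫ x, ((0 - d) * f ‖x‖ - ‖x‖ * deriv f ‖x‖) / 2 * ‖w x‖ ^ 2 := by
    rw [← integral_const_mul]
    congr 1
    ext x
    ring
  refine ⟨i1.add i2, ?_⟩
  rw [integral_add i1 i2, e1, e2, key]
  ring

/-- The energy identity with the multiplier `f(|x|) w`. -/
theorem integral_energy (h : EnergyPair S A ρ R w H) (hf : IsCutoff a b f)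
    {W : Space d → ℝ} (hW : AEStronglyMeasurable W volume) {M : ℝ} (hWM : ∀ᵐ x, |W x| ≤ M)
    (hweq : CutoffWeakEquation S A W f w H) :
    Integrable (fun x => f ‖x‖ * ‖H x‖ ^ 2 + deriv f ‖x‖ / ‖x‖ * corr w H x -
      f ‖x‖ * W x * ‖w x‖ ^ 2) volume ∧
    ∫ x, (f ‖x‖ * ‖H x‖ ^ 2 + deriv f ‖x‖ / ‖x‖ * corr w H x - f ‖x‖ * W x * ‖w x‖ ^ 2) = 0 := by
  obtain ⟨M₀, hM0, hM⟩ := hf.bounded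
  obtain ⟨M₁, hM10, hM1⟩ := hf.bounded_deriv_div
  -- The pair (w, H) is tested against itself.
  have key := congrArg Complex.re (hweq _ _ _ _ h)
  rw [Complex.add_re, re_integral_inner_self_mul,
    re_integral_smul_radial h hf.aestronglyMeasurable_deriv_div_real
    (Eventually.of_forall fun x => hM1 _)] at key
  have e : (∫ x, inner ℂ (w x) ((f ‖x‖ : ℂ) • ((W x : ℂ) * w x))).re =
      ∫ x, f ‖x‖ * W x * ‖w x‖ ^ 2 := by
    rw [← re_integral_inner_self_mul]
    simp only [smul_eq_mul, Complex.ofReal_mul, mul_assoc]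
  rw [e] at key
  have i1 : Integrable (fun x => f ‖x‖ * ‖H x‖ ^ 2) volume :=
    integrable_bdd_mul h.integrable_grad_sq hf.aestronglyMeasurable_real
      (Eventually.of_forall fun x => hM _)
  have i2 : Integrable (fun x => deriv f ‖x‖ / ‖x‖ * corr w H x) volume :=
    integrable_bdd_mul h.integrable_corr hf.aestronglyMeasurable_deriv_div_real
      (Eventually.of_forall fun x => hM1 _)
  have i3 : Integrable (fun x => f ‖x‖ * W x * ‖w x‖ ^ 2) volume :=
    integrable_bdd_mul (M := M₀ * M) h.integrable_sq (hf.aestronglyMeasurable_real.mul hW) (by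
      filter_upwards [hWM] with x hx
      rw [abs_mul]
      gcongr
      exact hM _)
  have i12 : Integrable (fun x => f ‖x‖ * ‖H x‖ ^ 2 + deriv f ‖x‖ / ‖x‖ * corr w H x) volume :=
    i1.add i2
  refine ⟨i12.sub i3, ?_⟩
  rw [integral_sub i12 i3, integral_add i1 i2, key, sub_self]

theorem tendsto_defect_bound (hS : IsSingularCone S) (hA : ContDiffOn ℝ 1 A Sᶜ)
    (h : EnergyPair S A ρ R w H) (hf : IsCutoff a b f) (c : ℝ) :
    Tendsto (fun n => ∫ x, c / 2 * (f ‖x‖ * ((‖transport A (step n) w x‖ +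
      ‖transport A (-step n) w x‖) * ‖H x‖))) atTop (𝓝 (∫ x, c * (f ‖x‖ * (‖w x‖ * ‖H x‖)))) := by
  obtain ⟨M₀, hM0, hM⟩ := hf.bounded
  have mH : MemLp (fun x => f ‖x‖ * ‖H x‖) 2 volume :=
    h.memLp_grad.of_le_mul (c := M₀) (hf.aestronglyMeasurable_real.mul h.memLp_grad.1.norm)
      (Eventually.of_forall fun x => by
        rw [norm_mul, norm_norm]
        gcongr
        exact hM _)
  have t0 := tendstoL2_transport hS hA h.memLp
  have t1 := (t0.comp tendsto_step_nhds).norm.add (t0.comp tendsto_neg_step_nhds).norm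
  have t2 := (t1.tendsto_integral_inner (𝕜 := ℝ) (TendstoL2.const mH)).const_mul (c / 2)
  simp_rw [← integral_const_mul] at t2
  refine (t2.congr fun n => ?_).trans_eq ?_
  · congr 1
    ext x
    simp only [RCLike.inner_apply, conj_trivial]
    ring
  · congr 2
    ext x
    simp only [RCLike.inner_apply, conj_trivial]
    ring

/-- The defect is at most e C |s| on the support of f, so the factor (2s)⁻¹ leaves a bounded
quantity. This yields the magnetic term of the virial inequality. -/
theorem defect_le (hS : IsSingularCone S) (hA : ContDiffOn ℝ 1 A Sᶜ)
    (h : EnergyPair S A ρ R w H) (hρa : ρ ≤ a) {C : ℝ}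
    (hC : ∀ x ∉ S, Real.exp (-1) * ρ ≤ ‖x‖ → ‖x‖ * ‖tangentialField A x‖ ≤ C)
    (hf : IsCutoff a b f) (hf0 : ∀ r, 0 ≤ f r) (n : ℕ)
    (hi1 : Integrable (fun x => inner ℂ ((Complex.I * transport A (step n) w x) •
      cvec (phaseDefect A (step n) x)) ((f ‖x‖ : ℂ) • H x)) volume)
    (hi2 : Integrable (fun x => inner ℂ ((Complex.I * transport A (-step n) w x) •
      cvec (phaseDefect A (-step n) x)) ((f ‖x‖ : ℂ) • H x)) volume) :
    ‖((2 * step n : ℝ)⁻¹ : ℂ) * ((∫ x, inner ℂ ((Complex.I * transport A (step n) w x) •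
        cvec (phaseDefect A (step n) x)) ((f ‖x‖ : ℂ) • H x)) -
      ∫ x, inner ℂ ((Complex.I * transport A (-step n) w x) •
        cvec (phaseDefect A (-step n) x)) ((f ‖x‖ : ℂ) • H x))‖ ≤
    ∫ x, (Real.exp 1 * C) / 2 * (f ‖x‖ * ((‖transport A (step n) w x‖ +
      ‖transport A (-step n) w x‖) * ‖H x‖)) := by
  obtain ⟨M₀, hM0, hM⟩ := hf.bounded
  have hs := step_pos n
  have hpt : ∀ s : ℝ, |s| ≤ 1 → ∀ x ∉ S, ‖inner ℂ ((Complex.I * transport A s w x) •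
      cvec (phaseDefect A s x)) ((f ‖x‖ : ℂ) • H x)‖ ≤
      Real.exp 1 * C * |s| * (f ‖x‖ * (‖transport A s w x‖ * ‖H x‖)) := by
    intro s hs x hx
    rcases lt_or_ge ‖x‖ a with hxa | hxa
    · rw [hf.zero _ (Or.inl hxa)]
      simp
    · refine (norm_inner_le_norm _ _).trans ?_
      rw [norm_smul, norm_smul, norm_mul, Complex.norm_I, one_mul, norm_cvec, Complex.norm_real,
        Real.norm_of_nonneg (hf0 _)]
      have h1 := norm_phaseDefect_le_of_annulus hS hA hs hC hx (Or.inl (hρa.trans hxa))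
      calc _ = ‖phaseDefect A s x‖ * (f ‖x‖ * (‖transport A s w x‖ * ‖H x‖)) := by ring
        _ ≤ _ := by
          have := hf0 ‖x‖
          gcongr
  rw [← integral_sub hi1 hi2, ← integral_const_mul]
  refine norm_integral_le_of_norm_le ?_ ?_
  · refine (integrable_bdd_mul (M := M₀) ?_ hf.aestronglyMeasurable_real
      (Eventually.of_forall fun x => hM _)).const_mul _
    exact ((memLp_transport hS hA h.memLp _).norm.add
      (memLp_transport hS hA h.memLp _).norm).integrable_mul h.memLp_grad.norm
  · filter_upwards [hS.ae_notMem] with x hx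
    have h1 := hpt _ (abs_step_le_one n) x hx
    have h2 := hpt _ (abs_neg_step_le_one n) x hx
    rw [abs_neg] at h2
    rw [abs_of_pos hs] at h1 h2
    rw [norm_mul, norm_inv, Complex.norm_real, Real.norm_of_nonneg (by positivity),
      inv_mul_le_iff₀ (by positivity)]
    refine (norm_sub_le _ _).trans ((add_le_add h1 h2).trans_eq ?_)
    ring

end Identities

/-! ### The potential in the symmetric difference quotient -/

section RadialInequality

variable {d : ℕ} {S : Set (Space d)} {A : Space d → Space d} {a b ρ R : ℝ} {f : ℝ → ℝ}
  {w : Space d → ℂ} {H : Space d → EuclideanSpace ℂ (Fin d)}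

theorem TendstoL2.tendsto_weighted_sq {α F : Type*} [MeasurableSpace α] {μ : Measure α}
    [NormedAddCommGroup F] [InnerProductSpace ℂ F] {v : ℕ → α → F} {v₀ : α → F}
    (h : TendstoL2 μ atTop v v₀) {m : ℕ → α → ℝ} {m₀ : α → ℝ}
    (hm : ∀ n, AEStronglyMeasurable (m n) μ) (M : ℝ) (hM : ∀ n, ∀ᵐ x ∂μ, |m n x| ≤ M)
    (hlim : ∀ᵐ x ∂μ, Tendsto (fun n => m n x) atTop (𝓝 (m₀ x))) :
    Tendsto (fun n => ∫ x, m n x * ‖v n x‖ ^ 2 ∂μ) atTop (𝓝 (∫ x, m₀ x * ‖v₀ x‖ ^ 2 ∂μ)) := by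
  have hm₀ : AEStronglyMeasurable m₀ μ := aestronglyMeasurable_of_tendsto_ae atTop hm hlim
  have hM₀ : ∀ᵐ x ∂μ, |m₀ x| ≤ M := by
    filter_upwards [ae_all_iff.2 hM, hlim] with x h1 h2
    exact le_of_tendsto h2.abs (Eventually.of_forall h1)
  have t := h.smul_of_bounded (m := fun n x => (m n x : ℂ)) (m₀ := fun x => (m₀ x : ℂ))
    (fun n => Complex.continuous_ofReal.comp_aestronglyMeasurable (hm n))
    (Complex.continuous_ofReal.comp_aestronglyMeasurable hm₀) M
    (fun n => (hM n).mono fun x hx => by rw [Complex.norm_real]; exact hx)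
    (hM₀.mono fun x hx => by rw [Complex.norm_real]; exact hx)
    (hlim.mono fun x hx => (Complex.continuous_ofReal.tendsto _).comp hx)
  have t2 := (Complex.continuous_re.tendsto _).comp (h.tendsto_integral_inner (𝕜 := ℂ) t)
  rw [re_integral_inner_self_mul] at t2
  exact t2.congr fun n => re_integral_inner_self_mul _ _

theorem tendsto_weighted_inner {α F : Type*} [MeasurableSpace α] {μ : Measure α}
    [NormedAddCommGroup F] [InnerProductSpace ℂ F] {v : ℕ → α → F} {v₀ : α → F}
    (hv₀ : MemLp v₀ 2 μ) (h : TendstoL2 μ atTop v v₀) {m : ℕ → α → ℝ} {m₀ : α → ℝ}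
    (hm : ∀ n, AEStronglyMeasurable (m n) μ) (M : ℝ) (hM : ∀ n, ∀ᵐ x ∂μ, |m n x| ≤ M)
    (hlim : ∀ᵐ x ∂μ, Tendsto (fun n => m n x) atTop (𝓝 (m₀ x))) :
    Tendsto (fun n => ∫ x, m n x * (inner ℂ (v₀ x) (v n x)).re ∂μ) atTop
      (𝓝 (∫ x, m₀ x * ‖v₀ x‖ ^ 2 ∂μ)) := by
  have hm₀ : AEStronglyMeasurable m₀ μ := aestronglyMeasurable_of_tendsto_ae atTop hm hlim
  have hM₀ : ∀ᵐ x ∂μ, |m₀ x| ≤ M := by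
    filter_upwards [ae_all_iff.2 hM, hlim] with x h1 h2
    exact le_of_tendsto h2.abs (Eventually.of_forall h1)
  have t := h.smul_of_bounded (m := fun n x => (m n x : ℂ)) (m₀ := fun x => (m₀ x : ℂ))
    (fun n => Complex.continuous_ofReal.comp_aestronglyMeasurable (hm n))
    (Complex.continuous_ofReal.comp_aestronglyMeasurable hm₀) M
    (fun n => (hM n).mono fun x hx => by rw [Complex.norm_real]; exact hx)
    (hM₀.mono fun x hx => by rw [Complex.norm_real]; exact hx)
    (hlim.mono fun x hx => (Complex.continuous_ofReal.tendsto _).comp hx)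
  have t2 := (Complex.continuous_re.tendsto _).comp
    ((TendstoL2.const hv₀).tendsto_integral_inner (𝕜 := ℂ) t)
  rw [re_integral_inner_self_mul] at t2
  refine t2.congr fun n => ?_
  have hi := integral_re (𝕜 := ℂ) (integrable_inner_of_memLp hv₀ (t.memLp n))
  rw [RCLike.re_eq_complex_re] at hi
  rw [Function.comp_apply, ← hi]
  congr 1
  ext x
  rw [inner_smul_right, Complex.re_ofReal_mul]

/-- The part of the symmetric difference quotient that comes from a potential, rewritten with
`w` and its dilation. -/
theorem re_potential_slope (hS : IsSingularCone S) (hA : ContDiffOn ℝ 1 A Sᶜ)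
    (hw : MemLp w 2 volume) (hf : IsCutoff a b f) {V : Space d → ℝ}
    (hV : AEStronglyMeasurable V volume) {M : ℝ} (hM : ∀ x ∉ S, |V x| ≤ M) (s : ℝ) :
    (((2 * s : ℝ)⁻¹ : ℂ) * ((∫ x, inner ℂ (transport A s w x) ((f ‖x‖ : ℂ) • ((V x : ℂ) * w x))) -
      ∫ x, inner ℂ (transport A (-s) w x) ((f ‖x‖ : ℂ) • ((V x : ℂ) * w x)))).re =
    ∫ x, (2 * s)⁻¹ * (f ‖x‖ * V x - Real.exp (s * d) * (f (Real.exp s * ‖x‖) *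
      V (Real.exp s • x))) * (inner ℂ (w x) (transport A s w x)).re := by
  obtain ⟨M₀, hM0, hM₀⟩ := hf.bounded
  have hTw := memLp_transport hS hA hw s
  have hi := (integrable_inner_of_memLp hw hTw).re
  have hc := hf.contDiff.continuous
  have i1 : Integrable (fun x => f ‖x‖ * V x * (inner ℂ (w x) (transport A s w x)).re) volume :=
    integrable_bdd_mul (M := M₀ * M) hi (hf.aestronglyMeasurable_real.mul hV) (by
      filter_upwards [hS.ae_notMem] with x hx
      rw [abs_mul]
      gcongr
      exacts [hM₀ _, hM x hx])
  have i2 : Integrable (fun x => f (Real.exp s * ‖x‖) * V (Real.exp s • x) *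
      (inner ℂ (w x) (transport A s w x)).re) volume :=
    integrable_bdd_mul (M := M₀ * M) hi
      ((show Continuous fun x : Space d => f (Real.exp s * ‖x‖) by fun_prop).aestronglyMeasurable.mul
        (aestronglyMeasurable_exp_smul hV s)) (by
      filter_upwards [hS.ae_notMem] with x hx
      rw [abs_mul]
      gcongr
      exacts [hM₀ _, hM _ (hS.exp_smul_notMem hx s)])
  have re_int : ∀ m : Space d → ℝ, AEStronglyMeasurable m volume → (∀ᵐ x, |m x| ≤ M₀ * M) →
      (∫ x, (m x : ℂ) * inner ℂ (w x) (transport A s w x)).re =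
        ∫ x, m x * (inner ℂ (w x) (transport A s w x)).re := by
    intro m hm hb
    have h0 : Integrable (fun x => (m x : ℂ) * inner ℂ (w x) (transport A s w x)) volume :=
      (integrable_inner_of_memLp hw hTw).bdd_mul (c := M₀ * M)
        (Complex.continuous_ofReal.comp_aestronglyMeasurable hm)
        (hb.mono fun x hx => by rw [Complex.norm_real]; exact hx)
    have := integral_re (𝕜 := ℂ) h0
    rw [RCLike.re_eq_complex_re] at this
    rw [← this]
    simp only [Complex.re_ofReal_mul]
  have e1 : (∫ x, inner ℂ (transport A s w x) ((f ‖x‖ : ℂ) • ((V x : ℂ) * w x))).re =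
      ∫ x, f ‖x‖ * V x * (inner ℂ (w x) (transport A s w x)).re := by
    rw [← re_int (fun x => f ‖x‖ * V x) (hf.aestronglyMeasurable_real.mul hV) (by
      filter_upwards [hS.ae_notMem] with x hx
      rw [abs_mul]
      gcongr
      exacts [hM₀ _, hM x hx]), integral_inner_comm_re]
    congr 2
    ext x
    rw [← smul_eq_mul, smul_smul, inner_smul_left, ← Complex.ofReal_mul, Complex.conj_ofReal]
  have e2 : (∫ x, inner ℂ (transport A (-s) w x) ((f ‖x‖ : ℂ) • ((V x : ℂ) * w x))).re =
      Real.exp (s * d) * ∫ x, f (Real.exp s * ‖x‖) * V (Real.exp s • x) *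
        (inner ℂ (w x) (transport A s w x)).re := by
    have := integral_inner_transport_neg A s w fun x => ((f ‖x‖ * V x : ℝ) : ℂ)
    simp only [norm_cutoff_comp] at this
    rw [← re_int (fun x => f (Real.exp s * ‖x‖) * V (Real.exp s • x))
      ((show Continuous fun x : Space d => f (Real.exp s * ‖x‖) by fun_prop).aestronglyMeasurable.mul
        (aestronglyMeasurable_exp_smul hV s)) (by
      filter_upwards [hS.ae_notMem] with x hx
      rw [abs_mul]
      gcongr
      exacts [hM₀ _, hM _ (hS.exp_smul_notMem hx s)]), ← Complex.re_ofReal_mul]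
    refine congrArg Complex.re (Eq.trans ?_ this)
    congr 1
    ext x
    rw [← smul_eq_mul, smul_smul, Complex.ofReal_mul]
  rw [← Complex.ofReal_inv, Complex.re_ofReal_mul, Complex.sub_re, e1, e2, ← integral_const_mul,
    ← integral_sub i1 (i2.const_mul _), ← integral_const_mul]
  congr 1
  ext x
  ring

/-- Upper bound for the potential part of the symmetric difference quotient. -/
theorem re_potential_slope_le (hS : IsSingularCone S) (hA : ContDiffOn ℝ 1 A Sᶜ)
    (hw : MemLp w 2 volume) (hf : IsCutoff a b f) (hf0 : ∀ r, 0 ≤ f r) {V : Space d → ℝ}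
    (hV : AEStronglyMeasurable V volume) {M : ℝ} (hM : ∀ x ∉ S, |V x| ≤ M) {Cv : ℝ}
    (hmono : ∀ x ∉ S, ∀ s : ℝ, 0 ≤ s → s ≤ 1 → a ≤ ‖Real.exp s • x‖ → ‖Real.exp s • x‖ ≤ b →
      V x - V (Real.exp s • x) ≤ Cv * s) {M₀ : ℝ} (hM₀ : ∀ r, |f r| ≤ M₀) {s : ℝ} (hs : 0 < s)
    (hs1 : s ≤ 1) :
    (((2 * s : ℝ)⁻¹ : ℂ) * ((∫ x, inner ℂ (transport A s w x) ((f ‖x‖ : ℂ) • ((V x : ℂ) * w x))) -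
      ∫ x, inner ℂ (transport A (-s) w x) ((f ‖x‖ : ℂ) • ((V x : ℂ) * w x)))).re ≤
    (∫ x, slopeCoeff 0 d f s ‖x‖ * V x * (inner ℂ (w x) (transport A s w x)).re) +
    Cv / 4 * ((∫ x, Real.exp (s * d) * f (Real.exp s * ‖x‖) * ‖w x‖ ^ 2) +
      ∫ x, Real.exp (s * d) * f (Real.exp s * ‖x‖) * ‖transport A s w x‖ ^ 2) +
    Real.exp d * M₀ * M / 2 *
      ∫ x, ‖s⁻¹ • (transport A s w x - w x)‖ * ‖transport A s w x - w x‖ := by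
  have hc := hf.contDiff.continuous
  have hTw := memLp_transport hS hA hw s
  have hi := (integrable_inner_of_memLp hw hTw).re
  obtain ⟨M₁, hM1, hM₁⟩ := hf.bounded_slopeCoeff 0 d
  have mfs : AEStronglyMeasurable (fun x : Space d => Real.exp (s * d) * f (Real.exp s * ‖x‖))
      volume := Continuous.aestronglyMeasurable (by fun_prop)
  have bfs : ∀ x : Space d, |Real.exp (s * d) * f (Real.exp s * ‖x‖)| ≤ Real.exp d * M₀ := by
    intro x
    rw [abs_mul, Real.abs_exp]
    gcongr
    · exact mul_le_of_le_one_left (Nat.cast_nonneg d) hs1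
    · exact hM₀ _
  have j1 : Integrable (fun x => slopeCoeff 0 d f s ‖x‖ * V x *
      (inner ℂ (w x) (transport A s w x)).re) volume := by
    refine integrable_bdd_mul (M := M₁ * M) hi (AEStronglyMeasurable.mul ?_ hV) ?_
    · unfold slopeCoeff
      exact Continuous.aestronglyMeasurable (by fun_prop)
    · filter_upwards [hS.ae_notMem] with x hx
      rw [abs_mul]
      gcongr
      exacts [hM₁ s hs hs1 _, hM x hx]
  have j2 : Integrable (fun x => Real.exp (s * d) * f (Real.exp s * ‖x‖) * ‖w x‖ ^ 2) volume :=
    integrable_bdd_mul hw.norm.integrable_sq mfs (Eventually.of_forall bfs)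
  have j3 : Integrable (fun x => Real.exp (s * d) * f (Real.exp s * ‖x‖) *
      ‖transport A s w x‖ ^ 2) volume :=
    integrable_bdd_mul hTw.norm.integrable_sq mfs (Eventually.of_forall bfs)
  have j4 : Integrable (fun x => ‖s⁻¹ • (transport A s w x - w x)‖ * ‖transport A s w x - w x‖)
      volume := ((hTw.sub hw).const_smul s⁻¹).norm.integrable_mul (hTw.sub hw).norm
  have j23 : Integrable (fun x => Cv / 4 * (Real.exp (s * d) * f (Real.exp s * ‖x‖) * ‖w x‖ ^ 2 +
      Real.exp (s * d) * f (Real.exp s * ‖x‖) * ‖transport A s w x‖ ^ 2)) volume :=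
    (j2.add j3).const_mul _
  have j123 : Integrable (fun x => slopeCoeff 0 d f s ‖x‖ * V x *
      (inner ℂ (w x) (transport A s w x)).re +
      Cv / 4 * (Real.exp (s * d) * f (Real.exp s * ‖x‖) * ‖w x‖ ^ 2 +
      Real.exp (s * d) * f (Real.exp s * ‖x‖) * ‖transport A s w x‖ ^ 2)) volume :=
    j1.add j23
  rw [re_potential_slope hS hA hw hf hV hM s, ← integral_add j2 j3, ← integral_const_mul,
    ← integral_const_mul, ← integral_add j1 j23, ← integral_add j123 (j4.const_mul _)]
  have mleft : AEStronglyMeasurable (fun x : Space d => (2 * s)⁻¹ * (f ‖x‖ * V x -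
      Real.exp (s * d) * (f (Real.exp s * ‖x‖) * V (Real.exp s • x)))) volume :=
    ((hf.aestronglyMeasurable_real.mul hV).sub (((show Continuous fun x : Space d =>
      f (Real.exp s * ‖x‖) by fun_prop).aestronglyMeasurable.mul
        (aestronglyMeasurable_exp_smul hV s)).const_mul _)).const_mul _
  refine integral_mono_ae (integrable_bdd_mul (M := (2 * s)⁻¹ * (M₀ * M + Real.exp d * M₀ * M)) hi
    mleft ?_) (j123.add (j4.const_mul _)) ?_
  · filter_upwards [hS.ae_notMem] with x hx
    have hM0 : 0 ≤ M₀ := (abs_nonneg _).trans (hM₀ 0)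
    rw [abs_mul, abs_of_pos (by positivity : 0 < (2 * s)⁻¹), ← mul_assoc]
    gcongr
    refine (abs_sub _ _).trans (add_le_add ?_ ?_)
    · rw [abs_mul]
      gcongr
      exacts [hM₀ _, hM x hx]
    · rw [abs_mul]
      gcongr
      exacts [bfs x, hM _ (hS.exp_smul_notMem hx s)]
  · filter_upwards [hS.ae_notMem] with x hx
    set T := transport A s w x
    set g := Real.exp (s * d) * f (Real.exp s * ‖x‖) with hg
    set Vs := V (Real.exp s • x)
    have hg0 : 0 ≤ g := mul_nonneg (Real.exp_pos _).le (hf0 _)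
    have hgM : g ≤ Real.exp d * M₀ := (le_abs_self _).trans (bfs x)
    -- A one-sided bound on V(x) - V(e^s x) can only be multiplied by something nonnegative.
    -- Polarization isolates such a part; the remainder is of second order in T - w and tolerates
    -- the crude bound 2 M.
    have hpol : (inner ℂ (w x) T).re = (‖w x‖ ^ 2 + ‖T‖ ^ 2 - ‖T - w x‖ ^ 2) / 2 := by
      have h := @norm_sub_sq ℂ ℂ _ _ _ T (w x)
      rw [RCLike.re_eq_complex_re, ← inner_conj_symm, Complex.conj_re] at h
      linarith
    have hn : ‖s⁻¹ • (T - w x)‖ * ‖T - w x‖ = s⁻¹ * ‖T - w x‖ ^ 2 := by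
      rw [norm_smul, Real.norm_of_nonneg (inv_nonneg.2 hs.le)]
      ring
    have hgV : g * (V x - Vs) ≤ g * (Cv * s) := by
      rcases lt_or_ge ‖Real.exp s • x‖ a with h | h
      · rw [hg, ← norm_cutoff_comp, hf.zero _ (Or.inl h)]; simp
      rcases lt_or_ge b ‖Real.exp s • x‖ with h' | h'
      · rw [hg, ← norm_cutoff_comp, hf.zero _ (Or.inr h')]; simp
      exact mul_le_mul_of_nonneg_left (hmono x hx s hs.le hs1 h h') hg0
    have hgV2 : -(g * (V x - Vs)) ≤ Real.exp d * M₀ * (2 * M) := by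
      rw [← mul_neg]
      have h1 := abs_le.1 (hM x hx)
      have h2 := abs_le.1 (hM _ (hS.exp_smul_notMem hx s))
      calc g * -(V x - Vs) ≤ g * (2 * M) := by gcongr; linarith [h1.1, h2.2]
        _ ≤ _ := by
          have : 0 ≤ M := (abs_nonneg _).trans (hM x hx)
          gcongr
    -- A product rule for differences: the slope falls on f with V frozen at x, or on V with f taken
    -- at e^s x.
    have hsplit : (2 * s)⁻¹ * (f ‖x‖ * V x - Real.exp (s * d) * (f (Real.exp s * ‖x‖) * Vs)) *
        (inner ℂ (w x) T).re = slopeCoeff 0 d f s ‖x‖ * V x * (inner ℂ (w x) T).re +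
        (2 * s)⁻¹ * ((g * (V x - Vs)) * (inner ℂ (w x) T).re) := by
      rw [slopeCoeff, zero_mul, Real.exp_zero, mul_comm (d : ℝ) s]
      simp only [hg]
      field_simp
      ring
    have hmain : (g * (V x - Vs)) * (inner ℂ (w x) T).re ≤
        g * (Cv * s) * ((‖w x‖ ^ 2 + ‖T‖ ^ 2) / 2) +
          Real.exp d * M₀ * (2 * M) * (‖T - w x‖ ^ 2 / 2) := by
      rw [hpol]
      have h1 := mul_le_mul_of_nonneg_right hgV
        (by positivity : 0 ≤ (‖w x‖ ^ 2 + ‖T‖ ^ 2) / 2)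
      have h2 := mul_le_mul_of_nonneg_right hgV2 (by positivity : 0 ≤ ‖T - w x‖ ^ 2 / 2)
      linarith
    have hmain' := mul_le_mul_of_nonneg_left hmain (by positivity : 0 ≤ (2 * s)⁻¹)
    rw [hsplit, hn, add_assoc]
    refine add_le_add le_rfl (hmain'.trans_eq ?_)
    field_simp
    ring

/-- The limit of the bound in `re_potential_slope_le`. The last term drops out: one factor is a
convergent slope, the other is T_s w - w → 0. -/
theorem tendsto_potential_bound (hS : IsSingularCone S) (hA : ContDiffOn ℝ 1 A Sᶜ)
    (h : EnergyPair S A ρ R w H) (hf : IsCutoff a b f) {V : Space d → ℝ}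
    (hV : AEStronglyMeasurable V volume) {M : ℝ} (hM : ∀ x ∉ S, |V x| ≤ M) (Cv K : ℝ) :
    Tendsto (fun n =>
      (∫ x, slopeCoeff 0 d f (step n) ‖x‖ * V x * (inner ℂ (w x) (transport A (step n) w x)).re) +
      Cv / 4 * ((∫ x, Real.exp (step n * d) * f (Real.exp (step n) * ‖x‖) * ‖w x‖ ^ 2) +
        ∫ x, Real.exp (step n * d) * f (Real.exp (step n) * ‖x‖) * ‖transport A (step n) w x‖ ^ 2) +
      K * ∫ x, ‖(step n)⁻¹ • (transport A (step n) w x - w x)‖ * ‖transport A (step n) w x - w x‖)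
      atTop (𝓝 ((∫ x, ((0 - d) * f ‖x‖ - ‖x‖ * deriv f ‖x‖) / 2 * V x * ‖w x‖ ^ 2) +
        Cv / 2 * ∫ x, f ‖x‖ * ‖w x‖ ^ 2)) := by
  have hc := hf.contDiff.continuous
  obtain ⟨M₀, hM0, hM₀⟩ := hf.bounded
  obtain ⟨M₁, hM1, hM₁⟩ := hf.bounded_slopeCoeff 0 d
  have hT := (tendstoL2_transport hS hA h.memLp).comp tendsto_step_nhds
  have mslope : ∀ n, AEStronglyMeasurable (fun x => slopeCoeff 0 d f (step n) ‖x‖ * V x) volume := by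
    intro n
    refine AEStronglyMeasurable.mul ?_ hV
    unfold slopeCoeff
    exact Continuous.aestronglyMeasurable (by fun_prop)
  have t1 := tendsto_weighted_inner h.memLp hT (m := fun n x => slopeCoeff 0 d f (step n) ‖x‖ * V x)
    (m₀ := fun x => ((0 - d) * f ‖x‖ - ‖x‖ * deriv f ‖x‖) / 2 * V x) mslope (M₁ * M)
    (fun n => by
      filter_upwards [hS.ae_notMem] with x hx
      rw [abs_mul]
      gcongr
      exacts [hM₁ _ (step_pos n) (step_le_one n) _, hM x hx])
    (Eventually.of_forall fun x =>
      (((hf.tendsto_slopeCoeff 0 d ‖x‖).comp tendsto_step).mul_const (V x)))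
  have mfs : ∀ n, AEStronglyMeasurable
      (fun x : Space d => Real.exp (step n * d) * f (Real.exp (step n) * ‖x‖)) volume :=
    fun n => Continuous.aestronglyMeasurable (by fun_prop)
  have bfs : ∀ n, ∀ᵐ x : Space d, |Real.exp (step n * d) * f (Real.exp (step n) * ‖x‖)| ≤
      Real.exp d * M₀ := by
    refine fun n => Eventually.of_forall fun x => ?_
    rw [abs_mul, Real.abs_exp]
    gcongr
    · exact mul_le_of_le_one_left (Nat.cast_nonneg d) (step_le_one n)
    · exact hM₀ _
  have lfs : ∀ᵐ x : Space d, Tendsto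
      (fun n => Real.exp (step n * d) * f (Real.exp (step n) * ‖x‖)) atTop (𝓝 (f ‖x‖)) := by
    refine Eventually.of_forall fun x => ?_
    have hcont : Continuous fun s : ℝ => Real.exp (s * d) * f (Real.exp s * ‖x‖) := by fun_prop
    have := (hcont.tendsto 0).comp tendsto_step_nhds
    simpa [Function.comp_def] using this
  have t2 := (TendstoL2.const (l := (atTop : Filter ℕ)) h.memLp).tendsto_weighted_sq mfs _ bfs lfs
  have t3 := hT.tendsto_weighted_sq mfs _ bfs lfs
  have t4a : TendstoL2 volume atTop
      (fun n x => (step n)⁻¹ • (transport A (step n) w x - w x)) (radial H) :=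
    (h.tendstoL2_slope hS hA).comp (tendsto_step.mono_right
      (nhdsWithin_mono _ fun s (hs : s ∈ Set.Ioi 0) => ne_of_gt hs))
  have t4b := hT.sub (TendstoL2.const h.memLp)
  have t4 := t4a.norm.tendsto_integral_inner (𝕜 := ℝ) t4b.norm
  have z : ∫ x, inner ℝ ‖radial H x‖ ‖w x - w x‖ = 0 := by simp
  rw [z] at t4
  have key := (t1.add ((t2.add t3).const_mul (Cv / 4))).add (t4.const_mul K)
  refine (key.congr fun n => ?_).trans_eq ?_
  · simp only [RCLike.inner_apply, conj_trivial, mul_comm ‖transport A (step n) w _ - w _‖]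
  · congr 1
    ring

end RadialInequality

/-! ### The virial inequality -/

section RadialInequality

variable {d : ℕ} {S : Set (Space d)} {A : Space d → Space d} {a b ρ R : ℝ} {f : ℝ → ℝ}
  {w : Space d → ℂ} {H : Space d → EuclideanSpace ℂ (Fin d)}

/-- The test pair is (T_s w, ∇_A T_s w). Its gradient is split into the scaled and the defect part,
since the first is treated exactly and the second only estimated; the two potentials are kept apart
for the same reason. -/
theorem cutoffWeakEquation_transport (hS : IsSingularCone S) (hA : ContDiffOn ℝ 1 A Sᶜ)
    (hρ : 0 < ρ) (hR : 0 < R) (h : EnergyPair S A ρ R w H) {C : ℝ}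
    (hC : ∀ x ∉ S, Real.exp (-1) * ρ ≤ ‖x‖ → ‖x‖ * ‖tangentialField A x‖ ≤ C)
    (hf : IsCutoff a b f) {V₁ V₂ : Space d → ℝ} (hV₁ : AEStronglyMeasurable V₁ volume)
    (hV₂ : AEStronglyMeasurable V₂ volume) {M : ℝ} (hM₁ : ∀ x ∉ S, |V₁ x| ≤ M)
    (hM₂ : ∀ x ∉ S, |V₂ x| ≤ M)
    (hweq : CutoffWeakEquation S A (fun x => V₁ x + V₂ x) f w H) {s : ℝ} (hs : |s| ≤ 1) :
    Integrable (fun x => inner ℂ ((Complex.I * transport A s w x) • cvec (phaseDefect A s x))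
      ((f ‖x‖ : ℂ) • H x)) volume ∧
    (Real.exp s : ℂ) * (∫ x, inner ℂ (transport A s H x) ((f ‖x‖ : ℂ) • H x)) +
      (∫ x, inner ℂ ((Complex.I * transport A s w x) • cvec (phaseDefect A s x))
        ((f ‖x‖ : ℂ) • H x)) +
      (∫ x, inner ℂ (transport A s w x) (((deriv f ‖x‖ / ‖x‖ : ℝ) : ℂ) • radial H x)) =
    (∫ x, inner ℂ (transport A s w x) ((f ‖x‖ : ℂ) • ((V₁ x : ℂ) * w x))) +
      ∫ x, inner ℂ (transport A s w x) ((f ‖x‖ : ℂ) • ((V₂ x : ℂ) * w x)) := by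
  have hT := h.transport hS hA hρ hR hs hC
  have mH := hf.memLp_smul h.memLp_grad
  have mTH := (memLp_transport hS hA h.memLp_grad s).const_smul (Real.exp s : ℂ)
  have mD : MemLp (fun x => (Complex.I * transport A s w x) • cvec (phaseDefect A s x)) 2 volume :=
    (hT.memLp_grad.sub mTH).ae_eq (Eventually.of_forall fun x => by simp [transportGrad])
  have mV : ∀ {V : Space d → ℝ}, AEStronglyMeasurable V volume → (∀ x ∉ S, |V x| ≤ M) →
      MemLp (fun x => (f ‖x‖ : ℂ) • ((V x : ℂ) * w x)) 2 volume := fun hV hM =>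
    hf.memLp_smul (memLp_bounded_smul h.memLp (Complex.continuous_ofReal.comp_aestronglyMeasurable hV)
      (hS.ae_notMem.mono fun x hx => by rw [Complex.norm_real]; exact hM x hx))
  have iD := integrable_inner_of_memLp mD mH
  refine ⟨iD, ?_⟩
  have key := hweq _ _ _ _ hT
  have e1 : ∫ x, inner ℂ (transportGrad A s w H x) ((f ‖x‖ : ℂ) • H x) =
      (Real.exp s : ℂ) * (∫ x, inner ℂ (transport A s H x) ((f ‖x‖ : ℂ) • H x)) +
      ∫ x, inner ℂ ((Complex.I * transport A s w x) • cvec (phaseDefect A s x))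
        ((f ‖x‖ : ℂ) • H x) := by
    rw [← integral_const_mul, ← integral_add
      ((integrable_inner_of_memLp (memLp_transport hS hA h.memLp_grad s) mH).const_mul _) iD]
    congr 1
    ext x
    rw [transportGrad, inner_add_left, inner_smul_left, Complex.conj_ofReal]
  have e2 : ∫ x, inner ℂ (transport A s w x) ((f ‖x‖ : ℂ) • (((V₁ x + V₂ x : ℝ) : ℂ) * w x)) =
      (∫ x, inner ℂ (transport A s w x) ((f ‖x‖ : ℂ) • ((V₁ x : ℂ) * w x))) +
      ∫ x, inner ℂ (transport A s w x) ((f ‖x‖ : ℂ) • ((V₂ x : ℂ) * w x)) := by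
    rw [← integral_add (integrable_inner_of_memLp hT.memLp (mV hV₁ hM₁))
      (integrable_inner_of_memLp hT.memLp (mV hV₂ hM₂))]
    congr 1
    ext x
    rw [← inner_add_right, ← smul_add, Complex.ofReal_add, add_mul]
  rw [← e1, ← e2]
  exact key

/-- The energy inequality with the radial multiplier. -/
theorem integral_radial_nonpos (hS : IsSingularCone S) (hA : ContDiffOn ℝ 1 A Sᶜ)
    (hρ : 0 < ρ) (hR : 0 < R) (h : EnergyPair S A ρ R w H) (hρa : ρ ≤ a) {C : ℝ}
    (hC : ∀ x ∉ S, Real.exp (-1) * ρ ≤ ‖x‖ → ‖x‖ * ‖tangentialField A x‖ ≤ C)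
    (hf : IsCutoff a b f) (hf0 : ∀ r, 0 ≤ f r)
    {V₁ V₂ : Space d → ℝ} (hV₁ : AEStronglyMeasurable V₁ volume)
    (hV₂ : AEStronglyMeasurable V₂ volume) {M : ℝ} (hM₁ : ∀ x ∉ S, |V₁ x| ≤ M)
    (hM₂ : ∀ x ∉ S, |V₂ x| ≤ M) {Cv : ℝ}
    (hmono : ∀ x ∉ S, ∀ s : ℝ, 0 ≤ s → s ≤ 1 → a ≤ ‖Real.exp s • x‖ → ‖Real.exp s • x‖ ≤ b →
      V₁ x - V₁ (Real.exp s • x) ≤ Cv * s)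
    (hweq : CutoffWeakEquation S A (fun x => V₁ x + V₂ x) f w H) :
    Integrable (fun x => deriv f ‖x‖ / ‖x‖ * ‖radial H x‖ ^ 2 +
      ((2 - d) * f ‖x‖ - ‖x‖ * deriv f ‖x‖) / 2 * ‖H x‖ ^ 2 +
      (d * f ‖x‖ + ‖x‖ * deriv f ‖x‖) / 2 * V₁ x * ‖w x‖ ^ 2 - f ‖x‖ * V₂ x * corr w H x -
      Real.exp 1 * C * (f ‖x‖ * (‖w x‖ * ‖H x‖)) - Cv / 2 * (f ‖x‖ * ‖w x‖ ^ 2)) volume ∧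
    ∫ x, (deriv f ‖x‖ / ‖x‖ * ‖radial H x‖ ^ 2 +
      ((2 - d) * f ‖x‖ - ‖x‖ * deriv f ‖x‖) / 2 * ‖H x‖ ^ 2 +
      (d * f ‖x‖ + ‖x‖ * deriv f ‖x‖) / 2 * V₁ x * ‖w x‖ ^ 2 - f ‖x‖ * V₂ x * corr w H x -
      Real.exp 1 * C * (f ‖x‖ * (‖w x‖ * ‖H x‖)) - Cv / 2 * (f ‖x‖ * ‖w x‖ ^ 2)) ≤ 0 := by
  obtain ⟨M₀, hM0, hM₀⟩ := hf.bounded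
  obtain ⟨M', hM'0, hM'⟩ := hf.bounded_mul_deriv
  obtain ⟨M'', hM''0, hM''⟩ := hf.bounded_deriv_div
  have mf := hf.aestronglyMeasurable_real (d := d)
  have mf' := hf.aestronglyMeasurable_deriv (d := d)
  have mf'' := hf.aestronglyMeasurable_deriv_div_real (d := d)
  have i1 : Integrable (fun x => deriv f ‖x‖ / ‖x‖ * ‖radial H x‖ ^ 2) volume :=
    integrable_bdd_mul h.integrable_radial_sq mf'' (Eventually.of_forall fun x => hM'' _)
  have i2 : Integrable (fun x => ((2 - d) * f ‖x‖ - ‖x‖ * deriv f ‖x‖) / 2 * ‖H x‖ ^ 2) volume := by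
    refine integrable_bdd_mul (M := (|2 - (d : ℝ)| * M₀ + M') / 2) h.integrable_grad_sq
      (((mf.const_mul _).sub mf').aemeasurable.div_const _).aestronglyMeasurable (Eventually.of_forall fun x => ?_)
    rw [abs_div, abs_two]
    gcongr
    refine (abs_sub _ _).trans (add_le_add ?_ (hM' _))
    rw [abs_mul]
    gcongr
    exact hM₀ _
  have i3 : Integrable (fun x => (d * f ‖x‖ + ‖x‖ * deriv f ‖x‖) / 2 * V₁ x * ‖w x‖ ^ 2)
      volume := by
    refine integrable_bdd_mul (M := (d * M₀ + M') / 2 * M) h.integrable_sq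
      ((((mf.const_mul _).add mf').aemeasurable.div_const _).aestronglyMeasurable.mul hV₁) ?_
    filter_upwards [hS.ae_notMem] with x hx
    rw [abs_mul, abs_div, abs_two]
    gcongr
    · refine (abs_add_le _ _).trans (add_le_add ?_ (hM' _))
      rw [abs_mul, Nat.abs_cast]
      gcongr
      exact hM₀ _
    · exact hM₁ x hx
  have i4 : Integrable (fun x => f ‖x‖ * V₂ x * corr w H x) volume := by
    refine integrable_bdd_mul (M := M₀ * M) h.integrable_corr (mf.mul hV₂) ?_
    filter_upwards [hS.ae_notMem] with x hx
    rw [abs_mul]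
    gcongr
    exacts [hM₀ _, hM₂ x hx]
  have i5 : Integrable (fun x => Real.exp 1 * C * (f ‖x‖ * (‖w x‖ * ‖H x‖))) volume :=
    (integrable_bdd_mul h.integrable_mul_grad mf (Eventually.of_forall fun x => hM₀ _)).const_mul _
  have i6 : Integrable (fun x => Cv / 2 * (f ‖x‖ * ‖w x‖ ^ 2)) volume :=
    (integrable_bdd_mul h.integrable_sq mf (Eventually.of_forall fun x => hM₀ _)).const_mul _
  refine ⟨((((i1.add i2).add i3).sub i4).sub i5).sub i6, ?_⟩
  have split : ∫ x, (deriv f ‖x‖ / ‖x‖ * ‖radial H x‖ ^ 2 +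
      ((2 - d) * f ‖x‖ - ‖x‖ * deriv f ‖x‖) / 2 * ‖H x‖ ^ 2 +
      (d * f ‖x‖ + ‖x‖ * deriv f ‖x‖) / 2 * V₁ x * ‖w x‖ ^ 2 - f ‖x‖ * V₂ x * corr w H x -
      Real.exp 1 * C * (f ‖x‖ * (‖w x‖ * ‖H x‖)) - Cv / 2 * (f ‖x‖ * ‖w x‖ ^ 2)) =
      (∫ x, deriv f ‖x‖ / ‖x‖ * ‖radial H x‖ ^ 2) +
      (∫ x, ((2 - d) * f ‖x‖ - ‖x‖ * deriv f ‖x‖) / 2 * ‖H x‖ ^ 2) +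
      (∫ x, (d * f ‖x‖ + ‖x‖ * deriv f ‖x‖) / 2 * V₁ x * ‖w x‖ ^ 2) -
      (∫ x, f ‖x‖ * V₂ x * corr w H x) -
      (∫ x, Real.exp 1 * C * (f ‖x‖ * (‖w x‖ * ‖H x‖))) -
      ∫ x, Cv / 2 * (f ‖x‖ * ‖w x‖ ^ 2) := by
    rw [← integral_add i1 i2, ← integral_add (by exact i1.add i2) i3,
      ← integral_sub (by exact (i1.add i2).add i3) i4,
      ← integral_sub (by exact ((i1.add i2).add i3).sub i4) i5,
      ← integral_sub (by exact (((i1.add i2).add i3).sub i4).sub i5) i6]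
  rw [split]
  have mX := hf.memLp_deriv_smul h.memLp_radial
  have mV2 : MemLp (fun x => (f ‖x‖ : ℂ) • ((V₂ x : ℂ) * w x)) 2 volume :=
    hf.memLp_smul (memLp_bounded_smul h.memLp
      (Complex.continuous_ofReal.comp_aestronglyMeasurable hV₂)
      (hS.ae_notMem.mono fun x hx => by rw [Complex.norm_real]; exact hM₂ x hx))
  -- Here α = 1 and β = d - 1 reproduce the factors e^s and e^{-s} with which the gradient appears
  -- at s and at -s.
  have tL := tendsto_symmetric_correlation hS hA hf 1 (d - 1) h.memLp_grad
  have tX := (Complex.continuous_re.tendsto _).comp (tendsto_slope_inner hS hA h mX)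
  have tV := (Complex.continuous_re.tendsto _).comp (tendsto_slope_inner hS hA h mV2)
  have tB := tendsto_defect_bound hS hA h hf (Real.exp 1 * C)
  have tU := tendsto_potential_bound hS hA h hf hV₁ hM₁ Cv (Real.exp d * M₀ * M / 2)
  rw [re_integral_inner_self_mul] at tX
  have eV : (∫ x, inner ℂ (radial H x) ((f ‖x‖ : ℂ) • ((V₂ x : ℂ) * w x))).re =
      ∫ x, f ‖x‖ * V₂ x * corr w H x := by
    rw [← re_integral_smul_radial h (m := fun x => f ‖x‖ * V₂ x) (M := M₀ * M) (mf.mul hV₂) (by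
      filter_upwards [hS.ae_notMem] with x hx
      rw [abs_mul]
      gcongr
      exacts [hM₀ _, hM₂ x hx]), integral_inner_comm_re]
    congr 2
    ext x
    rw [← smul_eq_mul, smul_smul, inner_smul_left, inner_smul_right, ← Complex.ofReal_mul,
      Complex.conj_ofReal]
  rw [eV] at tV
  have tall := (((tL.add tX).sub tV).sub tB).sub tU
  have e2 : ∫ x, ((1 - ((d : ℝ) - 1)) * f ‖x‖ - ‖x‖ * deriv f ‖x‖) / 2 * ‖H x‖ ^ 2 =
      ∫ x, ((2 - d) * f ‖x‖ - ‖x‖ * deriv f ‖x‖) / 2 * ‖H x‖ ^ 2 := by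
    congr 1
    ext x
    ring
  have e3 : ∫ x, ((0 - (d : ℝ)) * f ‖x‖ - ‖x‖ * deriv f ‖x‖) / 2 * V₁ x * ‖w x‖ ^ 2 =
      -∫ x, (d * f ‖x‖ + ‖x‖ * deriv f ‖x‖) / 2 * V₁ x * ‖w x‖ ^ 2 := by
    rw [← integral_neg]
    congr 1
    ext x
    ring
  rw [e2, e3] at tall
  -- The inequality holds for each step size, and the claim is its limit.
  refine le_trans (le_of_eq ?_) (le_of_tendsto' tall fun n => ?_)
  · rw [integral_const_mul (Cv / 2)]
    ring
  obtain ⟨hi1, hw1⟩ := cutoffWeakEquation_transport hS hA hρ hR h hC hf hV₁ hV₂ hM₁ hM₂ hweq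
    (abs_step_le_one n)
  obtain ⟨hi2, hw2⟩ := cutoffWeakEquation_transport hS hA hρ hR h hC hf hV₁ hV₂ hM₁ hM₂ hweq
    (abs_neg_step_le_one n)
  have hdef := (Complex.abs_re_le_norm _).trans
    (defect_le hS hA h hρa hC hf hf0 n hi1 hi2)
  have hpot := re_potential_slope_le hS hA h.memLp hf hf0 hV₁ hM₁ hmono hM₀ (step_pos n)
    (step_le_one n)
  have hx1 : Real.exp (1 * step n) = Real.exp (step n) := by rw [one_mul]
  have hx2 : Real.exp (((d : ℝ) - 1 - d) * step n) = Real.exp (-step n) := by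
    congr 1
    ring
  simp only [Function.comp_apply, hx1, hx2, Complex.ofReal_inv]
  set s := step n
  generalize (∫ x, inner ℂ (transport A s H x) ((f ‖x‖ : ℂ) • H x)) = p1 at *
  generalize (∫ x, inner ℂ (transport A (-s) H x) ((f ‖x‖ : ℂ) • H x)) = p2 at *
  generalize (∫ x, inner ℂ ((Complex.I * transport A s w x) • cvec (phaseDefect A s x))
        ((f ‖x‖ : ℂ) • H x)) = d1 at *
  generalize (∫ x, inner ℂ ((Complex.I * transport A (-s) w x) • cvec (phaseDefect A (-s) x))
        ((f ‖x‖ : ℂ) • H x)) = d2 at *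
  generalize (∫ x, inner ℂ (transport A s w x) (((deriv f ‖x‖ / ‖x‖ : ℝ) : ℂ) • radial H x)) = x1
    at *
  generalize (∫ x, inner ℂ (transport A (-s) w x) (((deriv f ‖x‖ / ‖x‖ : ℝ) : ℂ) • radial H x)) = x2
    at *
  generalize (∫ x, inner ℂ (transport A s w x) ((f ‖x‖ : ℂ) • ((V₁ x : ℂ) * w x))) = q1 at *
  generalize (∫ x, inner ℂ (transport A (-s) w x) ((f ‖x‖ : ℂ) • ((V₁ x : ℂ) * w x))) = q2 at *
  generalize (∫ x, inner ℂ (transport A s w x) ((f ‖x‖ : ℂ) • ((V₂ x : ℂ) * w x))) = r1 at *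
  generalize (∫ x, inner ℂ (transport A (-s) w x) ((f ‖x‖ : ℂ) • ((V₂ x : ℂ) * w x))) = r2 at *
  have hsum : ((2 * s : ℝ)⁻¹ : ℂ) * (Real.exp s * p1 - Real.exp (-s) * p2) =
      ((2 * s : ℝ)⁻¹ : ℂ) * (q1 - q2) + ((2 * s : ℝ)⁻¹ : ℂ) * (r1 - r2) -
      ((2 * s : ℝ)⁻¹ : ℂ) * (d1 - d2) - ((2 * s : ℝ)⁻¹ : ℂ) * (x1 - x2) := by
    -- The weak equation at s minus the one at -s, divided by 2s.
    linear_combination ((2 * s : ℝ)⁻¹ : ℂ) * (hw1 - hw2)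
  rw [hsum, Complex.sub_re, Complex.sub_re, Complex.add_re]
  linarith [(abs_le.1 hdef).1]

end RadialInequality

/-! ### Algebra and pointwise bounds behind the Carleman estimate -/

section PointwiseEstimates

/-- Absorption of the lower order terms into the main terms of the Carleman inequality. -/
theorem absorption {P τ ℓ r C C₂ Cv V y z m n e q β : ℝ} (hr : 0 < r) (hℓ : 1 ≤ ℓ)
    (hτ : 1 ≤ τ) (hP : P = τ * r * ℓ) (hP1 : 1 ≤ P) (hC0 : 0 ≤ C) (hC₂ : 0 ≤ C₂)
    (hC : 4 * C ≤ τ) (hK : 4 * (C₂ + C ^ 2 + |Cv|) ≤ τ) (hV : V ^ 2 * r ≤ C₂ * ℓ)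
    (hm : 0 ≤ m) (he : |e| ≤ m * (r * z)) (hn : n ≤ y + z + τ * ℓ * m) (hβ : P ≤ β)
    (hq : τ ^ 2 * ℓ ≤ q) :
    τ ^ 2 * ℓ / 2 * m ^ 2 ≤ y ^ 2 + β * z ^ 2 + q * m ^ 2 - V * e - C * (m * n) - Cv / 2 * m ^ 2 := by
  -- In the application m = |w| and n = |H|, y is the tangential part of H, r z the modulus of the
  -- radial part plus P w, and e the real part of w̄ times the latter. Terms in y use up y², terms
  -- in z use P z² in two halves, and terms in m use two quarters of τ²ℓ m², which leaves the half
  -- in the claim.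
  have hP0 : 0 < P := by linarith
  have h1 : V * e ≤ P / 2 * z ^ 2 + C₂ / 2 * m ^ 2 := by
    have h2 : V * e ≤ |V| * (m * (r * z)) := by
      refine (le_abs_self _).trans ?_
      rw [abs_mul]
      gcongr
    have h3 : |V| ^ 2 * r ^ 2 ≤ C₂ * P := by
      rw [sq_abs]
      calc V ^ 2 * r ^ 2 = V ^ 2 * r * r := by ring
        _ ≤ C₂ * ℓ * r := by gcongr
        _ = C₂ * (1 * r * ℓ) := by ring
        _ ≤ C₂ * (τ * r * ℓ) := by gcongr
        _ = C₂ * P := by rw [hP]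
    have h4 : |V| * (m * (r * z)) * P ≤ (P / 2 * z ^ 2 + C₂ / 2 * m ^ 2) * P := by
      linarith [sq_nonneg (P * z - |V| * r * m), mul_le_mul_of_nonneg_right h3 (sq_nonneg m)]
    exact h2.trans (le_of_mul_le_mul_right h4 hP0)
  have h2 : C * (m * n) ≤ y ^ 2 + C ^ 2 / 4 * m ^ 2 + P / 2 * z ^ 2 + C ^ 2 / 2 * m ^ 2 +
      τ ^ 2 * ℓ / 4 * m ^ 2 := by
    have h3 : C * (m * n) ≤ C * (m * (y + z + τ * ℓ * m)) := by gcongr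
    have h4 : C * m * y ≤ y ^ 2 + C ^ 2 / 4 * m ^ 2 := by linarith [sq_nonneg (y - C * m / 2)]
    have h5 : C * m * z ≤ P / 2 * z ^ 2 + C ^ 2 / 2 * m ^ 2 := by
      linarith [sq_nonneg (z - C * m), mul_le_mul_of_nonneg_right hP1 (sq_nonneg z)]
    have h6 : C * (τ * ℓ) * m ^ 2 ≤ τ ^ 2 * ℓ / 4 * m ^ 2 := by
      have : C * (τ * ℓ) ≤ τ / 4 * (τ * ℓ) := by
        gcongr
        linarith
      linarith [mul_le_mul_of_nonneg_right this (sq_nonneg m)]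
    calc _ ≤ C * (m * (y + z + τ * ℓ * m)) := h3
      _ = C * m * y + C * m * z + C * (τ * ℓ) * m ^ 2 := by ring
      _ ≤ _ := by linarith
  have h3 : β * z ^ 2 ≥ P * z ^ 2 := by gcongr
  have h4 : q * m ^ 2 ≥ τ ^ 2 * ℓ * m ^ 2 := by gcongr
  have h5 : (C₂ / 2 + C ^ 2 / 4 + C ^ 2 / 2 + Cv / 2) * m ^ 2 ≤ τ ^ 2 * ℓ / 4 * m ^ 2 := by
    gcongr
    have : τ * 1 ≤ τ ^ 2 * ℓ := by
      rw [pow_two, mul_assoc]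
      gcongr
      exact one_le_mul_of_one_le_of_one_le hτ hℓ
    linarith [le_abs_self Cv, abs_nonneg Cv, sq_nonneg C]
  linarith

/-- The algebraic identity behind the Carleman inequality. -/
theorem carleman_identity {r E χ χ₁ χ₂ P P₁ P₂ D N X c a V₁ V₂ C Cv mn q q₁ : ℝ} (hr : r ≠ 0)
    (hq : q = P₁ - (2 * P - D + 2) * P) (hq₁ : q₁ = P₂ - (4 * P - D + 2) * P₁) :
    ((χ₁ + (2 * P - D) * χ) * E / r) / r * X +
      ((2 - D) * (χ * E) - (χ₁ + (2 * P - D) * χ) * E) / 2 * N +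
      (D * (χ * E) + (χ₁ + (2 * P - D) * χ) * E) / 2 * V₁ * a - χ * E * V₂ * c -
      C * (χ * E * mn) - Cv / 2 * (χ * E * a) +
    (E * (χ * P + χ₁ / 2) * N +
      (E * ((2 * P - D) * (χ * P + χ₁ / 2) + χ₁ * P + χ * P₁ + χ₂ / 2) / r) / r * c -
      E * (χ * P + χ₁ / 2) * (V₁ + V₂) * a) -
    ((χ₁ * q + χ * ((2 * P - D) * q - 2 * q + q₁)) * E / (2 * r ^ 2) * a +
      D * (χ * E * q / (2 * r ^ 2)) * a + 2 * (χ * E * q / (2 * r ^ 2)) * c) =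
    χ * E * ((r ^ 2 * N - X) / r ^ 2 + (2 * P - D + 1) * ((X + 2 * P * c + P ^ 2 * a) / r ^ 2) +
      (P * (P₁ - P) + (D - 2) * (P - P₁ / 2) + P₁ - P₂ / 2) / r ^ 2 * a - V₂ * (c + P * a) -
      C * mn - Cv / 2 * a) +
    E * (χ₁ * (X + P * c - q / 2 * a) / r ^ 2 + (χ₂ + (2 * P - D) * χ₁) / 2 * c / r ^ 2 -
      χ₁ / 2 * V₂ * a) := by
  -- Subscripts stand for repeated r d/dr, and r E' = (2P - D) E. The virial multiplier is f = χE,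
  -- the energy multiplier g = E(χP + χ₁/2) equals (D f + r f')/2, so that V₁ cancels and the
  -- coefficient of N becomes χE. The divergence multiplier χEq/(2r²) has q chosen so that, apart
  -- from derivatives of χ, the cross term in c completes the square with factor 2P - D + 1.
  subst hq hq₁
  field_simp
  ring

/-- Bound for the terms of the Carleman inequality that contain derivatives of the cutoff. -/
theorem cutoff_error_bound {r ρ τ ℓ χ₁ χ₂ P P₁ D X c m n q V C₂ : ℝ} (hρ : 0 < ρ) (hr : ρ ≤ r)
    (hτ : 1 ≤ τ) (hℓ : 1 ≤ ℓ) (hD : 0 ≤ D) (hP : P = τ * r * ℓ) (hP₁ : P₁ = τ * (r * ℓ + r))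
    (hq : q = P₁ - (2 * P - D + 2) * P) (hX0 : 0 ≤ X) (hX : X ≤ r ^ 2 * n ^ 2)
    (hc : |c| ≤ r * (m * n)) (hC₂ : 0 ≤ C₂) (hV : V ^ 2 * r ≤ C₂ * ℓ) :
    |χ₁ * (X + P * c - q / 2 * m ^ 2) / r ^ 2 + (χ₂ + (2 * P - D) * χ₁) / 2 * c / r ^ 2 -
      χ₁ / 2 * V * m ^ 2| ≤
    (7 + (2 * D + 5 + C₂) * ρ⁻¹) * (|χ₁| + |χ₂|) * (τ ^ 2 * ℓ ^ 2) * (m ^ 2 + n ^ 2) := by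
  have hr0 : 0 < r := hρ.trans_le hr
  set κ := ρ⁻¹ with hκ
  have hκ0 : 0 < κ := inv_pos.2 hρ
  have hrκ : 1 / r ≤ κ := by
    rw [one_div]
    exact inv_anti₀ hρ hr
  -- P = r T and P₁ = r T + τ r: after division by the powers of r each term is at most quadratic in
  -- T, with negative powers of r bounded by those of ρ.
  set T := τ * ℓ with hT
  have hT1 : 1 ≤ T := one_le_mul_of_one_le_of_one_le hτ hℓ
  have hT2 : T ≤ T ^ 2 := le_self_pow₀ hT1 two_ne_zero
  have hτT : τ ≤ T := le_mul_of_one_le_right (by linarith) hℓ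
  have hℓT : ℓ ≤ T := le_mul_of_one_le_left (by linarith) hτ
  set s := m ^ 2 + n ^ 2 with hs
  have hs0 : 0 ≤ s := by positivity
  have hms : m ^ 2 ≤ s := le_add_of_nonneg_right (sq_nonneg n)
  have hPr : P = r * T := by rw [hP]; ring
  have b1 : |X / r ^ 2| ≤ T ^ 2 * s := by
    rw [abs_of_nonneg (by positivity), div_le_iff₀ (by positivity), mul_comm]
    have h1 : n ^ 2 ≤ s := by linarith [sq_nonneg m]
    exact hX.trans (mul_le_mul_of_nonneg_left
      (h1.trans (le_mul_of_one_le_left hs0 (one_le_pow₀ hT1))) (sq_nonneg r))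
  have hcs : |c / r| ≤ s / 2 := by
    rw [abs_div, abs_of_pos hr0, div_le_iff₀ hr0]
    refine hc.trans ?_
    rw [mul_comm r]
    exact mul_le_mul_of_nonneg_right (by linarith [sq_nonneg (m - n)]) hr0.le
  have b2 : |P * c / r ^ 2| ≤ T ^ 2 * s := by
    have e : P * c / r ^ 2 = T * (c / r) := by
      rw [hPr]
      field_simp
    rw [e, abs_mul, abs_of_pos (by linarith)]
    calc T * |c / r| ≤ T ^ 2 * (s / 2) := by gcongr
      _ ≤ T ^ 2 * s := by gcongr; linarith
  have b3 : |q / r ^ 2| ≤ (2 + (D + 4) * κ) * T ^ 2 := by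
    have e : q / r ^ 2 = (1 / r) * (T + τ) - (2 * T + (2 - D) * (1 / r)) * T := by
      rw [hq, hP₁, hPr]
      field_simp
      ring
    have h0 : 0 ≤ 1 / r := by positivity
    rw [e, abs_le]
    have h1 : (1 / r) * (T + τ) ≤ κ * (2 * T ^ 2) := by
      gcongr
      linarith
    have h2 : 0 ≤ (1 / r) * (T + τ) := by positivity
    have h3 : (1 / r) * T ≤ κ * T ^ 2 := by gcongr
    have h4 : 0 ≤ (1 / r) * T := by positivity
    have h5 : D * ((1 / r) * T) ≤ D * (κ * T ^ 2) := by gcongr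
    have h6 : 0 ≤ D * ((1 / r) * T) := by positivity
    have h7 : 0 ≤ D * (κ * T ^ 2) := by positivity
    have h8 : 0 ≤ κ * T ^ 2 := by positivity
    have h9 : 0 ≤ T ^ 2 := by positivity
    constructor <;> linarith
  have b3' : |q / r ^ 2 / 2 * m ^ 2| ≤ (2 + (D + 4) * κ) * T ^ 2 * s := by
    rw [abs_mul, abs_div, abs_two, abs_of_nonneg (sq_nonneg m)]
    calc _ ≤ (2 + (D + 4) * κ) * T ^ 2 / 2 * s := by gcongr
      _ ≤ _ := by
        gcongr
        exact half_le_self (by positivity)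
  have b4 : |(2 * P - D) / 2 * c / r ^ 2| ≤ (1 + D * κ) * T ^ 2 * s := by
    have e : (2 * P - D) / 2 * c / r ^ 2 = (T - D * (1 / r) / 2) * (c / r) := by
      rw [hPr]
      field_simp
    rw [e, abs_mul]
    have h0 : 0 ≤ 1 / r := by positivity
    have h1 : |T - D * (1 / r) / 2| ≤ (1 + D * κ) * T ^ 2 := by
      have h2 : D * (1 / r) ≤ D * (κ * T ^ 2) := by
        gcongr
        exact hrκ.trans (le_mul_of_one_le_right hκ0.le (one_le_pow₀ hT1))
      have h3 : 0 ≤ D * (1 / r) := by positivity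
      have h4 : 0 ≤ D * (κ * T ^ 2) := by positivity
      rw [abs_le]
      constructor <;> linarith
    calc _ ≤ (1 + D * κ) * T ^ 2 * (s / 2) := by gcongr
      _ ≤ _ := by gcongr; linarith
  have b5 : |V / 2 * m ^ 2| ≤ (C₂ * κ + 1) * T ^ 2 * s := by
    have h1 : V ^ 2 ≤ C₂ * κ * T ^ 2 := by
      have h2 : V ^ 2 ≤ C₂ * ℓ * (1 / r) := by
        rw [mul_one_div, le_div_iff₀ hr0]
        exact hV
      calc V ^ 2 ≤ C₂ * ℓ * (1 / r) := h2
        _ ≤ C₂ * T ^ 2 * κ := by gcongr; linarith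
        _ = _ := by ring
    have h2 : |V| / 2 ≤ (C₂ * κ + 1) * T ^ 2 := by
      have : |V| ≤ V ^ 2 + 1 := by
        rw [← sq_abs V]
        linarith [sq_nonneg (|V| - 1), abs_nonneg V]
      have h3 : 1 ≤ T ^ 2 := one_le_pow₀ hT1
      linarith [abs_nonneg V]
    rw [abs_mul, abs_div, abs_two, abs_of_nonneg (sq_nonneg m)]
    gcongr
  have b6 : |c / r ^ 2 / 2| ≤ κ * T ^ 2 * s := by
    have e : c / r ^ 2 / 2 = (1 / r) * (c / r) / 2 := by field_simp
    rw [e, abs_div, abs_mul, abs_two, abs_of_nonneg (by positivity : 0 ≤ 1 / r)]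
    have h1 : (1 / r) * |c / r| ≤ κ * (s / 2) := by gcongr
    have h2 : κ * s ≤ κ * s * T ^ 2 := le_mul_of_one_le_right (by positivity) (one_le_pow₀ hT1)
    linarith [mul_nonneg hκ0.le hs0]
  have e : χ₁ * (X + P * c - q / 2 * m ^ 2) / r ^ 2 + (χ₂ + (2 * P - D) * χ₁) / 2 * c / r ^ 2 -
      χ₁ / 2 * V * m ^ 2 =
      χ₁ * (X / r ^ 2 + P * c / r ^ 2 - q / r ^ 2 / 2 * m ^ 2 + (2 * P - D) / 2 * c / r ^ 2 -
        V / 2 * m ^ 2) + χ₂ * (c / r ^ 2 / 2) := by ring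
  rw [e]
  have t1 : |X / r ^ 2 + P * c / r ^ 2 - q / r ^ 2 / 2 * m ^ 2 + (2 * P - D) / 2 * c / r ^ 2 -
        V / 2 * m ^ 2| ≤ (6 + (2 * D + 4 + C₂) * κ) * T ^ 2 * s := by
    rw [abs_le] at *
    constructor <;> linarith [b1.1, b1.2, b2.1, b2.2, b3'.1, b3'.2, b4.1, b4.2, b5.1, b5.2]
  refine (abs_add_le _ _).trans ?_
  rw [abs_mul, abs_mul]
  have t2 : |χ₁| * |X / r ^ 2 + P * c / r ^ 2 - q / r ^ 2 / 2 * m ^ 2 + (2 * P - D) / 2 * c / r ^ 2 -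
        V / 2 * m ^ 2| ≤ |χ₁| * ((7 + (2 * D + 5 + C₂) * κ) * T ^ 2 * s) := by
    refine mul_le_mul_of_nonneg_left (t1.trans ?_) (abs_nonneg _)
    gcongr <;> linarith
  have t3 : |χ₂| * |c / r ^ 2 / 2| ≤ |χ₂| * ((7 + (2 * D + 5 + C₂) * κ) * T ^ 2 * s) := by
    refine mul_le_mul_of_nonneg_left (b6.trans ?_) (abs_nonneg _)
    gcongr
    linarith [mul_nonneg hD hκ0.le, mul_nonneg hC₂ hκ0.le]
  refine (add_le_add t2 t3).trans_eq ?_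
  rw [hT, mul_pow]
  ring

/-- The pointwise lower bound for the density in the Carleman inequality. -/
theorem carleman_pointwise {r ρ τ ℓ E χ χ₁ χ₂ P P₁ P₂ D X c m n q V C C₂ Cv : ℝ} (hρ : 0 < ρ)
    (hr : ρ ≤ r) (hℓ : 1 ≤ ℓ) (hτ : 1 ≤ τ) (hD : 2 ≤ D) (hE : 0 ≤ E) (hχ : 0 ≤ χ)
    (hP : P = τ * r * ℓ) (hP₁ : P₁ = τ * (r * ℓ + r)) (hP₂ : P₂ = τ * (r * ℓ + 2 * r))
    (hq : q = P₁ - (2 * P - D + 2) * P) (hm : 0 ≤ m) (hX : 0 ≤ X) (hXn : X ≤ r * n)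
    (hc : |c| ≤ m * X) (hC0 : 0 ≤ C) (hC₂ : 0 ≤ C₂) (hτρ : D ≤ τ * ρ) (hC : 4 * C ≤ τ)
    (hK : 4 * (C₂ + C ^ 2 + |Cv|) ≤ τ) (hV : V ^ 2 * r ≤ C₂ * ℓ) :
    χ * E * (τ ^ 2 * ℓ / 2 * m ^ 2) - E * ((7 + (2 * D + 5 + C₂) * ρ⁻¹) * (|χ₁| + |χ₂|) *
      (τ ^ 2 * ℓ ^ 2) * (m ^ 2 + n ^ 2)) ≤
    χ * E * ((r ^ 2 * n ^ 2 - X ^ 2) / r ^ 2 +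
      (2 * P - D + 1) * ((X ^ 2 + 2 * P * c + P ^ 2 * m ^ 2) / r ^ 2) +
      (P * (P₁ - P) + (D - 2) * (P - P₁ / 2) + P₁ - P₂ / 2) / r ^ 2 * m ^ 2 - V * (c + P * m ^ 2) -
      C * (m * n) - Cv / 2 * m ^ 2) +
    E * (χ₁ * (X ^ 2 + P * c - q / 2 * m ^ 2) / r ^ 2 + (χ₂ + (2 * P - D) * χ₁) / 2 * c / r ^ 2 -
      χ₁ / 2 * V * m ^ 2) := by
  have hr0 : 0 < r := hρ.trans_le hr
  have hτ0 : 0 < τ := by linarith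
  have hPD : D ≤ P := by
    rw [hP]
    calc D ≤ τ * ρ := hτρ
      _ ≤ τ * r := by gcongr
      _ ≤ τ * r * ℓ := le_mul_of_one_le_right (by positivity) hℓ
  have hP0 : 0 < P := by linarith
  have hcc := abs_le.1 hc
  have hXX : X ^ 2 ≤ r ^ 2 * n ^ 2 := by
    rw [← mul_pow]
    gcongr
  have hcr : |c| ≤ r * (m * n) := hc.trans (by
    calc m * X ≤ m * (r * n) := by gcongr
      _ = _ := by ring)
  have herr := cutoff_error_bound (χ₁ := χ₁) (χ₂ := χ₂) hρ hr hτ hℓ (by linarith) hP hP₁ hq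
    (sq_nonneg X) hXX hcr hC₂ hV
  -- `Z` is the squared modulus of the radial component plus P w. Knowing only |c| ≤ m X, it is
  -- still at least (X - P m)².
  set Z := X ^ 2 + 2 * P * c + P ^ 2 * m ^ 2 with hZ
  have hZX : (X - P * m) ^ 2 ≤ Z := by linarith [mul_le_mul_of_nonneg_left hcc.1 hP0.le]
  have hZ0 : 0 ≤ Z := (sq_nonneg _).trans hZX
  set z := √Z / r with hz
  set y := √(r ^ 2 * n ^ 2 - X ^ 2) / r with hy
  have hz2 : z ^ 2 = Z / r ^ 2 := by rw [hz, div_pow, Real.sq_sqrt hZ0]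
  have hy2 : y ^ 2 = (r ^ 2 * n ^ 2 - X ^ 2) / r ^ 2 := by
    rw [hy, div_pow, Real.sq_sqrt (by linarith)]
  have hz0 : 0 ≤ z := by positivity
  have hy0 : 0 ≤ y := by positivity
  have he : |c + P * m ^ 2| ≤ m * (r * z) := by
    have e : m * (r * z) = m * √Z := by
      rw [hz]
      field_simp
    rw [e]
    refine abs_le_of_sq_le_sq ?_ (by positivity)
    rw [mul_pow, Real.sq_sqrt hZ0, hZ]
    have : c ^ 2 ≤ m ^ 2 * X ^ 2 := by
      rw [← mul_pow, ← sq_abs c]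
      gcongr
    linarith
  have hn' : n ≤ y + z + τ * ℓ * m := by
    have h1 : X ≤ r * z + P * m := by
      have : X - P * m ≤ √Z := Real.le_sqrt_of_sq_le hZX
      have e : r * z = √Z := by
        rw [hz]
        field_simp
      linarith
    have h2 : r * n ≤ r * y + X := by
      refine abs_le_of_sq_le_sq' ?_ (by positivity) |>.2
      have e : (r * y) ^ 2 = r ^ 2 * n ^ 2 - X ^ 2 := by
        rw [mul_pow, hy2]
        field_simp
      have e2 : (r * y + X) ^ 2 = (r * y) ^ 2 + X ^ 2 + 2 * (r * y * X) := by ring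
      rw [e2, e, mul_pow]
      linarith [mul_nonneg (mul_nonneg hr0.le hy0) hX]
    refine le_of_mul_le_mul_left ?_ hr0
    calc r * n ≤ r * y + (r * z + P * m) := by linarith
      _ = r * (y + z + τ * ℓ * m) := by rw [hP]; ring
  -- The main gain: P₁ - P = τ r because r ℓ' = 1, hence P (P₁ - P) = τ² r² ℓ. A constant ℓ would
  -- give nothing here. The other terms are nonnegative since D ≥ 2 and ℓ ≥ 1.
  have hQ : τ ^ 2 * ℓ ≤ (P * (P₁ - P) + (D - 2) * (P - P₁ / 2) + P₁ - P₂ / 2) / r ^ 2 := by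
    rw [le_div_iff₀ (by positivity), hP, hP₁, hP₂]
    have h1 : 0 ≤ (D - 2) * (τ * r * (ℓ - 1)) :=
      mul_nonneg (by linarith) (mul_nonneg (by positivity) (by linarith))
    have h2 : 0 ≤ τ * r * ℓ := by positivity
    linarith
  have hmain := absorption hr0 hℓ hτ hP (by linarith) hC0 hC₂ hC hK hV hm he hn'
    (show P ≤ 2 * P - D + 1 by linarith) hQ
  rw [hy2, hz2] at hmain
  have h1 := mul_le_mul_of_nonneg_left hmain (mul_nonneg hχ hE)
  have h2 := mul_le_mul_of_nonneg_left (neg_le_of_abs_le herr) hE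
  linarith

end PointwiseEstimates

/-! ### The Carleman weight and the three multipliers -/

section Carleman

theorem continuous_of_continuousOn_Ioi {a : ℝ} {g : ℝ → ℝ} (ha : 0 < a)
    (hg : ContinuousOn g (Set.Ioi 0)) (h0 : ∀ r < a, g r = 0) : Continuous g := by
  refine continuous_iff_continuousAt.2 fun r => ?_
  rcases lt_or_ge r a with h | h
  · have : g =ᶠ[𝓝 r] fun _ => 0 := by
      filter_upwards [Iio_mem_nhds h] with t ht
      exact h0 t ht
    exact continuousAt_const.congr this.symm
  · exact hg.continuousAt (Ioi_mem_nhds (ha.trans_le h))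

theorem IsCutoff.of_contDiffOn {a b : ℝ} {g : ℝ → ℝ} (ha : 0 < a)
    (hg : ContDiffOn ℝ 1 g (Set.Ioi 0)) (h0 : ∀ r, r < a ∨ b < r → g r = 0) : IsCutoff a b g := by
  refine ⟨ha, contDiff_iff_contDiffAt.2 fun r => ?_, h0⟩
  rcases lt_or_ge r a with h | h
  · have : g =ᶠ[𝓝 r] fun _ => 0 := by
      filter_upwards [Iio_mem_nhds h] with t ht
      exact h0 t (Or.inl ht)
    exact contDiffAt_const.congr_of_eventuallyEq this
  · exact hg.contDiffAt (Ioi_mem_nhds (ha.trans_le h))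

/-- The Euler operator `r d/dr`. -/
def euler (f : ℝ → ℝ) (r : ℝ) : ℝ := r * deriv f r

/-- `K + log r`, the derivative of the Carleman phase `r log r + (K - 1) r`. -/
def phaseSlope (K r : ℝ) : ℝ := K + Real.log r

/-- The Carleman phase. -/
def phase (K r : ℝ) : ℝ := r * Real.log r + (K - 1) * r

/-- The Carleman weight `r^{-D} exp (2 τ (r log r + (K - 1) r))`. -/
def weight (τ K D r : ℝ) : ℝ := Real.exp (2 * τ * phase K r - D * Real.log r)

theorem weight_pos (τ K D r : ℝ) : 0 < weight τ K D r := Real.exp_pos _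

theorem hasDerivAt_phaseSlope (K : ℝ) {r : ℝ} (hr : 0 < r) :
    HasDerivAt (phaseSlope K) r⁻¹ r := (Real.hasDerivAt_log hr.ne').const_add K

theorem hasDerivAt_phase (K : ℝ) {r : ℝ} (hr : 0 < r) :
    HasDerivAt (phase K) (phaseSlope K r) r := by
  have h := ((hasDerivAt_id r).mul (Real.hasDerivAt_log hr.ne')).add
    ((hasDerivAt_id r).const_mul (K - 1))
  refine h.congr_deriv ?_
  simp only [id, phaseSlope]
  field_simp
  ring

/-- With P = τ r ℓ this is r E' = (2P - D) E. The factor r^{-D} in the weight is there to cancel the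
divergence D of the field x. -/
theorem hasDerivAt_weight (τ K D : ℝ) {r : ℝ} (hr : 0 < r) :
    HasDerivAt (weight τ K D)
      ((2 * (τ * r * phaseSlope K r) - D) * weight τ K D r / r) r := by
  have h := (((hasDerivAt_phase K hr).const_mul (2 * τ)).sub
    ((Real.hasDerivAt_log hr.ne').const_mul D)).exp
  refine h.congr_deriv ?_
  simp only [weight, Pi.sub_apply]
  field_simp

theorem contDiffOn_phaseSlope (K : ℝ) : ContDiffOn ℝ 1 (phaseSlope K) (Set.Ioi 0) :=
  contDiffOn_const.add (Real.contDiffOn_log.mono fun _ hr => ne_of_gt hr)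

theorem contDiffOn_weight (τ K D : ℝ) : ContDiffOn ℝ 1 (weight τ K D) (Set.Ioi 0) := by
  have hl : ContDiffOn ℝ 1 Real.log (Set.Ioi 0) :=
    Real.contDiffOn_log.mono fun _ hr => ne_of_gt hr
  exact ((contDiffOn_const.mul ((contDiffOn_id.mul hl).add (contDiffOn_const.mul contDiffOn_id))).sub
    (contDiffOn_const.mul hl)).exp

/-- The multiplier of the divergence identity. -/
def phaseCoeff (τ K D r : ℝ) : ℝ :=
  τ * (r * phaseSlope K r + r) - (2 * (τ * r * phaseSlope K r) - D + 2) * (τ * r * phaseSlope K r)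

/-- Each application of r d/dr raises c by one, so c = 0, 1, 2 give the quantities P, P₁, P₂ of
`carleman_identity`. -/
theorem hasDerivAt_scaled (τ K c : ℝ) {r : ℝ} (hr : 0 < r) :
    HasDerivAt (fun r => τ * (r * phaseSlope K r + c * r))
      (τ * (r * phaseSlope K r + (c + 1) * r) / r) r := by
  have h := (((hasDerivAt_id r).mul (hasDerivAt_phaseSlope K hr)).add
    ((hasDerivAt_id r).const_mul c)).const_mul τ
  refine h.congr_deriv ?_
  simp only [id]
  field_simp
  ring

theorem hasDerivAt_phaseCoeff (τ K D : ℝ) {r : ℝ} (hr : 0 < r) :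
    HasDerivAt (phaseCoeff τ K D) ((τ * (r * phaseSlope K r + 2 * r) -
      (4 * (τ * r * phaseSlope K r) - D + 2) * (τ * (r * phaseSlope K r + r))) / r) r := by
  have h0 := hasDerivAt_scaled τ K 0 hr
  have h1 := hasDerivAt_scaled τ K 1 hr
  have h := h1.sub (((h0.const_mul 2).sub_const D |>.add_const 2).mul h0)
  refine (h.congr_of_eventuallyEq (Eventually.of_forall fun t => ?_)).congr_deriv ?_
  · simp only [phaseCoeff, Pi.sub_apply, Pi.mul_apply]
    ring
  · field_simp
    ring

theorem contDiffOn_phaseCoeff (τ K D : ℝ) : ContDiffOn ℝ 1 (phaseCoeff τ K D) (Set.Ioi 0) := by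
  have hp := contDiffOn_phaseSlope K
  have hi : ContDiffOn ℝ 1 (fun r : ℝ => r) (Set.Ioi 0) := contDiffOn_id
  unfold phaseCoeff
  fun_prop

variable {a b : ℝ} {χ : ℝ → ℝ}

theorem IsCutoff.euler (h : IsCutoff a b χ) (h2 : ContDiff ℝ 2 χ) : IsCutoff a b (euler χ) := by
  refine ⟨h.pos, ?_, fun r hr => ?_⟩
  · have : ContDiff ℝ 1 (deriv χ) := by
      have h3 : ContDiff ℝ (1 + 1) χ := by simpa [one_add_one_eq_two] using h2
      exact (contDiff_succ_iff_deriv.1 h3).2.2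
    exact contDiff_id.mul this
  · rw [MagneticSchrodinger.euler, h.deriv_zero hr, mul_zero]

theorem IsCutoff.hasDerivAt_euler (h : IsCutoff a b χ) {r : ℝ} (hr : 0 < r) :
    HasDerivAt χ (MagneticSchrodinger.euler χ r / r) r := by
  refine (h.hasDerivAt r).congr_deriv ?_
  rw [MagneticSchrodinger.euler]
  field_simp

theorem isCutoff_radialMultiplier (τ K D : ℝ) (h : IsCutoff a b χ) :
    IsCutoff a b fun r => χ r * weight τ K D r := by
  refine IsCutoff.of_contDiffOn h.pos (h.contDiff.contDiffOn.mul (contDiffOn_weight τ K D))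
    fun r hr => ?_
  rw [h.zero r hr, zero_mul]

theorem deriv_radialMultiplier (τ K D : ℝ) (h : IsCutoff a b χ) {r : ℝ} (hr : 0 < r) :
    deriv (fun r => χ r * weight τ K D r) r =
      (euler χ r + (2 * (τ * r * phaseSlope K r) - D) * χ r) * weight τ K D r / r := by
  refine ((h.hasDerivAt_euler hr).mul (hasDerivAt_weight τ K D hr)).deriv.trans ?_
  ring

/-- The multiplier of the energy identity. -/
def energyMultiplier (τ K D : ℝ) (χ : ℝ → ℝ) (r : ℝ) : ℝ :=
  weight τ K D r * (χ r * (τ * r * phaseSlope K r) + euler χ r / 2)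

theorem isCutoff_energyMultiplier (τ K D : ℝ) (h : IsCutoff a b χ) (h2 : ContDiff ℝ 2 χ) :
    IsCutoff a b (energyMultiplier τ K D χ) := by
  refine IsCutoff.of_contDiffOn h.pos ?_ fun r hr => ?_
  · have hp := contDiffOn_phaseSlope K
    have hi : ContDiffOn ℝ 1 (fun r : ℝ => r) (Set.Ioi 0) := contDiffOn_id
    have hw := contDiffOn_weight τ K D
    have h1 := (h.euler h2).contDiff.contDiffOn (s := Set.Ioi 0)
    have h0 := h.contDiff.contDiffOn (s := Set.Ioi 0)
    unfold energyMultiplier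
    fun_prop
  · rw [energyMultiplier, h.zero r hr, (h.euler h2).zero r hr]
    ring

theorem deriv_energyMultiplier (τ K D : ℝ) (h : IsCutoff a b χ) (h2 : ContDiff ℝ 2 χ) {r : ℝ}
    (hr : 0 < r) : deriv (energyMultiplier τ K D χ) r =
      weight τ K D r * ((2 * (τ * r * phaseSlope K r) - D) *
        (χ r * (τ * r * phaseSlope K r) + euler χ r / 2) + euler χ r * (τ * r * phaseSlope K r) +
        χ r * (τ * (r * phaseSlope K r + r)) + euler (euler χ) r / 2) / r := by
  have h0 := hasDerivAt_scaled τ K 0 hr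
  have hd := (hasDerivAt_weight τ K D hr).mul (((h.hasDerivAt_euler hr).mul h0).add
    (((h.euler h2).hasDerivAt_euler hr).div_const 2))
  have e : energyMultiplier τ K D χ = weight τ K D *
      ((χ * fun r => τ * (r * phaseSlope K r + 0 * r)) + fun r => euler χ r / 2) := by
    ext t
    simp only [energyMultiplier, Pi.mul_apply, Pi.add_apply]
    ring
  rw [e, hd.deriv]
  simp only [Pi.mul_apply, Pi.add_apply]
  ring

/-- The multiplier of the divergence identity. -/
def divergenceMultiplier (τ K D : ℝ) (χ : ℝ → ℝ) (r : ℝ) : ℝ :=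
  χ r * weight τ K D r * phaseCoeff τ K D r / (2 * r ^ 2)

theorem isCutoff_divergenceMultiplier (τ K D : ℝ) (h : IsCutoff a b χ) :
    IsCutoff a b (divergenceMultiplier τ K D χ) := by
  refine IsCutoff.of_contDiffOn h.pos ?_ fun r hr => ?_
  · exact ((h.contDiff.contDiffOn.mul (contDiffOn_weight τ K D)).mul
      (contDiffOn_phaseCoeff τ K D)).div (contDiffOn_const.mul (contDiffOn_id.pow 2))
      fun r hr => by
        have : 0 < r := hr
        positivity
  · rw [divergenceMultiplier, h.zero r hr]
    ring

theorem deriv_divergenceMultiplier (τ K D : ℝ) (h : IsCutoff a b χ) {r : ℝ} (hr : 0 < r) :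
    deriv (divergenceMultiplier τ K D χ) r =
      (euler χ r * phaseCoeff τ K D r + χ r * ((2 * (τ * r * phaseSlope K r) - D) *
        phaseCoeff τ K D r - 2 * phaseCoeff τ K D r + (τ * (r * phaseSlope K r + 2 * r) -
      (4 * (τ * r * phaseSlope K r) - D + 2) * (τ * (r * phaseSlope K r + r))))) *
        weight τ K D r / (2 * r ^ 2) / r := by
  have hd := (((h.hasDerivAt_euler hr).mul (hasDerivAt_weight τ K D hr)).mul
    (hasDerivAt_phaseCoeff τ K D hr)).div (((hasDerivAt_id r).pow 2).const_mul 2)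
    (by simp only [Pi.pow_apply, id]; positivity)
  have e : divergenceMultiplier τ K D χ =
      (χ * weight τ K D * phaseCoeff τ K D) / fun r => 2 * (id ^ 2 : ℝ → ℝ) r := rfl
  rw [e, hd.deriv]
  simp only [Pi.mul_apply, Pi.pow_apply, id]
  field_simp
  ring

end Carleman

/-! ### The integrated Carleman estimate -/

section CarlemanEstimate

variable {d : ℕ} {S : Set (Space d)} {A : Space d → Space d} {a b ρ R : ℝ} {χ : ℝ → ℝ}
  {w : Space d → ℂ} {H : Space d → EuclideanSpace ℂ (Fin d)}

theorem integrable_radial_mul {g : ℝ → ℝ} {v : Space d → ℝ} (hv : Integrable v volume)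
    (ha : 0 < a) (hg : ContinuousOn g (Set.Ioi 0)) (h0 : ∀ r, r < a ∨ b < r → g r = 0) :
    Integrable (fun x => g ‖x‖ * v x) volume := by
  have hc := continuous_of_continuousOn_Ioi ha hg fun r hr => h0 r (Or.inl hr)
  obtain ⟨M, -, hM⟩ := exists_bound_of_zero_off hc h0
  exact integrable_bdd_mul hv (hc.comp continuous_norm).aestronglyMeasurable
    (Eventually.of_forall fun x => hM _)

theorem abs_corr_le (w : Space d → ℂ) (H : Space d → EuclideanSpace ℂ (Fin d)) (x : Space d) :
    |corr w H x| ≤ ‖w x‖ * ‖radial H x‖ :=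
  (Complex.abs_re_le_norm _).trans (norm_inner_le_norm _ _)

/-- The Carleman estimate. -/
theorem carleman_estimate (hd : 2 ≤ d) (hS : IsSingularCone S) (hA : ContDiffOn ℝ 1 A Sᶜ)
    (hρ : 0 < ρ) (hR : 0 < R) (h : EnergyPair S A ρ R w H) (hρa : ρ ≤ a) {C : ℝ} (hC0 : 0 ≤ C)
    (hC : ∀ x ∉ S, Real.exp (-1) * ρ ≤ ‖x‖ → ‖x‖ * ‖tangentialField A x‖ ≤ C)
    (hχ : IsCutoff a b χ) (hχ2 : ContDiff ℝ 2 χ) (hχ0 : ∀ r, 0 ≤ χ r)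
    {V₁ V₂ : Space d → ℝ} (hV₁ : AEStronglyMeasurable V₁ volume)
    (hV₂ : AEStronglyMeasurable V₂ volume) {M : ℝ} (hM₁ : ∀ x ∉ S, |V₁ x| ≤ M)
    (hM₂ : ∀ x ∉ S, |V₂ x| ≤ M) {Cv : ℝ}
    (hmono : ∀ x ∉ S, ∀ s : ℝ, 0 ≤ s → s ≤ 1 → a ≤ ‖Real.exp s • x‖ → ‖Real.exp s • x‖ ≤ b →
      V₁ x - V₁ (Real.exp s • x) ≤ Cv * s)
    (hweq : ∀ f, IsCutoff a b f → CutoffWeakEquation S A (fun x => V₁ x + V₂ x) f w H)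
    {K C₂ τ : ℝ} (hK : ∀ r, a ≤ r → 1 ≤ phaseSlope K r) (hC₂ : 0 ≤ C₂)
    (hVC : ∀ x ∉ S, a ≤ ‖x‖ → ‖x‖ ≤ b → V₂ x ^ 2 * ‖x‖ ≤ C₂ * phaseSlope K ‖x‖)
    (hτ : 1 ≤ τ) (hτa : d ≤ τ * a) (hτC : 4 * (Real.exp 1 * C) ≤ τ)
    (hτK : 4 * (C₂ + (Real.exp 1 * C) ^ 2 + |Cv|) ≤ τ) :
    Integrable (fun x => χ ‖x‖ * weight τ K d ‖x‖ * phaseSlope K ‖x‖ * ‖w x‖ ^ 2) volume ∧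
    Integrable (fun x => weight τ K d ‖x‖ *
      (|euler χ ‖x‖| + |euler (euler χ) ‖x‖|) * phaseSlope K ‖x‖ ^ 2 * (‖w x‖ ^ 2 + ‖H x‖ ^ 2))
      volume ∧
    ∫ x, χ ‖x‖ * weight τ K d ‖x‖ * phaseSlope K ‖x‖ * ‖w x‖ ^ 2 ≤
    2 * (7 + (2 * d + 5 + C₂) * a⁻¹) * ∫ x, weight τ K d ‖x‖ *
      (|euler χ ‖x‖| + |euler (euler χ) ‖x‖|) * phaseSlope K ‖x‖ ^ 2 *
        (‖w x‖ ^ 2 + ‖H x‖ ^ 2) := by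
  have ha := hχ.pos
  have hχ1 := hχ.euler hχ2
  have hF := isCutoff_radialMultiplier τ K d hχ
  have hg := isCutoff_energyMultiplier τ K d hχ hχ2
  have hk := isCutoff_divergenceMultiplier τ K d hχ
  have hχ2z : ∀ r, r < a ∨ b < r → euler (euler χ) r = 0 := fun r hr => by
    rw [euler, hχ1.deriv_zero hr, mul_zero]
  have cp := (contDiffOn_phaseSlope K).continuousOn
  have cw := (contDiffOn_weight τ K d).continuousOn
  have c0 := hχ.contDiff.continuous.continuousOn (s := Set.Ioi 0)
  have c1 := hχ1.contDiff.continuous.continuousOn (s := Set.Ioi 0)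
  have c2 : ContinuousOn (euler (euler χ)) (Set.Ioi 0) :=
    (continuous_id.mul hχ1.continuous_deriv).continuousOn
  have iL : Integrable (fun x => χ ‖x‖ * weight τ K d ‖x‖ * phaseSlope K ‖x‖ * ‖w x‖ ^ 2)
      volume :=
    integrable_radial_mul (g := fun r => χ r * weight τ K d r * phaseSlope K r) h.integrable_sq ha
      ((c0.mul cw).mul cp) fun r hr => by rw [hχ.zero r hr]; ring
  have iR : Integrable (fun x => weight τ K d ‖x‖ *
      (|euler χ ‖x‖| + |euler (euler χ) ‖x‖|) * phaseSlope K ‖x‖ ^ 2 * (‖w x‖ ^ 2 + ‖H x‖ ^ 2))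
      volume :=
    integrable_radial_mul (g := fun r => weight τ K d r *
      (|euler χ r| + |euler (euler χ) r|) * phaseSlope K r ^ 2)
      (h.integrable_sq.add h.integrable_grad_sq) ha
      ((cw.mul (c1.abs.add c2.abs)).mul (cp.pow 2)) fun r hr => by
        rw [hχ1.zero r hr, hχ2z r hr]; simp
  refine ⟨iL, iR, ?_⟩
  -- The virial inequality, the energy identity and the divergence identity, each with its own
  -- multiplier. Their combined density is bounded below pointwise and has nonpositive integral.
  obtain ⟨j1, k1⟩ := integral_radial_nonpos hS hA hρ hR h hρa hC hF
    (fun r => mul_nonneg (hχ0 r) (weight_pos τ K d r).le) hV₁ hV₂ hM₁ hM₂ hmono (hweq _ hF)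
  obtain ⟨j2, k2⟩ := integral_energy h hg (hV₁.add hV₂) (M := M + M) (by
    filter_upwards [hS.ae_notMem] with x hx
    exact (abs_add_le _ _).trans (add_le_add (hM₁ x hx) (hM₂ x hx))) (hweq _ hg)
  simp only [Pi.add_apply] at j2 k2
  obtain ⟨j3, k3⟩ := integral_divergence hS hA h hk
  have hle := integral_mono_ae ((iL.const_mul (τ ^ 2 / 2)).sub
    (iR.const_mul ((7 + (2 * d + 5 + C₂) * a⁻¹) * τ ^ 2))) ((j1.add j2).sub j3) (by
    filter_upwards [hS.ae_notMem] with x hx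
    simp only [Pi.sub_apply, Pi.add_apply]
    have hr : 0 < ‖x‖ := norm_pos_iff.2 (hS.ne_zero hx)
    set r := ‖x‖ with hrdef
    have e1 := deriv_radialMultiplier τ K d hχ hr
    have e2 := deriv_energyMultiplier τ K d hχ hχ2 hr
    have e3 := deriv_divergenceMultiplier τ K d hχ hr
    have id := carleman_identity (r := r) (E := weight τ K d r) (χ := χ r) (χ₁ := euler χ r)
      (χ₂ := euler (euler χ) r) (P := τ * r * phaseSlope K r)
      (P₁ := τ * (r * phaseSlope K r + r)) (P₂ := τ * (r * phaseSlope K r + 2 * r)) (D := d)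
      (N := ‖H x‖ ^ 2) (X := ‖radial H x‖ ^ 2) (c := corr w H x) (a := ‖w x‖ ^ 2) (V₁ := V₁ x)
      (V₂ := V₂ x) (C := Real.exp 1 * C) (Cv := Cv) (mn := ‖w x‖ * ‖H x‖)
      (q := phaseCoeff τ K d r) hr.ne' rfl rfl
    have e1' : r * deriv (fun r => χ r * weight τ K d r) r =
        (euler χ r + (2 * (τ * r * phaseSlope K r) - d) * χ r) * weight τ K d r := by
      rw [e1]
      field_simp
    have e3' : r * deriv (divergenceMultiplier τ K d χ) r =
        (euler χ r * phaseCoeff τ K d r + χ r * ((2 * (τ * r * phaseSlope K r) - d) *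
        phaseCoeff τ K d r - 2 * phaseCoeff τ K d r + (τ * (r * phaseSlope K r + 2 * r) -
        (4 * (τ * r * phaseSlope K r) - d + 2) * (τ * (r * phaseSlope K r + r))))) *
        weight τ K d r / (2 * r ^ 2) := by
      rw [e3]
      exact mul_div_cancel₀ _ hr.ne'
    have key : τ ^ 2 / 2 * (χ r * weight τ K d r * phaseSlope K r * ‖w x‖ ^ 2) -
        (7 + (2 * d + 5 + C₂) * a⁻¹) * τ ^ 2 * (weight τ K d r *
          (|euler χ r| + |euler (euler χ) r|) * phaseSlope K r ^ 2 * (‖w x‖ ^ 2 + ‖H x‖ ^ 2)) ≤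
        χ r * weight τ K d r * ((r ^ 2 * ‖H x‖ ^ 2 - ‖radial H x‖ ^ 2) / r ^ 2 +
      (2 * (τ * r * phaseSlope K r) - d + 1) * ((‖radial H x‖ ^ 2 +
        2 * (τ * r * phaseSlope K r) * corr w H x + (τ * r * phaseSlope K r) ^ 2 * ‖w x‖ ^ 2) /
        r ^ 2) +
      ((τ * r * phaseSlope K r) * (τ * (r * phaseSlope K r + r) - τ * r * phaseSlope K r) +
        (d - 2) * (τ * r * phaseSlope K r - τ * (r * phaseSlope K r + r) / 2) +
        τ * (r * phaseSlope K r + r) - τ * (r * phaseSlope K r + 2 * r) / 2) / r ^ 2 * ‖w x‖ ^ 2 -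
        V₂ x * (corr w H x + τ * r * phaseSlope K r * ‖w x‖ ^ 2) -
      Real.exp 1 * C * (‖w x‖ * ‖H x‖) - Cv / 2 * ‖w x‖ ^ 2) +
    weight τ K d r * (euler χ r * (‖radial H x‖ ^ 2 + τ * r * phaseSlope K r * corr w H x -
      phaseCoeff τ K d r / 2 * ‖w x‖ ^ 2) / r ^ 2 + (euler (euler χ) r +
      (2 * (τ * r * phaseSlope K r) - d) * euler χ r) / 2 * corr w H x / r ^ 2 -
      euler χ r / 2 * V₂ x * ‖w x‖ ^ 2) := by
      -- ℓ ≥ 1 and the bound on V₂ are known only in the annulus; outside it the cutoff and its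
      -- derivatives make both sides zero.
      by_cases hab : a ≤ r ∧ r ≤ b
      · have hp := carleman_pointwise (n := ‖H x‖) (m := ‖w x‖) (X := ‖radial H x‖)
          (χ₁ := euler χ r) (χ₂ := euler (euler χ) r) (c := corr w H x) (V := V₂ x)
          (C := Real.exp 1 * C) (Cv := Cv) (D := d) (q := phaseCoeff τ K d r) ha hab.1 (hK r hab.1)
          hτ (by exact_mod_cast hd) (weight_pos τ K d r).le (hχ0 r) rfl rfl rfl rfl (norm_nonneg _)
          (norm_nonneg _) (norm_radial_le H x) (abs_corr_le w H x) (by positivity) hC₂ hτa hτC hτK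
          (hVC x hx hab.1 hab.2)
        refine le_trans (le_of_eq ?_) hp
        ring
      · have hr' : r < a ∨ b < r := by
          rw [not_and_or, not_le, not_le] at hab
          exact hab
        rw [hχ.zero r hr', hχ1.zero r hr', hχ2z r hr']
        simp
    refine key.trans (id.symm.le.trans (le_of_eq ?_))
    rw [e1', e3', e1, e2]
    simp only [energyMultiplier, divergenceMultiplier]
    ring)
  simp only [Pi.sub_apply, Pi.add_apply] at hle
  rw [integral_sub (iL.const_mul _) (iR.const_mul _), integral_const_mul, integral_const_mul,
    integral_sub (by exact j1.add j2) j3, integral_add j1 j2, k2, k3] at hle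
  have hτ2 : 0 < τ ^ 2 / 2 := by positivity
  refine le_of_mul_le_mul_left ?_ hτ2
  linarith

end CarlemanEstimate

/-! ### Cutoffs with scale-invariant bounds -/

section CutoffFunctions

theorem deriv_eq_zero_of_eqOn {f : ℝ → ℝ} {U : Set ℝ} (hU : IsOpen U) {c : ℝ}
    (h : ∀ t ∈ U, f t = c) {t : ℝ} (ht : t ∈ U) : deriv f t = 0 := by
  have : f =ᶠ[𝓝 t] fun _ => c := by
    filter_upwards [hU.mem_nhds ht] with y hy
    exact h y hy
  rw [this.deriv_eq]
  exact deriv_const t c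

theorem euler_eq_zero_of_eqOn {f : ℝ → ℝ} {U : Set ℝ} (hU : IsOpen U) {c : ℝ}
    (h : ∀ t ∈ U, f t = c) {t : ℝ} (ht : t ∈ U) : euler f t = 0 ∧ euler (euler f) t = 0 := by
  have h1 : ∀ t ∈ U, euler f t = 0 := fun t ht => by
    rw [euler, deriv_eq_zero_of_eqOn hU h ht, mul_zero]
  refine ⟨h1 t ht, ?_⟩
  rw [euler, deriv_eq_zero_of_eqOn hU h1 ht, mul_zero]

theorem contDiff_euler {f : ℝ → ℝ} (hf : ContDiff ℝ ∞ f) : ContDiff ℝ ∞ (euler f) :=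
  contDiff_id.mul (contDiff_infty_iff_deriv.1 hf).2

theorem euler_mul {f g : ℝ → ℝ} (hf : ContDiff ℝ ∞ f) (hg : ContDiff ℝ ∞ g) :
    euler (fun r => f r * g r) = fun r => euler f r * g r + f r * euler g r := by
  ext r
  have h1 := (hf.differentiable (by simp)).differentiableAt (x := r)
  have h2 := (hg.differentiable (by simp)).differentiableAt (x := r)
  rw [euler, deriv_fun_mul h1 h2, euler, euler]
  ring

theorem euler_add {f g : ℝ → ℝ} (hf : ContDiff ℝ ∞ f) (hg : ContDiff ℝ ∞ g) :
    euler (fun r => f r + g r) = fun r => euler f r + euler g r := by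
  ext r
  have h1 := (hf.differentiable (by simp)).differentiableAt (x := r)
  have h2 := (hg.differentiable (by simp)).differentiableAt (x := r)
  rw [euler, deriv_fun_add h1 h2, euler, euler]
  ring

/-- The operator r d/dr commutes with dilations. This makes the bounds for `annulusCutoff`
independent of both radii, which is needed when R → ∞. -/
theorem euler_comp_div {f : ℝ → ℝ} (hf : ContDiff ℝ ∞ f) (a : ℝ) :
    euler (fun r => f (r / a)) = fun r => euler f (r / a) := by
  ext r
  have h1 := (hf.differentiable (by simp)).differentiableAt (x := r / a) |>.hasDerivAt
  have h2 := h1.comp r ((hasDerivAt_id r).div_const a)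
  have h3 : deriv (fun r => f (r / a)) r = deriv f (r / a) * (1 / a) := h2.deriv
  rw [euler, euler, h3]
  ring

theorem exists_bound_euler {f : ℝ → ℝ} (hf : ContDiff ℝ ∞ f) {c c' : ℝ}
    (h1 : ∀ t < 1, f t = c) (h2 : ∀ t, 2 < t → f t = c') :
    ∃ M, 0 ≤ M ∧ ∀ t, |euler f t| ≤ M ∧ |euler (euler f) t| ≤ M := by
  have hz : ∀ t, t < 1 ∨ 2 < t → euler f t = 0 ∧ euler (euler f) t = 0 := fun t ht =>
    ht.elim (fun h => euler_eq_zero_of_eqOn isOpen_Iio (fun t ht => h1 t ht) h)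
      fun h => euler_eq_zero_of_eqOn isOpen_Ioi (fun t ht => h2 t ht) h
  obtain ⟨M, hM0, hM⟩ := exists_bound_of_zero_off (contDiff_euler hf).continuous
    fun t ht => (hz t ht).1
  obtain ⟨M', -, hM'⟩ := exists_bound_of_zero_off (contDiff_euler (contDiff_euler hf)).continuous
    fun t ht => (hz t ht).2
  exact ⟨max M M', hM0.trans (le_max_left _ _), fun t =>
    ⟨(hM t).trans (le_max_left _ _), (hM' t).trans (le_max_right _ _)⟩⟩

/-- A smooth step from `0` on `t ≤ 1` to `1` on `t ≥ 2`. -/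
def stepUp (t : ℝ) : ℝ := Real.smoothTransition (t - 1)

/-- A smooth step from `1` on `t ≤ 1` to `0` on `t ≥ 2`. -/
def stepDown (t : ℝ) : ℝ := Real.smoothTransition (2 - t)

theorem contDiff_stepUp : ContDiff ℝ ∞ stepUp :=
  Real.smoothTransition.contDiff.comp (contDiff_id.sub contDiff_const)

theorem contDiff_stepDown : ContDiff ℝ ∞ stepDown :=
  Real.smoothTransition.contDiff.comp (contDiff_const.sub contDiff_id)

/-- A smooth cutoff that vanishes off `[a, 2 R]` and is `1` on `[2 a, R]`. -/
def annulusCutoff (a R r : ℝ) : ℝ := stepUp (r / a) * stepDown (r / R)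

variable {a R : ℝ}

theorem contDiff_annulusCutoff (a R : ℝ) : ContDiff ℝ ∞ (annulusCutoff a R) :=
  (contDiff_stepUp.comp (contDiff_id.div_const a)).mul
    (contDiff_stepDown.comp (contDiff_id.div_const R))

theorem annulusCutoff_nonneg (a R r : ℝ) : 0 ≤ annulusCutoff a R r :=
  mul_nonneg (Real.smoothTransition.nonneg _) (Real.smoothTransition.nonneg _)

theorem annulusCutoff_eq_one (ha : 0 < a) (hR : 0 < R) {r : ℝ} (h1 : 2 * a ≤ r) (h2 : r ≤ R) :
    annulusCutoff a R r = 1 := by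
  rw [annulusCutoff, stepUp, stepDown, Real.smoothTransition.one_of_one_le,
    Real.smoothTransition.one_of_one_le, one_mul]
  · rw [le_sub_comm, div_le_iff₀ hR]
    linarith
  · rw [le_sub_iff_add_le, le_div_iff₀ ha]
    linarith

theorem isCutoff_annulusCutoff (ha : 0 < a) (hR : 0 < R) :
    IsCutoff a (2 * R) (annulusCutoff a R) := by
  refine ⟨ha, (contDiff_annulusCutoff a R).of_le (by exact_mod_cast le_top), fun r hr => ?_⟩
  rcases hr with h | h
  · rw [annulusCutoff, stepUp, Real.smoothTransition.zero_of_nonpos, zero_mul]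
    rw [sub_nonpos, div_le_one ha]
    exact h.le
  · rw [annulusCutoff, stepDown, Real.smoothTransition.zero_of_nonpos, mul_zero]
    rw [sub_nonpos, le_div_iff₀ hR]
    exact h.le

theorem euler_annulusCutoff_eq_zero (ha : 0 < a) (hR : 0 < R) {r : ℝ}
    (h : r < a ∨ (2 * a < r ∧ r < R) ∨ 2 * R < r) :
    euler (annulusCutoff a R) r = 0 ∧ euler (euler (annulusCutoff a R)) r = 0 := by
  rcases h with h | h | h
  · exact euler_eq_zero_of_eqOn isOpen_Iio
      (fun t ht => (isCutoff_annulusCutoff ha hR).zero t (Or.inl ht)) h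
  · exact euler_eq_zero_of_eqOn isOpen_Ioo
      (fun t ht => annulusCutoff_eq_one ha hR ht.1.le ht.2.le) h
  · exact euler_eq_zero_of_eqOn isOpen_Ioi
      (fun t ht => (isCutoff_annulusCutoff ha hR).zero t (Or.inr ht)) h

theorem exists_bound_euler_annulusCutoff : ∃ M, 0 ≤ M ∧ ∀ a R r : ℝ,
    |euler (annulusCutoff a R) r| + |euler (euler (annulusCutoff a R)) r| ≤ M := by
  obtain ⟨M₁, hM₁, h1⟩ := exists_bound_euler contDiff_stepUp (c := 0) (c' := 1)
    (fun t ht => Real.smoothTransition.zero_of_nonpos (by linarith))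
    (fun t ht => Real.smoothTransition.one_of_one_le (by linarith))
  obtain ⟨M₂, hM₂, h2⟩ := exists_bound_euler contDiff_stepDown (c := 1) (c' := 0)
    (fun t ht => Real.smoothTransition.one_of_one_le (by linarith))
    (fun t ht => Real.smoothTransition.zero_of_nonpos (by linarith))
  -- The Leibniz rule for one and for two Euler derivatives of a product of steps with values in [0,
  -- 1].
  refine ⟨(M₁ + M₂) + (M₁ + 2 * (M₁ * M₂) + M₂), by positivity, fun a R r => ?_⟩
  have cu : ContDiff ℝ ∞ fun r => stepUp (r / a) :=
    contDiff_stepUp.comp (contDiff_id.div_const a)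
  have cd : ContDiff ℝ ∞ fun r => stepDown (r / R) :=
    contDiff_stepDown.comp (contDiff_id.div_const R)
  have cu1 : ContDiff ℝ ∞ fun r => euler stepUp (r / a) :=
    (contDiff_euler contDiff_stepUp).comp (contDiff_id.div_const a)
  have cd1 : ContDiff ℝ ∞ fun r => euler stepDown (r / R) :=
    (contDiff_euler contDiff_stepDown).comp (contDiff_id.div_const R)
  have e1 : euler (annulusCutoff a R) = fun r =>
      euler stepUp (r / a) * stepDown (r / R) + stepUp (r / a) * euler stepDown (r / R) := by
    have := euler_mul cu cd
    rw [euler_comp_div contDiff_stepUp, euler_comp_div contDiff_stepDown] at this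
    exact this
  have e2 : euler (euler (annulusCutoff a R)) = fun r =>
      (euler (euler stepUp) (r / a) * stepDown (r / R) +
        euler stepUp (r / a) * euler stepDown (r / R)) +
      (euler stepUp (r / a) * euler stepDown (r / R) +
        stepUp (r / a) * euler (euler stepDown) (r / R)) := by
    rw [e1, euler_add (cu1.mul cd) (cu.mul cd1), euler_mul cu1 cd, euler_mul cu cd1,
      euler_comp_div contDiff_stepUp, euler_comp_div contDiff_stepDown,
      euler_comp_div (contDiff_euler contDiff_stepUp),
      euler_comp_div (contDiff_euler contDiff_stepDown)]
  have hu : |stepUp (r / a)| ≤ 1 := by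
    rw [stepUp, abs_of_nonneg (Real.smoothTransition.nonneg _)]
    exact Real.smoothTransition.le_one _
  have hd : |stepDown (r / R)| ≤ 1 := by
    rw [stepDown, abs_of_nonneg (Real.smoothTransition.nonneg _)]
    exact Real.smoothTransition.le_one _
  have mulb : ∀ {x y p q : ℝ}, |x| ≤ p → |y| ≤ q → |x * y| ≤ p * q := fun hx hy => by
    rw [abs_mul]
    exact mul_le_mul hx hy (abs_nonneg _) ((abs_nonneg _).trans hx)
  have a1 := mulb (h1 (r / a)).1 hd
  have a2 := mulb hu (h2 (r / R)).1
  have a3 := mulb (h1 (r / a)).2 hd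
  have a4 := mulb (h1 (r / a)).1 (h2 (r / R)).1
  have a5 := mulb hu (h2 (r / R)).2
  rw [e2, e1]
  beta_reduce
  refine add_le_add ((abs_add_le _ _).trans (by linarith)) ((abs_add_le _ _).trans ?_)
  linarith [abs_add_le (euler (euler stepUp) (r / a) * stepDown (r / R))
    (euler stepUp (r / a) * euler stepDown (r / R)),
    abs_add_le (euler stepUp (r / a) * euler stepDown (r / R))
    (stepUp (r / a) * euler (euler stepDown) (r / R))]

end CutoffFunctions

/-! ### The Carleman estimate for a solution on an annulus -/

section Localization

variable {d : ℕ} {S : Set (Space d)} {A : Space d → Space d} {u : Space d → ℂ}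
  {G : Space d → EuclideanSpace ℂ (Fin d)} {V₁ V₂ : Space d → ℝ}

theorem HasFastDecay.exists_tail (hu : AEStronglyMeasurable u volume)
    (hG : AEStronglyMeasurable G volume) (h : HasFastDecay u G) {m : ℝ} (hm : 0 < m) :
    ∃ C R₁ : ℝ, 0 ≤ C ∧ ∀ R, R₁ ≤ R →
      IntegrableOn (fun x => ‖u x‖ ^ 2 + ‖G x‖ ^ 2) {x | R < ‖x‖} volume ∧
      ∫ x in {x | R < ‖x‖}, (‖u x‖ ^ 2 + ‖G x‖ ^ 2) ≤ C * Real.exp (-m * R * (1 + Real.log R)) := by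
  obtain ⟨C, R₁, hC⟩ := h m hm
  refine ⟨|C|, R₁, abs_nonneg C, fun R hR => ?_⟩
  have hmeas : AEStronglyMeasurable (fun x => ‖u x‖ ^ 2 + ‖G x‖ ^ 2)
      (volume.restrict {x | R < ‖x‖}) := ((hu.norm.pow 2).add (hG.norm.pow 2)).restrict
  have hpos : ∀ x, 0 ≤ ‖u x‖ ^ 2 + ‖G x‖ ^ 2 := fun x => by positivity
  have he : ∀ x, ENNReal.ofReal (‖u x‖ ^ 2 + ‖G x‖ ^ 2) = ‖u x‖ₑ ^ 2 + ‖G x‖ₑ ^ 2 := fun x => by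
    rw [ENNReal.ofReal_add (by positivity) (by positivity), ENNReal.ofReal_pow (norm_nonneg _),
      ENNReal.ofReal_pow (norm_nonneg _), ofReal_norm, ofReal_norm]
  have hle := hC R hR
  simp only [← he] at hle
  have hle' : ENNReal.ofReal (C * Real.exp (-m * R * (1 + Real.log R))) ≤
      ENNReal.ofReal (|C| * Real.exp (-m * R * (1 + Real.log R))) :=
    ENNReal.ofReal_le_ofReal (by gcongr; exact le_abs_self C)
  refine ⟨⟨hmeas, ?_⟩, ?_⟩
  · rw [hasFiniteIntegral_iff_ofReal (Eventually.of_forall hpos)]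
    exact hle.trans_lt ENNReal.ofReal_lt_top
  · rw [integral_eq_lintegral_of_nonneg_ae (Eventually.of_forall hpos) hmeas]
    exact ENNReal.toReal_le_of_le_ofReal (by positivity) (hle.trans hle')

theorem CutoffWeakEquation.congr {W W' : Space d → ℝ} {a b : ℝ} {f : ℝ → ℝ} {w : Space d → ℂ}
    {H : Space d → EuclideanSpace ℂ (Fin d)} (h : CutoffWeakEquation S A W f w H)
    (hf : IsCutoff a b f) (hW : ∀ x, a ≤ ‖x‖ → ‖x‖ ≤ b → W x = W' x) :
    CutoffWeakEquation S A W' f w H := by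
  intro ρ R w' H' hE
  rw [h ρ R w' H' hE]
  congr 1
  ext x
  by_cases hx : a ≤ ‖x‖ ∧ ‖x‖ ≤ b
  · rw [hW x hx.1 hx.2]
  · rw [not_and_or, not_le, not_le] at hx
    rw [hf.zero _ hx]
    simp

/-- The Carleman estimate for a weak solution. -/
theorem IsWeakSolution.carleman (hd : 2 ≤ d) (hS : IsSingularCone S) (hA : ContDiffOn ℝ 1 A Sᶜ)
    (hu : MemLp u 2 volume) (hG : HasMagneticGrad S A u G)
    (hV₁ : AEStronglyMeasurable V₁ volume) (hV₂ : AEStronglyMeasurable V₂ volume)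
    (hb₁ : LocallyBoundedOffOrigin S V₁) (hb₂ : LocallyBoundedOffOrigin S V₂)
    (hsol : IsWeakSolution S A (fun x => V₁ x + V₂ x) u G) {ρ : ℝ} (hρ : 0 < ρ) {C : ℝ}
    (hC0 : 0 ≤ C)
    (hC : ∀ x ∉ S, Real.exp (-1) * (ρ / 4) ≤ ‖x‖ → ‖x‖ * ‖tangentialField A x‖ ≤ C) {Cv : ℝ}
    (hmono : ∀ x ∉ S, Real.exp (-1) * ρ ≤ ‖x‖ → ∀ s : ℝ, 0 ≤ s → s ≤ 1 →
      V₁ x - V₁ (Real.exp s • x) ≤ Cv * s)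
    {K C₂ τ R : ℝ} (hK : ∀ r, ρ ≤ r → 1 ≤ phaseSlope K r) (hC₂ : 0 ≤ C₂)
    (hVC : ∀ x ∉ S, ρ ≤ ‖x‖ → V₂ x ^ 2 * ‖x‖ ≤ C₂ * phaseSlope K ‖x‖)
    (hτ : 1 ≤ τ) (hτa : d ≤ τ * ρ) (hτC : 4 * (Real.exp 1 * C) ≤ τ)
    (hτK : 4 * (C₂ + (Real.exp 1 * C) ^ 2 + |Cv|) ≤ τ) (hR : ρ ≤ R) :
    Integrable (fun x => annulusCutoff ρ R ‖x‖ * weight τ K d ‖x‖ * phaseSlope K ‖x‖ *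
      ‖u x‖ ^ 2) volume ∧
    ∫ x, annulusCutoff ρ R ‖x‖ * weight τ K d ‖x‖ * phaseSlope K ‖x‖ * ‖u x‖ ^ 2 ≤
    2 * (7 + (2 * d + 5 + C₂) * ρ⁻¹) * ∫ x, weight τ K d ‖x‖ *
      (|euler (annulusCutoff ρ R) ‖x‖| + |euler (euler (annulusCutoff ρ R)) ‖x‖|) *
        phaseSlope K ‖x‖ ^ 2 * (‖u x‖ ^ 2 + ‖G x‖ ^ 2) := by
  have hR0 : 0 < R := hρ.trans_le hR
  set χ := annulusCutoff ρ R
  have hχ : IsCutoff ρ (2 * R) χ := isCutoff_annulusCutoff hρ hR0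
  have hχ2 : ContDiff ℝ 2 χ := contDiff_infty.1 (contDiff_annulusCutoff ρ R) 2
  -- This second cutoff is 1 on [ρ/2, 4R], a neighbourhood of the support [ρ, 2R] of χ, so ζ u is a
  -- pair of finite energy that agrees with u, gradient included, where χ lives.
  set ζ := annulusCutoff (ρ / 4) (4 * R)
  have hζ : IsCutoff (ρ / 4) (2 * (4 * R)) ζ := isCutoff_annulusCutoff (by positivity) (by positivity)
  have hE := hG.energyPair hS hA hu hζ
  set w : Space d → ℂ := fun x => (ζ ‖x‖ : ℂ) * u x with hw
  set H : Space d → EuclideanSpace ℂ (Fin d) := fun x =>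
    (ζ ‖x‖ : ℂ) • G x + ((deriv ζ ‖x‖ / ‖x‖ : ℝ) * u x : ℂ) • cvec x with hH
  have heq : ∀ x, ρ ≤ ‖x‖ → ‖x‖ ≤ 2 * R → w x = u x ∧ H x = G x := by
    intro x h1 h2
    have e1 : ζ ‖x‖ = 1 := annulusCutoff_eq_one (by positivity) (by positivity) (by linarith)
      (by linarith)
    have e2 : deriv ζ ‖x‖ = 0 := deriv_eq_zero_of_eqOn (U := Set.Ioo (2 * (ρ / 4)) (4 * R)) isOpen_Ioo
      (fun t ht => annulusCutoff_eq_one (by positivity) (by positivity) ht.1.le ht.2.le)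
      ⟨by linarith, by linarith⟩
    simp only [hw, hH, e1, e2]
    simp
  -- The potentials are truncated to make them bounded. The inner radius is e⁻¹ρ because V₁ is
  -- compared at x and at e^s x, and the latter may lie in the annulus while x does not.
  set Ω : Set (Space d) := {x | Real.exp (-1) * ρ ≤ ‖x‖ ∧ ‖x‖ ≤ 2 * R} with hΩ
  have hΩc : IsCompact Ω := isCompact_annulus _ _
  have hΩ0 : (0 : Space d) ∉ Ω := zero_notMem_annulus (by positivity)
  have he1 : Real.exp (-1) ≤ 1 := Real.exp_le_one_iff.2 (by norm_num)
  have hΩmem : ∀ x : Space d, ρ ≤ ‖x‖ → ‖x‖ ≤ 2 * R → x ∈ Ω := fun x h1 h2 =>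
    ⟨(mul_le_of_le_one_left hρ.le he1).trans h1, h2⟩
  obtain ⟨M₁, hM₁⟩ := hb₁ Ω hΩc hΩ0
  obtain ⟨M₂, hM₂⟩ := hb₂ Ω hΩc hΩ0
  have trunc : ∀ {V : Space d → ℝ} {M : ℝ}, (∀ x ∈ Ω \ S, |V x| ≤ M) →
      M ≤ max |M₁| |M₂| → ∀ x ∉ S, |Ω.indicator V x| ≤ max |M₁| |M₂| := by
    intro V M hM hle x hx
    by_cases h : x ∈ Ω
    · rw [Set.indicator_of_mem h]
      exact (hM x ⟨h, hx⟩).trans hle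
    · rw [Set.indicator_of_notMem h, abs_zero]
      exact (abs_nonneg _).trans (le_max_left _ _)
  have key := carleman_estimate (w := w) (H := H) (V₁ := Ω.indicator V₁) (V₂ := Ω.indicator V₂)
    (Cv := Cv) (K := K) (C₂ := C₂) (τ := τ) hd hS hA
    (show 0 < ρ / 4 by positivity) (show 0 < 2 * (4 * R) by positivity) hE (by linarith) hC0 hC hχ
    hχ2 (annulusCutoff_nonneg ρ R) (hV₁.indicator hΩc.measurableSet)
    (hV₂.indicator hΩc.measurableSet) (M := max |M₁| |M₂|)
    (trunc hM₁ ((le_abs_self _).trans (le_max_left _ _)))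
    (trunc hM₂ ((le_abs_self _).trans (le_max_right _ _)))
    (fun x hx s hs0 hs1 h1 h2 => by
      rw [norm_cutoff_comp] at h1 h2
      have h3 : Real.exp (-1) * ρ ≤ ‖x‖ := by
        rw [Real.exp_neg, inv_mul_le_iff₀ (Real.exp_pos 1)]
        refine h1.trans ?_
        gcongr
      have h4 : ‖x‖ ≤ 2 * R :=
        (le_mul_of_one_le_left (norm_nonneg x) (Real.one_le_exp hs0)).trans h2
      rw [Set.indicator_of_mem (show x ∈ Ω from ⟨h3, h4⟩), Set.indicator_of_mem
        (hΩmem _ (by rwa [norm_cutoff_comp]) (by rwa [norm_cutoff_comp]))]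
      exact hmono x hx h3 s hs0 hs1)
    (fun f hf => ((hsol.cutoffWeakEquation hS hA (hV₁.add hV₂) (fun K hK h0 => by
        obtain ⟨N₁, hN₁⟩ := hb₁ K hK h0
        obtain ⟨N₂, hN₂⟩ := hb₂ K hK h0
        exact ⟨N₁ + N₂, fun x hx => (abs_add_le _ _).trans (add_le_add (hN₁ x hx) (hN₂ x hx))⟩) hu
      (fun K hK h0 => memLp_restrict_of_hasMagneticGrad hS hA hG K hK h0) hf heq).congr hf
      fun x h1 h2 => by
        have := hΩmem x h1 h2
        rw [Set.indicator_of_mem this, Set.indicator_of_mem this]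
        rfl))
    hK hC₂ (fun x hx h1 h2 => by
      rw [Set.indicator_of_mem (hΩmem x h1 h2)]
      exact hVC x hx h1) hτ hτa hτC hτK
  have e1 : (fun x => χ ‖x‖ * weight τ K d ‖x‖ * phaseSlope K ‖x‖ * ‖w x‖ ^ 2) =
      fun x => χ ‖x‖ * weight τ K d ‖x‖ * phaseSlope K ‖x‖ * ‖u x‖ ^ 2 := by
    ext x
    by_cases hx : ρ ≤ ‖x‖ ∧ ‖x‖ ≤ 2 * R
    · rw [(heq x hx.1 hx.2).1]
    · rw [not_and_or, not_le, not_le] at hx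
      rw [hχ.zero _ hx]
      simp
  have e2 : (fun x => weight τ K d ‖x‖ * (|euler χ ‖x‖| + |euler (euler χ) ‖x‖|) *
        phaseSlope K ‖x‖ ^ 2 * (‖w x‖ ^ 2 + ‖H x‖ ^ 2)) =
      fun x => weight τ K d ‖x‖ * (|euler χ ‖x‖| + |euler (euler χ) ‖x‖|) *
        phaseSlope K ‖x‖ ^ 2 * (‖u x‖ ^ 2 + ‖G x‖ ^ 2) := by
    ext x
    by_cases hx : ρ ≤ ‖x‖ ∧ ‖x‖ ≤ 2 * R
    · rw [(heq x hx.1 hx.2).1, (heq x hx.1 hx.2).2]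
    · rw [not_and_or, not_le, not_le] at hx
      have h0 : euler χ ‖x‖ = 0 ∧ euler (euler χ) ‖x‖ = 0 :=
        euler_annulusCutoff_eq_zero hρ hR0 (hx.imp id Or.inr)
      rw [h0.1, h0.2]
      simp
  rw [e1, e2] at key
  exact ⟨key.1, key.2.2⟩

end Localization

/-! ### Letting R and then τ tend to infinity -/

section Vanishing

theorem strictMonoOn_phase {K ρ : ℝ} (hρ : 0 < ρ) (hK : ∀ r, ρ ≤ r → 1 ≤ phaseSlope K r) :
    StrictMonoOn (phase K) (Set.Ici ρ) := by
  refine strictMonoOn_of_deriv_pos (convex_Ici ρ) (fun r hr =>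
    (hasDerivAt_phase K (hρ.trans_le hr)).continuousAt.continuousWithinAt) fun r hr => ?_
  rw [interior_Ici] at hr
  rw [(hasDerivAt_phase K (hρ.trans hr)).deriv]
  exact one_pos.trans_le (hK r (le_of_lt hr))

theorem monotoneOn_phaseSlope {K ρ : ℝ} (hρ : 0 < ρ) : MonotoneOn (phaseSlope K) (Set.Ici ρ) :=
  fun r hr r' _ h => by
    have : 0 < r := hρ.trans_le hr
    unfold phaseSlope
    gcongr

/-- Superexponential decay beats the Carleman weight. -/
theorem tendsto_outer_weight (τ K c : ℝ) {C : ℝ} (hC : 0 ≤ C) :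
    Tendsto (fun R => Real.exp (2 * τ * phase K (2 * R) - c) * phaseSlope K (2 * R) ^ 2 *
      (C * Real.exp (-(8 * τ + 8) * (R / 2) * (1 + Real.log (R / 2))))) atTop (𝓝 0) := by
  -- The phase at 2R contributes 4τ R log R and the decay at R/2 contributes -(4τ + 4) R log R. `B₁`
  -- collects the terms linear in R, `B₂` the constants from the squared slope; -4 R log R dominates
  -- what is left.
  set B₁ := 4 * τ * Real.log 2 + 4 * τ * (K - 1) - (4 * τ + 4) * (1 - Real.log 2) with hB₁
  set B₂ := 2 * (K + Real.log 2) with hB₂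
  have hlim : Tendsto (fun R => C * Real.exp (B₂ - c) * Real.exp (-R)) atTop (𝓝 0) := by
    simpa using (Real.tendsto_exp_atBot.comp tendsto_neg_atTop_atBot).const_mul
      (C * Real.exp (B₂ - c))
  refine squeeze_zero' (Eventually.of_forall fun R => by positivity) ?_ hlim
  filter_upwards [eventually_ge_atTop 1, Real.tendsto_log_atTop.eventually_ge_atTop
    (max ((B₁ + 3) / 4) (-(K + Real.log 2)))] with R hR hlog
  have hR0 : 0 < R := by linarith
  have hl1 := (le_max_left _ _).trans hlog
  have hl2 := (le_max_right _ _).trans hlog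
  have e1 : Real.log (2 * R) = Real.log 2 + Real.log R := Real.log_mul two_ne_zero hR0.ne'
  have e2 : Real.log (R / 2) = Real.log R - Real.log 2 := Real.log_div hR0.ne' two_ne_zero
  have hs0 : 0 ≤ phaseSlope K (2 * R) := by
    rw [phaseSlope, e1]
    linarith
  have hs : phaseSlope K (2 * R) ^ 2 ≤ Real.exp (2 * phaseSlope K (2 * R)) := by
    rw [two_mul (phaseSlope K (2 * R)), Real.exp_add, ← pow_two]
    gcongr
    linarith [Real.add_one_le_exp (phaseSlope K (2 * R))]
  have hexp : 2 * τ * phase K (2 * R) - c + 2 * phaseSlope K (2 * R) +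
      -(8 * τ + 8) * (R / 2) * (1 + Real.log (R / 2)) ≤ B₂ - c + -R := by
    rw [phase, phaseSlope, e1, e2]
    have h1 : Real.log R ≤ R := (Real.log_le_sub_one_of_pos hR0).trans (by linarith)
    have h2 : R * (-4 * Real.log R + B₁ + 3) ≤ 0 :=
      mul_nonpos_of_nonneg_of_nonpos hR0.le (by linarith)
    linarith
  calc _ ≤ Real.exp (2 * τ * phase K (2 * R) - c) * Real.exp (2 * phaseSlope K (2 * R)) *
        (C * Real.exp (-(8 * τ + 8) * (R / 2) * (1 + Real.log (R / 2)))) := by gcongr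
    _ = C * Real.exp (2 * τ * phase K (2 * R) - c + 2 * phaseSlope K (2 * R) +
        -(8 * τ + 8) * (R / 2) * (1 + Real.log (R / 2))) := by
      rw [Real.exp_add, Real.exp_add]
      ring
    _ ≤ C * Real.exp (B₂ - c + -R) := by gcongr
    _ = _ := by
      rw [Real.exp_add]
      ring

variable {d : ℕ} {S : Set (Space d)} {A : Space d → Space d} {u : Space d → ℂ}
  {G : Space d → EuclideanSpace ℂ (Fin d)} {V₁ V₂ : Space d → ℝ}

theorem memLp_annulus_sq (hS : IsSingularCone S) (hA : ContDiffOn ℝ 1 A Sᶜ)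
    (hu : MemLp u 2 volume) (hG : HasMagneticGrad S A u G) {a b : ℝ} (ha : 0 < a) :
    IntegrableOn (fun x => ‖u x‖ ^ 2 + ‖G x‖ ^ 2) {x | a ≤ ‖x‖ ∧ ‖x‖ ≤ b} volume :=
  (hu.restrict _).norm.integrable_sq.add (memLp_restrict_of_hasMagneticGrad hS hA hG _
    (isCompact_annulus a b) (zero_notMem_annulus ha)).norm.integrable_sq

/-- The Carleman estimate, with the terms at infinity removed by the decay of the solution. -/
theorem IsWeakSolution.integral_annulus_le (hd : 2 ≤ d) (hS : IsSingularCone S)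
    (hA : ContDiffOn ℝ 1 A Sᶜ)
    (hu : MemLp u 2 volume) (hG : HasMagneticGrad S A u G) (hdecay : HasFastDecay u G)
    (hV₁ : AEStronglyMeasurable V₁ volume) (hV₂ : AEStronglyMeasurable V₂ volume)
    (hb₁ : LocallyBoundedOffOrigin S V₁) (hb₂ : LocallyBoundedOffOrigin S V₂)
    (hsol : IsWeakSolution S A (fun x => V₁ x + V₂ x) u G) {ρ : ℝ} (hρ : 0 < ρ) {C : ℝ}
    (hC0 : 0 ≤ C)
    (hC : ∀ x ∉ S, Real.exp (-1) * (ρ / 4) ≤ ‖x‖ → ‖x‖ * ‖tangentialField A x‖ ≤ C) {Cv : ℝ}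
    (hmono : ∀ x ∉ S, Real.exp (-1) * ρ ≤ ‖x‖ → ∀ s : ℝ, 0 ≤ s → s ≤ 1 →
      V₁ x - V₁ (Real.exp s • x) ≤ Cv * s)
    {K C₂ : ℝ} (hK : ∀ r, ρ ≤ r → 1 ≤ phaseSlope K r) (hC₂ : 0 ≤ C₂)
    (hVC : ∀ x ∉ S, ρ ≤ ‖x‖ → V₂ x ^ 2 * ‖x‖ ≤ C₂ * phaseSlope K ‖x‖) {L : ℝ} (hL : 3 * ρ ≤ L) :
    ∃ B τ₀ : ℝ, ∀ τ, τ₀ ≤ τ → Real.exp (2 * τ * phase K (3 * ρ)) *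
      (∫ x in {x : Space d | 3 * ρ ≤ ‖x‖ ∧ ‖x‖ ≤ L}, ‖u x‖ ^ 2) ≤
      B * Real.exp (2 * τ * phase K (2 * ρ)) := by
  obtain ⟨M, hM0, hM⟩ := exists_bound_euler_annulusCutoff
  have hmonoφ := (strictMonoOn_phase hρ hK).monotoneOn
  have hmonoℓ := monotoneOn_phaseSlope (K := K) hρ
  have hL0 : 0 < L := by linarith
  set v : Space d → ℝ := fun x => ‖u x‖ ^ 2 + ‖G x‖ ^ 2 with hv
  have hv0 : ∀ x, 0 ≤ v x := fun x => by positivity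
  set Ω₁ : Set (Space d) := {x | 3 * ρ ≤ ‖x‖ ∧ ‖x‖ ≤ L} with hΩ₁
  set Ω₂ : Set (Space d) := {x | ρ ≤ ‖x‖ ∧ ‖x‖ ≤ 2 * ρ} with hΩ₂
  have mΩ₁ : MeasurableSet Ω₁ := (isCompact_annulus _ _).measurableSet
  have mΩ₂ : MeasurableSet Ω₂ := (isCompact_annulus _ _).measurableSet
  set Q := 2 * (7 + (2 * d + 5 + C₂) * ρ⁻¹) with hQ
  have hQ0 : 0 ≤ Q := by positivity
  have iΩ₂ : IntegrableOn v Ω₂ volume := memLp_annulus_sq hS hA hu hG hρ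
  -- No τ occurs in this constant: the powers r^{±d} and the slopes are fixed, and τ survives only
  -- in the two exponentials.
  refine ⟨Real.exp (d * Real.log L) *
    (Q * (Real.exp (-(d * Real.log ρ)) * M * phaseSlope K (2 * ρ) ^ 2 * ∫ x in Ω₂, v x)),
    max (max 1 (d / ρ)) (max (4 * (Real.exp 1 * C)) (4 * (C₂ + (Real.exp 1 * C) ^ 2 + |Cv|))),
    fun τ hτ => ?_⟩
  have h1 : 1 ≤ τ := (le_max_left _ _).trans ((le_max_left _ _).trans hτ)
  have h2 : d ≤ τ * ρ := by
    rw [← div_le_iff₀ hρ]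
    exact (le_max_right _ _).trans ((le_max_left _ _).trans hτ)
  have h3 : 4 * (Real.exp 1 * C) ≤ τ := (le_max_left _ _).trans ((le_max_right _ _).trans hτ)
  have h4 : 4 * (C₂ + (Real.exp 1 * C) ^ 2 + |Cv|) ≤ τ :=
    (le_max_right _ _).trans ((le_max_right _ _).trans hτ)
  have hτ0 : 0 < τ := by linarith
  -- The decay rate has to grow with τ, which is why decay is assumed for every m.
  obtain ⟨C', R₁, hC'0, htail⟩ := hdecay.exists_tail hu.1 hG.2.1 (m := 8 * τ + 8) (by positivity)
  have hlim := (((tendsto_outer_weight τ K (d * Real.log ρ) hC'0).const_mul M).const_add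
    (Real.exp (2 * τ * phase K (2 * ρ) - d * Real.log ρ) * M * phaseSlope K (2 * ρ) ^ 2 *
      ∫ x in Ω₂, v x)).const_mul Q
  rw [mul_zero, add_zero] at hlim
  have hmain : Real.exp (2 * τ * phase K (3 * ρ) - d * Real.log L) * (∫ x in Ω₁, ‖u x‖ ^ 2) ≤
      Q * (Real.exp (2 * τ * phase K (2 * ρ) - d * Real.log ρ) * M * phaseSlope K (2 * ρ) ^ 2 *
      ∫ x in Ω₂, v x) := by
    refine ge_of_tendsto hlim ?_
    filter_upwards [eventually_ge_atTop L, eventually_ge_atTop (2 * R₁)] with R hRL hR₁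
    have hRρ : 3 * ρ ≤ R := hL.trans hRL
    have hR0 : 0 < R := by linarith
    obtain ⟨j1, j2⟩ := hsol.carleman hd hS hA hu hG hV₁ hV₂ hb₁ hb₂ hρ hC0 hC hmono hK hC₂ hVC h1
      h2 h3 h4 (R := R) (by linarith)
    obtain ⟨it, ht⟩ := htail (R / 2) (by linarith)
    -- The tail set is open and the outer transition annulus contains ‖x‖ = R, so the tail is taken
    -- from R/2.
    set Ω₃ : Set (Space d) := {x | R / 2 < ‖x‖} with hΩ₃
    have mΩ₃ : MeasurableSet Ω₃ := measurableSet_lt measurable_const measurable_norm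
    have hlow : Real.exp (2 * τ * phase K (3 * ρ) - d * Real.log L) * (∫ x in Ω₁, ‖u x‖ ^ 2) ≤
        ∫ x, annulusCutoff ρ R ‖x‖ * weight τ K d ‖x‖ * phaseSlope K ‖x‖ * ‖u x‖ ^ 2 := by
      rw [← integral_const_mul, ← integral_indicator mΩ₁]
      refine integral_mono (IntegrableOn.integrable_indicator
        (hu.norm.integrable_sq.integrableOn.const_mul _) mΩ₁) j1 fun x => ?_
      by_cases hx : x ∈ Ω₁
      · rw [Set.indicator_of_mem hx]
        have hx0 : 0 < ‖x‖ := by linarith [hx.1]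
        have e1 : annulusCutoff ρ R ‖x‖ = 1 :=
          annulusCutoff_eq_one hρ hR0 (by linarith [hx.1]) (hx.2.trans hRL)
        have e2 : Real.exp (2 * τ * phase K (3 * ρ) - d * Real.log L) ≤ weight τ K d ‖x‖ := by
          refine Real.exp_le_exp.2 (sub_le_sub ?_ ?_)
          · gcongr
            exact hmonoφ (show ρ ≤ 3 * ρ by linarith) (show ρ ≤ ‖x‖ by linarith [hx.1]) hx.1
          · gcongr
            exact hx.2
        have e3 := hK ‖x‖ (by linarith [hx.1])
        beta_reduce
        rw [e1, one_mul]
        gcongr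
        exact e2.trans (le_mul_of_one_le_right (weight_pos _ _ _ _).le e3)
      · rw [Set.indicator_of_notMem hx]
        rcases lt_or_ge ‖x‖ ρ with h | h
        · beta_reduce
          rw [(isCutoff_annulusCutoff hρ hR0).zero _ (Or.inl h)]
          simp
        · exact mul_nonneg (mul_nonneg (mul_nonneg (annulusCutoff_nonneg _ _ _)
            (weight_pos _ _ _ _).le) (zero_le_one.trans (hK _ h))) (sq_nonneg _)
    have hup : ∫ x, weight τ K d ‖x‖ *
        (|euler (annulusCutoff ρ R) ‖x‖| + |euler (euler (annulusCutoff ρ R)) ‖x‖|) *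
        phaseSlope K ‖x‖ ^ 2 * v x ≤
        Real.exp (2 * τ * phase K (2 * ρ) - d * Real.log ρ) * M * phaseSlope K (2 * ρ) ^ 2 *
        (∫ x in Ω₂, v x) + Real.exp (2 * τ * phase K (2 * R) - d * Real.log ρ) * M *
          phaseSlope K (2 * R) ^ 2 * ∫ x in Ω₃, v x := by
      rw [← integral_const_mul, ← integral_const_mul, ← integral_indicator mΩ₂,
        ← integral_indicator mΩ₃, ← integral_add (IntegrableOn.integrable_indicator (iΩ₂.const_mul _) mΩ₂)
        (IntegrableOn.integrable_indicator (it.const_mul _) mΩ₃)]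
      refine integral_mono_of_nonneg (Eventually.of_forall fun x => ?_)
        ((IntegrableOn.integrable_indicator (iΩ₂.const_mul _) mΩ₂).add
        (IntegrableOn.integrable_indicator (it.const_mul _) mΩ₃)) (Eventually.of_forall fun x => ?_)
      · have := weight_pos τ K d ‖x‖
        have := hv0 x
        simp only [Pi.zero_apply]
        positivity
      · have bound : ∀ r', ρ ≤ ‖x‖ → ‖x‖ ≤ r' → weight τ K d ‖x‖ *
            (|euler (annulusCutoff ρ R) ‖x‖| + |euler (euler (annulusCutoff ρ R)) ‖x‖|) *
            phaseSlope K ‖x‖ ^ 2 * v x ≤ Real.exp (2 * τ * phase K r' - d * Real.log ρ) * M *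
            phaseSlope K r' ^ 2 * v x := by
          intro r' hr hr'
          have e1 : weight τ K d ‖x‖ ≤ Real.exp (2 * τ * phase K r' - d * Real.log ρ) := by
            refine Real.exp_le_exp.2 (sub_le_sub ?_ ?_)
            · gcongr
              exact hmonoφ hr (hr.trans hr') hr'
            · gcongr
          have e2 := hmonoℓ hr (hr.trans hr') hr'
          have e3 := zero_le_one.trans (hK _ hr)
          have e4 := hv0 x
          have e5 := hM ρ R ‖x‖
          have e6 := weight_pos τ K d ‖x‖
          gcongr
        have n2 : 0 ≤ Ω₂.indicator (fun x => Real.exp (2 * τ * phase K (2 * ρ) - d * Real.log ρ) *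
            M * phaseSlope K (2 * ρ) ^ 2 * v x) x :=
          Set.indicator_nonneg (fun x _ => mul_nonneg (by positivity) (hv0 x)) x
        have n3 : 0 ≤ Ω₃.indicator (fun x => Real.exp (2 * τ * phase K (2 * R) - d * Real.log ρ) *
            M * phaseSlope K (2 * R) ^ 2 * v x) x :=
          Set.indicator_nonneg (fun x _ => mul_nonneg (by positivity) (hv0 x)) x
        have zero : (‖x‖ < ρ ∨ (2 * ρ < ‖x‖ ∧ ‖x‖ < R) ∨ 2 * R < ‖x‖) → weight τ K d ‖x‖ *
            (|euler (annulusCutoff ρ R) ‖x‖| + |euler (euler (annulusCutoff ρ R)) ‖x‖|) *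
            phaseSlope K ‖x‖ ^ 2 * v x = 0 := fun h => by
          obtain ⟨z1, z2⟩ := euler_annulusCutoff_eq_zero hρ hR0 h
          rw [z1, z2]
          simp
        beta_reduce
        rcases lt_or_ge ‖x‖ ρ with c1 | c1
        · rw [zero (Or.inl c1)]
          exact add_nonneg n2 n3
        rcases le_or_gt ‖x‖ (2 * ρ) with c2 | c2
        · refine le_add_of_le_of_nonneg ?_ n3
          rw [Set.indicator_of_mem (show x ∈ Ω₂ from ⟨c1, c2⟩)]
          exact bound _ c1 c2
        rcases lt_or_ge ‖x‖ R with c3 | c3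
        · rw [zero (Or.inr (Or.inl ⟨c2, c3⟩))]
          exact add_nonneg n2 n3
        rcases le_or_gt ‖x‖ (2 * R) with c4 | c4
        · refine le_add_of_nonneg_of_le n2 ?_
          rw [Set.indicator_of_mem (show x ∈ Ω₃ from (by linarith : R / 2 < ‖x‖))]
          exact bound _ c1 c4
        · rw [zero (Or.inr (Or.inr c4))]
          exact add_nonneg n2 n3
    refine hlow.trans (j2.trans (mul_le_mul_of_nonneg_left (hup.trans ?_) hQ0))
    refine add_le_add le_rfl ?_
    calc _ ≤ Real.exp (2 * τ * phase K (2 * R) - d * Real.log ρ) * M * phaseSlope K (2 * R) ^ 2 *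
          (C' * Real.exp (-(8 * τ + 8) * (R / 2) * (1 + Real.log (R / 2)))) := by gcongr
      _ = _ := by ring
  rw [Real.exp_sub, sub_eq_add_neg (2 * τ * phase K (2 * ρ)), Real.exp_add, div_mul_eq_mul_div,
    div_le_iff₀ (Real.exp_pos _)] at hmain
  refine hmain.trans (le_of_eq ?_)
  ring

/-- Unique continuation from infinity under abstract conditions on the potentials. -/
theorem IsWeakSolution.ae_eq_zero (hd : 2 ≤ d) (hS : IsSingularCone S)
    (hA : ContDiffOn ℝ 1 A Sᶜ)
    (hu : MemLp u 2 volume) (hG : HasMagneticGrad S A u G) (hdecay : HasFastDecay u G)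
    (hV₁ : AEStronglyMeasurable V₁ volume) (hV₂ : AEStronglyMeasurable V₂ volume)
    (hb₁ : LocallyBoundedOffOrigin S V₁) (hb₂ : LocallyBoundedOffOrigin S V₂)
    (hsol : IsWeakSolution S A (fun x => V₁ x + V₂ x) u G)
    (hC : ∀ ρ > 0, ∃ C, ∀ x ∉ S, ρ ≤ ‖x‖ → ‖x‖ * ‖tangentialField A x‖ ≤ C)
    (hmono : ∀ ρ > 0, ∃ Cv, ∀ x ∉ S, ρ ≤ ‖x‖ → ∀ s : ℝ, 0 ≤ s → s ≤ 1 →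
      V₁ x - V₁ (Real.exp s • x) ≤ Cv * s)
    (hVC : ∀ ρ > 0, ∃ K C₂, 1 ≤ phaseSlope K ρ ∧ ∀ x ∉ S, ρ ≤ ‖x‖ →
      V₂ x ^ 2 * ‖x‖ ≤ C₂ * phaseSlope K ‖x‖) : ∀ᵐ x, u x = 0 := by
  have key : ∀ ρ > 0, ∀ L, 3 * ρ ≤ L → ∀ᵐ x, 3 * ρ ≤ ‖x‖ ∧ ‖x‖ ≤ L → u x = 0 := by
    intro ρ hρ L hL
    obtain ⟨C, hC⟩ := hC (Real.exp (-1) * (ρ / 4)) (by positivity)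
    obtain ⟨Cv, hmono⟩ := hmono (Real.exp (-1) * ρ) (by positivity)
    obtain ⟨K, C₂, hK, hVC⟩ := hVC ρ hρ
    have hK' : ∀ r, ρ ≤ r → 1 ≤ phaseSlope K r := fun r hr =>
      hK.trans (monotoneOn_phaseSlope hρ (le_refl ρ) hr hr)
    obtain ⟨B, τ₀, hB⟩ := hsol.integral_annulus_le hd hS hA hu hG hdecay hV₁ hV₂ hb₁ hb₂ hρ
      (abs_nonneg C) (fun x hx h => (hC x hx h).trans (le_abs_self C)) hmono hK' (abs_nonneg C₂)
      (fun x hx h => (hVC x hx h).trans (by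
        have := zero_le_one.trans (hK' _ h)
        gcongr
        exact le_abs_self C₂)) hL
    set J := ∫ x in {x : Space d | 3 * ρ ≤ ‖x‖ ∧ ‖x‖ ≤ L}, ‖u x‖ ^ 2 with hJ
    -- The gap left between 2ρ and 3ρ gives the factor e^{-2δτ} that forces the mass to vanish.
    have hδ : 0 < phase K (3 * ρ) - phase K (2 * ρ) :=
      sub_pos.2 (strictMonoOn_phase hρ hK' (show ρ ≤ 2 * ρ by linarith)
        (show ρ ≤ 3 * ρ by linarith) (by linarith))
    set δ := phase K (3 * ρ) - phase K (2 * ρ)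
    have hlim : Tendsto (fun τ : ℝ => B * Real.exp (-(2 * δ * τ))) atTop (𝓝 0) := by
      have h1 : Tendsto (fun τ : ℝ => 2 * δ * τ) atTop atTop :=
        tendsto_id.const_mul_atTop (by positivity)
      simpa using (Real.tendsto_exp_atBot.comp (tendsto_neg_atTop_atBot.comp h1)).const_mul B
    have hJ0 : J ≤ 0 := by
      refine ge_of_tendsto hlim ?_
      filter_upwards [eventually_ge_atTop τ₀] with τ hτ
      have h1 := hB τ hτ
      have e : Real.exp (2 * τ * phase K (2 * ρ)) =
          Real.exp (2 * τ * phase K (3 * ρ)) * Real.exp (-(2 * δ * τ)) := by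
        rw [← Real.exp_add]
        congr 1
        ring
      rw [e] at h1
      refine le_of_mul_le_mul_left ?_ (Real.exp_pos (2 * τ * phase K (3 * ρ)))
      linarith
    have hJ1 : J = 0 := le_antisymm hJ0 (integral_nonneg fun x => sq_nonneg _)
    rw [hJ, setIntegral_eq_zero_iff_of_nonneg_ae (Eventually.of_forall fun x => sq_nonneg _)
      hu.norm.integrable_sq.integrableOn] at hJ1
    have hm := (isCompact_annulus (d := d) (3 * ρ) L).measurableSet
    filter_upwards [(ae_restrict_iff' hm).1 hJ1] with x hx h
    simpa using hx h
  -- Countably many annuli, with ρ = 1/(n+1) and L = 3(n+1), exhaust the space without the origin.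
  have h1 : ∀ n : ℕ, ∀ᵐ x : Space d, 3 * (1 / ((n : ℝ) + 1)) ≤ ‖x‖ ∧ ‖x‖ ≤ 3 * ((n : ℝ) + 1) →
      u x = 0 := fun n => by
    have : 1 / ((n : ℝ) + 1) ≤ (n : ℝ) + 1 := by
      have : (0 : ℝ) ≤ n := Nat.cast_nonneg n
      rw [div_le_iff₀ (by positivity)]
      nlinarith
    exact key _ Nat.one_div_pos_of_nat _ (by linarith)
  filter_upwards [ae_all_iff.2 h1, hS.ae_notMem] with x hx hxS
  have hx0 : 0 < ‖x‖ := norm_pos_iff.2 (hS.ne_zero hxS)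
  obtain ⟨n₁, hn₁⟩ := exists_nat_one_div_lt (show 0 < ‖x‖ / 3 by positivity)
  obtain ⟨n₂, hn₂⟩ := exists_nat_gt ‖x‖
  refine hx (max n₁ n₂) ⟨?_, ?_⟩
  · have h2 : 1 / (((max n₁ n₂ : ℕ) : ℝ) + 1) ≤ 1 / ((n₁ : ℝ) + 1) := by
      gcongr
      exact le_max_left _ _
    linarith
  · have h2 : (n₂ : ℝ) ≤ ((max n₁ n₂ : ℕ) : ℝ) := by exact_mod_cast le_max_right _ _
    linarith [(Nat.cast_nonneg n₂ : (0 : ℝ) ≤ n₂)]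

end Vanishing

/-! ### From the assumptions to the bounds used in the Carleman estimate -/

section Hypotheses

variable {d : ℕ} {S : Set (Space d)} {A : Space d → Space d} {V : Space d → ℝ} {r₀ : ℝ}

/-- Away from the origin both zones give decay of order 1/r, the form in which the field and the
radial derivative enter; the constants are then absorbed by large τ. -/
theorem TwoZoneBound.exists_mul_le {F : Space d → ℝ} {f g : ℝ → ℝ} (h : TwoZoneBound S r₀ F f g)
    (hf : ∀ ρ > 0, ∃ C, ∀ r, ρ ≤ r → r * f r ≤ C) (hg : ∃ C, ∀ r, r₀ < r → r * g r ≤ C) :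
    ∀ ρ > 0, ∃ C, ∀ x ∉ S, ρ ≤ ‖x‖ → ‖x‖ * F x ≤ C := by
  intro ρ hρ
  obtain ⟨C₁, h1⟩ := hf ρ hρ
  obtain ⟨C₂, h2⟩ := hg
  refine ⟨max C₁ C₂, fun x hx hxρ => (mul_le_mul_of_nonneg_left (h x hx) (norm_nonneg x)).trans ?_⟩
  split_ifs with hr
  · exact (h1 _ hxρ).trans (le_max_left _ _)
  · exact (h2 _ (not_le.1 hr)).trans (le_max_right _ _)

theorem exists_mul_div_pow_le (ν : ℝ) (k : ℕ) :
    ∀ ρ > 0, ∃ C, ∀ r : ℝ, ρ ≤ r → r * (ν / r ^ (k + 1)) ≤ C := by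
  refine fun ρ hρ => ⟨|ν| / ρ ^ k, fun r hr => ?_⟩
  have hr0 : 0 < r := hρ.trans_le hr
  have e : r * (ν / r ^ (k + 1)) = ν / r ^ k := by
    field_simp
    ring
  rw [e]
  exact (div_le_div_of_nonneg_right (le_abs_self ν) (by positivity)).trans (by gcongr)

theorem exists_mul_div_le (hr₀ : 1 ≤ r₀) (ν : ℝ) : ∃ C, ∀ r : ℝ, r₀ < r → r * (ν / r) ≤ C :=
  ⟨ν, fun r hr => by
    have : r ≠ 0 := by linarith
    rw [mul_div_cancel₀ _ this]⟩

theorem exists_mul_div_rpow_le (hr₀ : 1 ≤ r₀) {c μ : ℝ} (hc : 0 < c) (hμ : 0 < μ) :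
    ∃ C, ∀ r : ℝ, r₀ < r → r * (c / r ^ (1 + μ)) ≤ C :=
  ⟨c, fun r hr => by
    have hr1 : 1 ≤ r := by linarith
    have h1 : r ≤ r ^ (1 + μ) := Real.self_le_rpow_of_one_le hr1 (by linarith)
    have h2 : 0 < r ^ (1 + μ) := by positivity
    rw [mul_div_assoc', div_le_iff₀ h2, mul_comm]
    gcongr⟩

theorem AssumptionOne.exists_bounds (hr₀ : 1 ≤ r₀) (h : AssumptionOne S r₀ A V) :
    (∀ ρ > 0, ∃ C, ∀ x ∉ S, ρ ≤ ‖x‖ → ‖x‖ * ‖tangentialField A x‖ ≤ C) ∧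
    ∀ ρ > 0, ∃ C, ∀ x ∉ S, ρ ≤ ‖x‖ → ‖x‖ * (radialDeriv V x)⁻ ≤ C := by
  obtain ⟨ν₁, ν₂, μ₁, μ₂, h1, h2, -, -⟩ := h
  exact ⟨h1.exists_mul_le (exists_mul_div_pow_le ν₁ 1) (exists_mul_div_le hr₀ ν₂),
    h2.exists_mul_le (exists_mul_div_pow_le μ₁ 2) (exists_mul_div_le hr₀ μ₂)⟩

theorem AssumptionTwo.exists_bounds (hr₀ : 1 ≤ r₀) (h : AssumptionTwo S r₀ A V) :
    (∀ ρ > 0, ∃ C, ∀ x ∉ S, ρ ≤ ‖x‖ → ‖x‖ * ‖tangentialField A x‖ ≤ C) ∧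
    ∀ ρ > 0, ∃ C, ∀ x ∉ S, ρ ≤ ‖x‖ → ‖x‖ * (radialDeriv V x)⁻ ≤ C := by
  obtain ⟨ν₁, μ₁, c, μ, hc, hμ, h1, h2, -⟩ := h
  exact ⟨h1.exists_mul_le (exists_mul_div_pow_le ν₁ 1) (exists_mul_div_rpow_le hr₀ hc hμ),
    h2.exists_mul_le (exists_mul_div_pow_le μ₁ 2) (exists_mul_div_rpow_le hr₀ hc hμ)⟩

theorem FieldAssumptionOne.exists_bound (hr₀ : 1 ≤ r₀) (h : FieldAssumptionOne S r₀ A) :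
    ∀ ρ > 0, ∃ C, ∀ x ∉ S, ρ ≤ ‖x‖ → ‖x‖ * ‖tangentialField A x‖ ≤ C := by
  obtain ⟨ν₁, ν₂, h1, -, -⟩ := h
  exact h1.exists_mul_le (exists_mul_div_pow_le ν₁ 1) (exists_mul_div_le hr₀ ν₂)

theorem FieldAssumptionTwo.exists_bound (hr₀ : 1 ≤ r₀) (h : FieldAssumptionTwo S r₀ A) :
    ∀ ρ > 0, ∃ C, ∀ x ∉ S, ρ ≤ ‖x‖ → ‖x‖ * ‖tangentialField A x‖ ≤ C := by
  obtain ⟨ν₁, c, μ, hc, hμ, h1, -⟩ := h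
  exact h1.exists_mul_le (exists_mul_div_pow_le ν₁ 1) (exists_mul_div_rpow_le hr₀ hc hμ)

/-- The derivative of σ ↦ V(e^σ x) is r ∂_r V at e^σ x, which is at least -C; the mean value
inequality turns this into the one-sided difference bound. -/
theorem sub_exp_smul_le_of_radialDeriv (hS : IsSingularCone S)
    (hV : RadiallyDifferentiableOff S V) {ρ C : ℝ} (hρ : 0 < ρ)
    (hC : ∀ x ∉ S, ρ ≤ ‖x‖ → ‖x‖ * (radialDeriv V x)⁻ ≤ C) {x : Space d} (hx : x ∉ S)
    (hxρ : ρ ≤ ‖x‖) {s : ℝ} (hs : 0 ≤ s) : V x - V (Real.exp s • x) ≤ C * s := by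
  have hx0 : 0 < ‖x‖ := hρ.trans_le hxρ
  have hnorm : ∀ σ : ℝ, ‖Real.exp σ • x‖ = Real.exp σ * ‖x‖ := fun σ => norm_cutoff_comp σ x
  have hray : ∀ σ : ℝ, alongRay V (Real.exp σ • x) = alongRay V x := fun σ => by
    ext t
    have : (Real.exp σ * ‖x‖)⁻¹ * Real.exp σ = ‖x‖⁻¹ := by
      have := (Real.exp_pos σ).ne'
      field_simp
    rw [alongRay, alongRay, hnorm, smul_smul _ (Real.exp σ), this]
  have hval : ∀ σ : ℝ, V (Real.exp σ • x) = alongRay V x (Real.exp σ * ‖x‖) := fun σ => by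
    rw [alongRay, smul_smul, mul_assoc, mul_inv_cancel₀ hx0.ne', mul_one]
  have hd : ∀ σ : ℝ, HasDerivAt (fun σ => V (Real.exp σ • x))
      (radialDeriv V (Real.exp σ • x) * (Real.exp σ * ‖x‖)) σ := fun σ => by
    have h1 := (hV _ (hS.exp_smul_notMem hx σ)).hasDerivAt
    rw [hray, hnorm] at h1
    have h2 := h1.comp σ ((Real.hasDerivAt_exp σ).mul_const ‖x‖)
    rw [radialDeriv, hray, hnorm]
    exact h2.congr_of_eventuallyEq (Eventually.of_forall hval)
  have key := (convex_Icc (0 : ℝ) s).mul_sub_le_image_sub_of_le_deriv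
    (f := fun σ => V (Real.exp σ • x)) (C := -C)
    (fun σ _ => (hd σ).continuousAt.continuousWithinAt)
    (fun σ _ => (hd σ).differentiableAt.differentiableWithinAt) (fun σ hσ => by
      rw [interior_Icc] at hσ
      rw [(hd σ).deriv]
      have h1 := hC _ (hS.exp_smul_notMem hx σ) (by
        rw [hnorm]
        exact hxρ.trans (le_mul_of_one_le_left hx0.le (Real.one_le_exp hσ.1.le)))
      rw [hnorm] at h1
      have h2 : -(radialDeriv V (Real.exp σ • x))⁻ ≤ radialDeriv V (Real.exp σ • x) := by
        rw [neg_le]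
        exact neg_le_negPart _
      have h3 : 0 ≤ Real.exp σ * ‖x‖ := by positivity
      nlinarith [mul_le_mul_of_nonneg_right h2 h3]) 0 ⟨le_rfl, hs⟩ s ⟨hs, le_rfl⟩ hs
  rw [Real.exp_zero, one_smul] at key
  linarith

theorem LocallyBoundedOffOrigin.add_const (h : LocallyBoundedOffOrigin S V) (c : ℝ) :
    LocallyBoundedOffOrigin S fun x => V x + c := fun K hK h0 => by
  obtain ⟨C, hC⟩ := h K hK h0
  exact ⟨C + |c|, fun x hx => (abs_add_le _ _).trans (add_le_add_left (hC x hx) _)⟩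

theorem locallyBoundedOffOrigin_const (c : ℝ) :
    LocallyBoundedOffOrigin S fun _ => c := fun _ _ _ => ⟨|c|, fun _ _ => le_rfl⟩

/-- The powers 3/2 and 1/2 become integers after squaring: V² r is at most γ₁²/r² in the inner zone
and γ₂² (log r + 1) in the outer one, and K ≥ 1 compares the logarithm with ℓ. -/
theorem sq_mul_le_of_twoZoneBound (hr₀ : 1 ≤ r₀) {γ₁ γ₂ : ℝ}
    (h : TwoZoneBound S r₀ (fun x => |V x|) (fun r => γ₁ / r ^ (3 / 2 : ℝ))
        (fun r => γ₂ * (Real.log r + 1) ^ (1 / 2 : ℝ) / r ^ (1 / 2 : ℝ))) {ρ K : ℝ} (hρ : 0 < ρ)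
    (hK1 : 1 ≤ K) (hK : 1 ≤ phaseSlope K ρ) {x : Space d} (hx : x ∉ S) (hxρ : ρ ≤ ‖x‖) :
    V x ^ 2 * ‖x‖ ≤ (γ₁ ^ 2 / ρ ^ 2 + γ₂ ^ 2) * phaseSlope K ‖x‖ := by
  set r := ‖x‖
  have hr : 0 < r := hρ.trans_le hxρ
  have hℓ : 1 ≤ phaseSlope K r := hK.trans (monotoneOn_phaseSlope hρ (le_refl ρ) hxρ hxρ)
  have hsq : ∀ y p : ℝ, 0 ≤ y → (y ^ (p / 2)) ^ 2 = y ^ p := fun y p hy => by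
    rw [← Real.rpow_natCast, ← Real.rpow_mul hy]
    norm_num
  have hV := pow_le_pow_left₀ (abs_nonneg _) (h x hx) 2
  rw [sq_abs] at hV
  split_ifs at hV with hc
  · rw [div_pow, hsq r 3 hr.le, show (3 : ℝ) = ((3 : ℕ) : ℝ) by norm_num, Real.rpow_natCast] at hV
    calc V x ^ 2 * r ≤ γ₁ ^ 2 / r ^ 3 * r := by gcongr
      _ = γ₁ ^ 2 / r ^ 2 := by field_simp
      _ ≤ γ₁ ^ 2 / ρ ^ 2 := by gcongr
      _ ≤ (γ₁ ^ 2 / ρ ^ 2 + γ₂ ^ 2) * 1 := by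
        rw [mul_one]
        exact le_add_of_nonneg_right (sq_nonneg _)
      _ ≤ _ := by gcongr
  · have hr1 : 1 ≤ r := hr₀.trans (not_le.1 hc).le
    have hl : 0 ≤ Real.log r + 1 := by linarith [Real.log_nonneg hr1]
    rw [div_pow, mul_pow, hsq _ 1 hl, hsq _ 1 hr.le, Real.rpow_one, Real.rpow_one] at hV
    calc V x ^ 2 * r ≤ γ₂ ^ 2 * (Real.log r + 1) / r * r := by gcongr
      _ = γ₂ ^ 2 * (Real.log r + 1) := by field_simp
      _ ≤ γ₂ ^ 2 * phaseSlope K r := by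
        gcongr
        rw [phaseSlope]
        linarith
      _ ≤ _ := by
        gcongr
        exact le_add_of_nonneg_left (by positivity)

theorem one_le_phaseSlope (ρ : ℝ) : 1 ≤ phaseSlope (1 + |Real.log ρ|) ρ := by
  rw [phaseSlope]
  linarith [neg_abs_le (Real.log ρ)]

theorem locallyBoundedOffOrigin_of_twoZoneBound (hr₀ : 1 ≤ r₀) {γ₁ γ₂ : ℝ}
    (h : TwoZoneBound S r₀ (fun x => |V x|) (fun r => γ₁ / r ^ (3 / 2 : ℝ))
        (fun r => γ₂ * (Real.log r + 1) ^ (1 / 2 : ℝ) / r ^ (1 / 2 : ℝ))) :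
    LocallyBoundedOffOrigin S V := by
  intro K hK h0
  obtain ⟨ρ, hρ, hball⟩ := Metric.mem_nhds_iff.1 (hK.isClosed.isOpen_compl.mem_nhds h0)
  obtain ⟨R, hR⟩ := hK.isBounded.exists_norm_le
  set κ := 1 + |Real.log ρ| with hκ
  set C := (γ₁ ^ 2 / ρ ^ 2 + γ₂ ^ 2) * phaseSlope κ R / ρ with hC
  refine ⟨C + 1, fun x hx => ?_⟩
  have hxρ : ρ ≤ ‖x‖ := by
    by_contra hlt
    exact hball (mem_ball_zero_iff.2 (not_le.1 hlt)) hx.1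
  have h1 := sq_mul_le_of_twoZoneBound hr₀ h hρ (le_add_of_nonneg_right (abs_nonneg _))
    (one_le_phaseSlope ρ) hx.2 hxρ
  have h2 : phaseSlope κ ‖x‖ ≤ phaseSlope κ R :=
    monotoneOn_phaseSlope hρ hxρ (hxρ.trans (hR x hx.1)) (hR x hx.1)
  have h3 : V x ^ 2 ≤ C := by
    rw [hC, le_div_iff₀ hρ]
    calc V x ^ 2 * ρ ≤ V x ^ 2 * ‖x‖ := by gcongr
      _ ≤ _ := h1
      _ ≤ _ := by gcongr
  have h4 : |V x| ≤ V x ^ 2 + 1 := by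
    rw [← sq_abs (V x)]
    nlinarith [sq_nonneg (|V x| - 1), abs_nonneg (V x)]
  linarith

end Hypotheses

/-! ### The eigenvalue equation in weak form and the theorem -/

section Conclusion

variable {d : ℕ} {S : Set (Space d)} {A : Space d → Space d} {V : Space d → ℝ}
  {u : Space d → ℂ} {G : Space d → EuclideanSpace ℂ (Fin d)} {h : Space d → ℂ}

/-- Solutions of `(H_{A,V} + λ) u = 0` are weak solutions with the potential `V + λ`. -/
theorem MemDistortedSobolev.isWeakSolution (hS : IsSingularCone S) (hA : ContDiffOn ℝ 1 A Sᶜ)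
    (hV : AEStronglyMeasurable V volume) (hb : LocallyBoundedOffOrigin S V)
    (hu : MemDistortedSobolev S A V u G h) {lam : ℝ}
    (heq : ∀ᵐ x, h x + (lam : ℂ) * u x = 0) :
    IsWeakSolution S A (fun x => V x + lam) u G := by
  intro φ hφ
  have hK : IsCompact (tsupport φ) := hφ.compact
  have h0 := zero_notMem_of_subset_compl hS hφ.support
  have mG := memLp_indicator_of_memLp_restrict hK
    (memLp_restrict_of_hasMagneticGrad hS hA hu.grad _ hK h0)
  have mφ := hφ.isC1Test.memLp
  have iG : Integrable (fun x => inner ℂ (magneticGrad A φ x) (G x)) volume := by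
    refine (integrable_inner_of_memLp (hφ.isC1Test.memLp_magneticGrad hS hA) mG).congr
      (Eventually.of_forall fun x => ?_)
    by_cases hx : x ∈ tsupport φ
    · simp [Set.indicator_of_mem hx]
    · simp [magneticGrad_eq_zero hx]
  have iV : Integrable (fun x => (V x : ℂ) * u x * star (φ x)) volume := by
    refine (integrable_inner_of_memLp mφ (memLp_potential_mul hS hV hb hu.memLp hK h0)).congr
      (Eventually.of_forall fun x => ?_)
    by_cases hx : x ∈ tsupport φ
    · simp [Set.indicator_of_mem hx, RCLike.inner_apply]
    · simp [image_eq_zero_of_notMem_tsupport hx]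
  have iu : Integrable (fun x => u x * star (φ x)) volume :=
    (integrable_inner_of_memLp mφ hu.memLp).congr
      (Eventually.of_forall fun x => by simp [RCLike.inner_apply])
  have key := hu.op φ hφ
  have e1 : ∫ x, h x * star (φ x) = -((lam : ℂ) * ∫ x, u x * star (φ x)) := by
    rw [← integral_const_mul, ← integral_neg]
    refine integral_congr_ae ?_
    filter_upwards [heq] with x hx
    rw [eq_neg_of_add_eq_zero_left hx]
    ring
  rw [integral_add (f := fun x => -inner ℂ (magneticGrad A φ x) (G x)) iG.neg iV, integral_neg,
    e1] at key
  have e2 : ∫ x, inner ℂ (φ x) (((V x + lam : ℝ) : ℂ) * u x) =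
      (∫ x, (V x : ℂ) * u x * star (φ x)) + (lam : ℂ) * ∫ x, u x * star (φ x) := by
    rw [← integral_const_mul, ← integral_add iV (iu.const_mul _)]
    congr 1
    ext x
    rw [RCLike.inner_apply, ← starRingEnd_apply]
    push_cast
    ring
  rw [e2]
  linear_combination -key

end Conclusion

end

end MagneticSchrodinger

theorem theorem1p1 {d : ℕ} (hd : 3 ≤ d) (lam : ℝ) (hlam : 0 ≤ lam) (r₀ : ℝ) (hr₀ : 1 ≤ r₀)
    (S : Set (Space d)) (hS : IsSingularCone S)
    (A : Space d → Space d) (hA : ContDiffOn ℝ 1 A Sᶜ)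
    (V : Space d → ℝ) (hV : AEStronglyMeasurable V volume)
    (hyp : HypothesisOne S r₀ A V ∨ HypothesisTwo S r₀ A V)
    (u : Space d → ℂ) (gradAu : Space d → EuclideanSpace ℂ (Fin d)) (Hu : Space d → ℂ)
    (hu : MemDistortedSobolev S A V u gradAu Hu)
    (heq : ∀ᵐ x ∂(volume : Measure (Space d)), Hu x + (lam : ℂ) * u x = 0)
    (hdecay : HasFastDecay u gradAu) :
    ∀ᵐ x ∂(volume : Measure (Space d)), u x = 0 := by
  have hd2 : 2 ≤ d := by omega
  rcases hyp with ⟨hb, hdiff, hass, -⟩ | ⟨hfield, γ₁, γ₂, -, -, hγ⟩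
  · have hsol := hu.isWeakSolution hS hA hV hb heq
    have hbounds := hass.elim (fun h => h.exists_bounds hr₀) fun h => h.exists_bounds hr₀
    -- Under hypothesis (i) all of V + λ goes through its radial differences, where the constant λ
    -- cancels.
    refine IsWeakSolution.ae_eq_zero (V₁ := fun x => V x + lam) (V₂ := fun _ => 0) hd2 hS hA
      hu.memLp hu.grad hdecay (hV.add aestronglyMeasurable_const) aestronglyMeasurable_const
      (hb.add_const lam) (locallyBoundedOffOrigin_const 0) (by simpa only [add_zero] using hsol)
      hbounds.1 (fun ρ hρ => ?_) fun ρ _ => ⟨1 + |Real.log ρ|, 0, one_le_phaseSlope ρ, by simp⟩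
    obtain ⟨C, hC⟩ := hbounds.2 ρ hρ
    refine ⟨C, fun x hx hxρ s hs _ => ?_⟩
    rw [add_sub_add_right_eq_sub]
    exact sub_exp_smul_le_of_radialDeriv hS hdiff hρ hC hx hxρ hs
  · have hb := locallyBoundedOffOrigin_of_twoZoneBound hr₀ hγ
    have hsol := hu.isWeakSolution hS hA hV hb heq
    -- Under hypothesis (ii) V is controlled by size. Only λ, whose radial differences are zero,
    -- goes into V₁.
    refine IsWeakSolution.ae_eq_zero (V₁ := fun _ => lam) (V₂ := V) hd2 hS hA hu.memLp hu.grad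
      hdecay aestronglyMeasurable_const hV (locallyBoundedOffOrigin_const lam) hb
      (by simpa only [add_comm] using hsol)
      (hfield.elim (fun h => h.exists_bound hr₀) fun h => h.exists_bound hr₀)
      (fun ρ _ => ⟨0, fun x _ _ s _ _ => by simp⟩) fun ρ hρ =>
      ⟨1 + |Real.log ρ|, γ₁ ^ 2 / ρ ^ 2 + γ₂ ^ 2, one_le_phaseSlope ρ, fun x hx hxρ =>
        sq_mul_le_of_twoZoneBound hr₀ hγ hρ (le_add_of_nonneg_right (abs_nonneg _))
          (one_le_phaseSlope ρ) hx hxρ⟩
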